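/- Three point particles 1, 2, 3 with masses $m_1,m_2,m_3>0$ move in the plane; put $a=m_1/m_2$, $b=m_3/m_2$. Initially 2 and 3 are at rest at two distinct points and 1 moves with a non-zero velocity. The particles move freely except for hard contact binary collisions: two particles at the same point exchange momentum so that total momentum and total kinetic energy are conserved, the third particle is unaffected, and the velocities do change (scattering angle $0$ is not a collision). A collision is denoted by the number of the particle not involved in it, and a sequence of collisions by the string of these numbers in order of occurrence, with a positive time between successive collisions. The sequence $w$ is *allowed* at $(a,b)$ if the initial data and the scattering can be chosen so that precisely the collisions of $w$ occur and after the last of them 1 and 2 have the same velocity (capture). Let $R(w)\subset Q=\{a>0,b>0\}$ be the set of $(a,b)$ at which $w$ is allowed. A pair $(a,b)\in Q$ is *Thomas-forbidden* if none of $(31)$, $(32)$, $(21)$ is allowed there. For $n\ge 1$ define curves $$C_{2n-1}:\ a=\cot\tfrac{\theta}{2}\cot n\theta,\quad b=\cot n\theta\,\cot\left(n-\tfrac12\right)\theta,\qquad \tfrac{(2n-2)\pi}{2n-1}<\theta<\tfrac{(2n-1)\pi}{2n},$$ $$C_{2n}:\ a=-\cot\tfrac{\theta}{2}\cot n\theta,\quad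 b=\cot n\theta\,\cot\left(n+\tfrac12\right)\theta,\qquad \tfrac{(2n-1)\pi}{2n}<\theta<\tfrac{2n\pi}{2n+1}.$$ ($C_1$ is the line $b=a$.) Say that $(a,b)$ is above a curve $C$ if $(a,y)\in C$ for some $y<b$. Then: 1. For every $n\ge1$ the regions $R((32)^n)$, $R((2)(32)^n)$, $R((21)^n)$, $R((21)^n(2))$ and $R((31)^n)$ all have non-empty interior. 2. For every $n\ge1$, $R((32)^n)$ is the set of points of $Q$ above $C_{2n-1}$ and not above $C_{2n}$, and $R((2)(32)^n)$ is the set of points of $Q$ above $C_{2n}$ and not above $C_{2n+1}$. The boundary in $Q$ of the former is $C_{2n-1}\cup C_{2n}$ and that of the latter is $C_{2n}\cup C_{2n+1}$, so that successive regions are contiguous. 3. For every $n\ge1$ the curves $C_{2n}$ and $C_{2n+1}$ both have the vertical asymptote $a=\tan^2\frac{\pi}{2(2n+1)}$ (they contain points with arbitrarily large $b$, and $a$ tends to this value as $b\to\infty$ along them), and $\tan^2\frac{\pi}{2(2m+1)}\to0$ as $m\to\infty$. 4. The regions of all the sequences $(32)^n$, $(2)(32)^n$, $(21)^n$, $(21)^n(2)$,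 $n\ge1$, are pairwise disjoint. Those of $(32)^n$, $(2)(32)^n$, $n\ge1$, together cover exactly $\{0<a<b\}$, and those of $(21)^n$, $(21)^n(2)$, $n\ge1$, cover exactly $\{0<b<a\}$. 5. For all $n\ge1$ and all real $a,b$: $(b,a)\in R((21)^n)$ if and only if $(a,b)\in R((32)^n)$, and $(b,a)\in R((21)^n(2))$ if and only if $(a,b)\in R((2)(32)^n)$. 6. No Thomas-forbidden pair lies in $R((31)^n)$ for any $n\ge1$, and for every Thomas-forbidden pair $(a,b)$ there is exactly one collision sequence, among all finite sequences of collisions, that is allowed at $(a,b)$. -/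

import Mathlib

open Set Filter Topology

noncomputable section

/-- The three particles. A binary collision is labelled by its spectator, i.e. by the particle
that does not take part in it, so `p3` also stands for a collision between particles 1 and 2. -/
inductive Particle
  | p1
  | p2
  | p3

open Particle

/-- A (planar) configuration: a complex number (position or velocity) for each particle. -/
abbrev Config := Particle → ℂ

/-- Elastic scattering in the collision with spectator `k`, for masses proportional to
`a`, `1`, `b`: the velocities `v` become `v'`, the spectator is unaffected, total momentum and
total kinetic energy are conserved, and the velocities do change (a scattering angle zero is
no collision). -/
def Scatters (a b : ℝ) (k : Particle) (v v' : Config) : Prop :=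
  v' k = v k ∧
  (a : ℂ) * v' p1 + v' p2 + (b : ℂ) * v' p3 = (a : ℂ) * v p1 + v p2 + (b : ℂ) * v p3 ∧
  a * ‖v' p1‖ ^ 2 + ‖v' p2‖ ^ 2 + b * ‖v' p3‖ ^ 2 =
    a * ‖v p1‖ ^ 2 + ‖v p2‖ ^ 2 + b * ‖v p3‖ ^ 2 ∧
  v' ≠ v

/-- From positions `r` and velocities `v`, free flight interrupted exactly by the hard contact
collisions of the list (in order from left to right, with positive time before each of them) can
end with particles 1 and 2 having the same velocity. -/
def CapturesFrom (a b : ℝ) : List Particle → Config → Config → Prop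
  | [], _, v => v p1 = v p2
  | k :: w, r, v =>
      ∃ t : ℝ, 0 < t ∧ ∃ v' : Config,
        (∀ i j : Particle, i ≠ k → j ≠ k → r i + (t : ℂ) * v i = r j + (t : ℂ) * v j) ∧
        Scatters a b k v v' ∧
        CapturesFrom a b w (fun i => r i + (t : ℂ) * v i) v'

/-- Velocities before the process: particle 1 moves with velocity `u`, 2 and 3 are at rest. -/
def initialVelocity (u : ℂ) : Config
  | p1 => u
  | p2 => 0
  | p3 => 0

/-- The capture process with collision sequence `w` is kinematically possible for
`m₁ / m₂ = a`, `m₃ / m₂ = b`. -/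
def CaptureAllowed (a b : ℝ) (w : List Particle) : Prop :=
  ∃ (u : ℂ) (r : Config), u ≠ 0 ∧ r p2 ≠ r p3 ∧ CapturesFrom a b w r (initialVelocity u)

/-- The quadrant of mass ratios `(a, b)`. -/
def massQuadrant : Set (ℝ × ℝ) := {p | 0 < p.1 ∧ 0 < p.2}

/-- The region of the Lieber diagram in which the collision sequence `w` is allowed. -/
def allowedRegion (w : List Particle) : Set (ℝ × ℝ) :=
  {p | p ∈ massQuadrant ∧ CaptureAllowed p.1 p.2 w}

/-- The sequence `(xy)ⁿ`. -/
def pairPow (x y : Particle) (n : ℕ) : List Particle := (List.replicate n [x, y]).flatten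

/-- `(32)ⁿ` -/
def seq32 (n : ℕ) : List Particle := pairPow p3 p2 n

/-- `(2)(32)ⁿ` -/
def seq232 (n : ℕ) : List Particle := p2 :: pairPow p3 p2 n

/-- `(21)ⁿ` -/
def seq21 (n : ℕ) : List Particle := pairPow p2 p1 n

/-- `(21)ⁿ(2)` -/
def seq212 (n : ℕ) : List Particle := pairPow p2 p1 n ++ [p2]

/-- `(31)ⁿ` -/
def seq31 (n : ℕ) : List Particle := pairPow p3 p1 n

/-- All sequences `(32)ⁿ` and `(2)(32)ⁿ` with `n ≥ 1`. -/
def upperSeqs : Set (List Particle) := {w | ∃ n : ℕ, 1 ≤ n ∧ (w = seq32 n ∨ w = seq232 n)}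

/-- All sequences `(21)ⁿ` and `(21)ⁿ(2)` with `n ≥ 1`. -/
def lowerSeqs : Set (List Particle) := {w | ∃ n : ℕ, 1 ≤ n ∧ (w = seq21 n ∨ w = seq212 n)}

/-- Mass ratios for which the three Thomas double-collision processes (31), (32), (21) are all
impossible. -/
def thomasForbidden : Set (ℝ × ℝ) :=
  {p | p ∈ massQuadrant ∧ ¬ CaptureAllowed p.1 p.2 [p3, p1] ∧
    ¬ CaptureAllowed p.1 p.2 [p3, p2] ∧ ¬ CaptureAllowed p.1 p.2 [p2, p1]}

/-- The boundary curve `C_{2n-1}`, for `n ≥ 1`. The end points of the range of `θ` correspond to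
the origin and to the asymptote and are no pairs of mass ratios. -/
def oddCurve (n : ℕ) : Set (ℝ × ℝ) :=
  {p | ∃ θ ∈ Ioo ((2 * (n : ℝ) - 2) * Real.pi / (2 * n - 1)) ((2 * (n : ℝ) - 1) * Real.pi / (2 * n)),
    p.1 = Real.cot (θ / 2) * Real.cot (n * θ) ∧
    p.2 = Real.cot (n * θ) * Real.cot (((n : ℝ) - 1 / 2) * θ)}

/-- The boundary curve `C_{2n}`, for `n ≥ 1`. -/
def evenCurve (n : ℕ) : Set (ℝ × ℝ) :=
  {p | ∃ θ ∈ Ioo ((2 * (n : ℝ) - 1) * Real.pi / (2 * n)) ((2 * (n : ℝ)) * Real.pi / (2 * n + 1)),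
    p.1 = -(Real.cot (θ / 2) * Real.cot (n * θ)) ∧
    p.2 = Real.cot (n * θ) * Real.cot (((n : ℝ) + 1 / 2) * θ)}

/-- The points that lie strictly above a curve (vertically, in the direction of `b`). -/
def strictlyAbove (C : Set (ℝ × ℝ)) : Set (ℝ × ℝ) := {p | ∃ y, (p.1, y) ∈ C ∧ y < p.2}

/-- The region between two curves, with the upper curve included and the lower one excluded.
Over an `a` that only the lower curve reaches, the region is unbounded in `b`. -/
def between (C D : Set (ℝ × ℝ)) : Set (ℝ × ℝ) := strictlyAbove C \ strictlyAbove D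

/-- The curve `C` has the vertical asymptote `a = c`: it contains points with arbitrarily large
`b`, and `a → c` as `b → ∞` along `C`. -/
def HasVerticalAsymptote (C : Set (ℝ × ℝ)) (c : ℝ) : Prop :=
  (comap Prod.snd atTop ⊓ 𝓟 C : Filter (ℝ × ℝ)).NeBot ∧
  Tendsto Prod.fst (comap Prod.snd atTop ⊓ 𝓟 C : Filter (ℝ × ℝ)) (𝓝 c)

end

/-! ### Relative motion in ℂ²: the form, the collision lines and their angles. -/

noncomputable section

open Particle

/-! Modulo translation, positions and velocities form ℂ² with the Hermitian form `herm`, and the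
configurations in which a given pair coincides form a complex line. The three lines make acute
angles ω₁, ω₂, ω₃ (`midAngle`) with sum π, and a = tan ω₁ / tan ω₂, b = tan ω₃ / tan ω₂; so pairs of
mass ratios correspond to acute triangles.

In free flight the position r turns in a real plane. Its angle Θ with the velocity v falls from π to
0 over the whole history. A collision conserves `herm r v` and the norm of v, hence Θ and the
normalised imaginary part j, although the plane changes. If the angle σ is swept between events on
the lines k and l, then sin ω_kl = κ sin σ with κ² = 1 − j², where ω_kl is the angle between the
lines. The initial velocity lies on the line of spectator 1 (Θ = π), the velocity after capture on
that of spectator 3 (Θ = 0). So a sequence is allowed iff its swept angles can be made to add up to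
π: a polygon with sides sin ω_kl is inscribed in a circle of diameter κ ≤ 1. In addition every
collision must really deflect. This is `captureAllowed_cons_iff`.

For (32)ⁿ, (2)(32)ⁿ, (21)ⁿ, (21)ⁿ(2) the polygon has one side sin A and N sides sin B, and it exists
with genuine deflections iff A ≤ N B and A + N B < π. The first is a polygon inequality
(`le_mul_of_inscribed`). The second comes from ω_kl ≤ σ, with equality excluded by deflection. The
converse is an intermediate value argument (`exists_inscribed`). Since the ω's add up to π, the two
conditions for (32)ⁿ and (2)(32)ⁿ say that `margin N` ≤ 0 and that `margin (N - 1)` > 0, so the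
regions are bands between consecutive zero curves. `margin_pos_of_succ` makes the bands disjoint,
`margin_pos_of_lt` gives their shape, and θ = π − 2ω₁ parametrises the curves. Exchanging the masses
exchanges ω₁ and ω₃.

For (31)ⁿ all sides are sin ω₂ and the condition is (2n+1) ω₂ ≤ π. A Thomas-forbidden pair thus has
ω₂ > π/3, and then the bound π on the sum of the line angles excludes everything but the four
families above and the single collision (2), which occurs exactly for a = b. -/

open ComplexConjugate in
/-- The Hermitian form of the relative motion, for masses `a`, `1`, `b`. -/
def herm (a b : ℝ) (x y : Config) : ℂ :=
  a * ((x p1 - x p2) * conj (y p1 - y p2)) + b * ((x p2 - x p3) * conj (y p2 - y p3)) +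
    a * b * ((x p1 - x p3) * conj (y p1 - y p3))

/-- The quadratic form belonging to `herm`. -/
def nsq (a b : ℝ) (x : Config) : ℝ :=
  a * ‖x p1 - x p2‖ ^ 2 + b * ‖x p2 - x p3‖ ^ 2 + a * b * ‖x p1 - x p3‖ ^ 2

/-- Configurations in which the two particles other than `k` coincide. -/
def OnLine (k : Particle) (r : Config) : Prop := ∀ i j : Particle, i ≠ k → j ≠ k → r i = r j

/-- Real linear combinations of configurations. -/
def lin (c : ℝ) (x : Config) (d : ℝ) (y : Config) : Config := fun i => (c : ℂ) * x i + (d : ℂ) * y i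

/-- The angle between the collision lines next to the sector with particle `k` in the middle. -/
def midAngle (a b : ℝ) : Particle → ℝ
  | p1 => Real.arctan (√(a * (1 + a + b) / b))
  | p2 => Real.arctan (√((1 + a + b) / (a * b)))
  | p3 => Real.arctan (√(b * (1 + a + b) / a))

/-- The angle between the collision lines with spectators `k` and `l`. -/
def lineAngle (a b : ℝ) : Particle → Particle → ℝ
  | p1, p2 => midAngle a b p3
  | p2, p1 => midAngle a b p3
  | p1, p3 => midAngle a b p2
  | p3, p1 => midAngle a b p2
  | p2, p3 => midAngle a b p1
  | p3, p2 => midAngle a b p1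
  | p1, p1 => 0
  | p2, p2 => 0
  | p3, p3 => 0

/-! ### The triangle of angles. -/

section Angles

variable {a b : ℝ}

lemma lineAngle_self (k : Particle) : lineAngle a b k k = 0 := by cases k <;> rfl

lemma lineAngle_comm (k l : Particle) : lineAngle a b k l = lineAngle a b l k := by
  cases k <;> cases l <;> rfl

lemma midAngle_swap (a b : ℝ) :
    midAngle b a p1 = midAngle a b p3 ∧ midAngle b a p2 = midAngle a b p2 ∧
      midAngle b a p3 = midAngle a b p1 := by
  refine ⟨?_, ?_, ?_⟩ <;> simp only [midAngle] <;> congr 2 <;> ring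

lemma midAngle_pos (ha : 0 < a) (hb : 0 < b) (k : Particle) : 0 < midAngle a b k := by
  cases k <;> simp only [midAngle] <;> apply Real.arctan_pos.2 <;> positivity

lemma midAngle_lt (k : Particle) : midAngle a b k < Real.pi / 2 := by
  cases k <;> exact Real.arctan_lt_pi_div_two _

lemma tan_sq_midAngle (ha : 0 < a) (hb : 0 < b) :
    Real.tan (midAngle a b p1) ^ 2 = a * (1 + a + b) / b ∧
    Real.tan (midAngle a b p2) ^ 2 = (1 + a + b) / (a * b) ∧
    Real.tan (midAngle a b p3) ^ 2 = b * (1 + a + b) / a := by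
  refine ⟨?_, ?_, ?_⟩ <;> simp only [midAngle, Real.tan_arctan] <;>
    exact Real.sq_sqrt (by positivity)

lemma tan_midAngle_pos (ha : 0 < a) (hb : 0 < b) (k : Particle) : 0 < Real.tan (midAngle a b k) :=
  Real.tan_pos_of_pos_of_lt_pi_div_two (midAngle_pos ha hb k) (midAngle_lt k)

lemma tan_midAngle_one (ha : 0 < a) (hb : 0 < b) :
    Real.tan (midAngle a b p1) = a * Real.tan (midAngle a b p2) := by
  have h1 := tan_midAngle_pos ha hb p1
  have h2 := tan_midAngle_pos ha hb p2
  obtain ⟨e1, e2, -⟩ := tan_sq_midAngle ha hb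
  refine (sq_eq_sq₀ h1.le (by positivity)).1 ?_
  rw [mul_pow, e1, e2]; field_simp

lemma tan_midAngle_three (ha : 0 < a) (hb : 0 < b) :
    Real.tan (midAngle a b p3) = b * Real.tan (midAngle a b p2) := by
  have h1 := tan_midAngle_pos ha hb p3
  have h2 := tan_midAngle_pos ha hb p2
  obtain ⟨-, e2, e1⟩ := tan_sq_midAngle ha hb
  refine (sq_eq_sq₀ h1.le (by positivity)).1 ?_
  rw [mul_pow, e1, e2]; field_simp

/-- With T = tan ω₂ the other tangents are aT and bT, and abT² = 1 + a + b says that the three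
tangents have equal sum and product. -/
lemma midAngle_sum (ha : 0 < a) (hb : 0 < b) :
    midAngle a b p1 + midAngle a b p2 + midAngle a b p3 = Real.pi := by
  have t1 := tan_midAngle_one ha hb
  have t3 := tan_midAngle_three ha hb
  have h2 := tan_midAngle_pos ha hb p2
  obtain ⟨-, e2, -⟩ := tan_sq_midAngle ha hb
  set T := Real.tan (midAngle a b p2) with hT
  have hT2 : Real.arctan T = midAngle a b p2 := by
    rw [hT, Real.arctan_tan] <;> linarith [midAngle_pos ha hb p2, midAngle_lt (a := a) (b := b) p2]
  have hT1 : Real.arctan (a * T) = midAngle a b p1 := by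
    rw [← t1, Real.arctan_tan] <;>
      linarith [midAngle_pos ha hb p1, midAngle_lt (a := a) (b := b) p1]
  have hT3 : Real.arctan (b * T) = midAngle a b p3 := by
    rw [← t3, Real.arctan_tan] <;>
      linarith [midAngle_pos ha hb p3, midAngle_lt (a := a) (b := b) p3]
  have e2' : a * b * T ^ 2 = 1 + a + b := by rw [e2]; field_simp
  have e3 : a * T * T = (1 + a + b) / b := by field_simp; linarith
  have h1 : 1 < a * T * T := by rw [e3, lt_div_iff₀ hb]; linarith
  rw [← hT1, ← hT2, ← hT3, Real.arctan_add_eq_add_pi h1 (by positivity)]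
  have : (a * T + T) / (1 - a * T * T) = -(b * T) := by
    rw [div_eq_iff (by linarith)]
    linear_combination (-T) * e2'
  rw [this, Real.arctan_neg]; ring

lemma cos_sq_midAngle (ha : 0 < a) (hb : 0 < b) :
    Real.cos (midAngle a b p1) ^ 2 = b / ((a + b) * (1 + a)) ∧
    Real.cos (midAngle a b p2) ^ 2 = a * b / ((1 + a) * (1 + b)) ∧
    Real.cos (midAngle a b p3) ^ 2 = a / ((a + b) * (1 + b)) := by
  refine ⟨?_, ?_, ?_⟩ <;> simp only [midAngle, Real.cos_sq_arctan] <;>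
    rw [Real.sq_sqrt (by positivity)] <;> field_simp <;> ring

lemma lineAngle_nonneg (ha : 0 < a) (hb : 0 < b) (k l : Particle) : 0 ≤ lineAngle a b k l := by
  cases k <;> cases l <;> simp only [lineAngle, le_refl] <;> exact (midAngle_pos ha hb _).le

lemma lineAngle_pos (ha : 0 < a) (hb : 0 < b) {k l : Particle} (h : k ≠ l) :
    0 < lineAngle a b k l := by
  cases k <;> cases l <;> simp only [lineAngle, ne_eq, not_true_eq_false] at * <;>
    exact (midAngle_pos ha hb _)

lemma lineAngle_lt (k l : Particle) : lineAngle a b k l < Real.pi / 2 := by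
  have := Real.pi_pos
  cases k <;> cases l <;> simp only [lineAngle] <;> first | exact midAngle_lt _ | linarith

lemma lineAngle_triangle (ha : 0 < a) (hb : 0 < b) {k l m : Particle} (h1 : k ≠ l) (h2 : l ≠ m)
    (h3 : k ≠ m) : lineAngle a b k l + lineAngle a b l m + lineAngle a b k m = Real.pi := by
  have := midAngle_sum ha hb
  cases k <;> cases l <;> cases m <;> simp_all only [ne_eq, not_true_eq_false, reduceCtorEq,
    not_false_eq_true] <;> simp only [lineAngle] <;> linarith

lemma cos_lineAngle_pos (ha : 0 < a) (hb : 0 < b) (k l : Particle) :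
    0 < Real.cos (lineAngle a b k l) :=
  Real.cos_pos_of_mem_Ioo
    ⟨by linarith [lineAngle_nonneg ha hb k l, Real.pi_pos], lineAngle_lt k l⟩

lemma sin_lineAngle_nonneg (ha : 0 < a) (hb : 0 < b) (k l : Particle) :
    0 ≤ Real.sin (lineAngle a b k l) :=
  Real.sin_nonneg_of_nonneg_of_le_pi (lineAngle_nonneg ha hb k l)
    (by linarith [lineAngle_lt (a := a) (b := b) k l, Real.pi_pos])

lemma sin_lineAngle_pos (ha : 0 < a) (hb : 0 < b) {k l : Particle} (h : k ≠ l) :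
    0 < Real.sin (lineAngle a b k l) :=
  Real.sin_pos_of_pos_of_lt_pi (lineAngle_pos ha hb h)
    (by linarith [lineAngle_lt (a := a) (b := b) k l, Real.pi_pos])

end Angles

/-! ### The Hermitian form. -/

section Hermitian

variable {a b : ℝ}

open ComplexConjugate

lemma herm_self (x : Config) : herm a b x x = (nsq a b x : ℂ) := by
  simp only [herm, nsq, Complex.mul_conj, Complex.normSq_eq_norm_sq]; push_cast; ring

lemma herm_conj (x y : Config) : conj (herm a b x y) = herm a b y x := by
  simp only [herm, map_add, map_mul, map_sub, Complex.conj_ofReal, Complex.conj_conj]; ring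

lemma herm_lin_left (c d : ℝ) (x y z : Config) :
    herm a b (lin c x d y) z = c * herm a b x z + d * herm a b y z := by
  simp only [herm, lin]; ring

lemma herm_lin_right (c d : ℝ) (x y z : Config) :
    herm a b z (lin c x d y) = c * herm a b z x + d * herm a b z y := by
  simp only [herm, lin, map_add, map_mul, map_sub, Complex.conj_ofReal]; ring

lemma nsq_lin (c d : ℝ) (x y : Config) :
    nsq a b (lin c x d y) =
      c ^ 2 * nsq a b x + d ^ 2 * nsq a b y + 2 * c * d * (herm a b x y).re := by
  have h : ((nsq a b (lin c x d y) : ℝ) : ℂ) =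
      ((c ^ 2 * nsq a b x + d ^ 2 * nsq a b y + 2 * c * d * (herm a b x y).re : ℝ) : ℂ) := by
    rw [← herm_self, herm_lin_left, herm_lin_right, herm_lin_right, herm_self, herm_self,
      ← herm_conj x y]
    have := Complex.add_conj (herm a b x y)
    push_cast
    push_cast at this
    linear_combination (c : ℂ) * d * this
  exact_mod_cast h

lemma nsq_nonneg (ha : 0 < a) (hb : 0 < b) (x : Config) : 0 ≤ nsq a b x := by
  unfold nsq; positivity

lemma nsq_eq_zero (ha : 0 < a) (hb : 0 < b) {x : Config} (h : nsq a b x = 0) (i j : Particle) :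
    x i = x j := by
  unfold nsq at h
  have h1 : ‖x p1 - x p2‖ ^ 2 = 0 := by
    have : 0 ≤ ‖x p1 - x p2‖ ^ 2 := by positivity
    have h2 : 0 ≤ b * ‖x p2 - x p3‖ ^ 2 := by positivity
    have h3 : 0 ≤ a * b * ‖x p1 - x p3‖ ^ 2 := by positivity
    nlinarith
  have h2 : ‖x p2 - x p3‖ ^ 2 = 0 := by
    have : 0 ≤ ‖x p2 - x p3‖ ^ 2 := by positivity
    have h3 : 0 ≤ a * b * ‖x p1 - x p3‖ ^ 2 := by positivity
    rw [h1] at h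
    nlinarith
  have e1 : x p1 = x p2 := by simpa [sub_eq_zero] using h1
  have e2 : x p2 = x p3 := by simpa [sub_eq_zero] using h2
  cases i <;> cases j <;> simp [e1, e2]

lemma OnLine.lin {k : Particle} {x y : Config} (hx : OnLine k x) (hy : OnLine k y) (c d : ℝ) :
    OnLine k (lin c x d y) := fun i j hi hj => by
  simp only [_root_.lin, hx i j hi hj, hy i j hi hj]

lemma OnLine.nsq_eq_zero {k l : Particle} (h : k ≠ l) {x : Config}
    (hk : OnLine k x) (hl : OnLine l x) : nsq a b x = 0 := by
  have h12 : x p1 = x p2 ∧ x p2 = x p3 := by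
    cases k <;> cases l <;> simp only [ne_eq, not_true_eq_false] at h
    · exact ⟨(hl p1 p3 (by simp) (by simp)).trans (hk p3 p2 (by simp) (by simp)), hk _ _ (by simp) (by simp)⟩
    · exact ⟨hl _ _ (by simp) (by simp), hk _ _ (by simp) (by simp)⟩
    · exact ⟨(hk p1 p3 (by simp) (by simp)).trans (hl p3 p2 (by simp) (by simp)), hl _ _ (by simp) (by simp)⟩
    · exact ⟨hl _ _ (by simp) (by simp), (hl p2 p1 (by simp) (by simp)).trans (hk _ _ (by simp) (by simp))⟩
    · exact ⟨hk _ _ (by simp) (by simp), hl _ _ (by simp) (by simp)⟩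
    · exact ⟨hk _ _ (by simp) (by simp), (hk p2 p1 (by simp) (by simp)).trans (hl _ _ (by simp) (by simp))⟩
  simp [nsq, h12.1, h12.2]

end Hermitian

/-! ### Collision lines and the law of scattering. -/

/-- The masses of the particles, in units of the mass of particle 2. -/
def mass (a b : ℝ) : Particle → ℝ
  | p1 => a
  | p2 => 1
  | p3 => b

/-- The configuration in which particle `k` sits at `s + z` and the others at `s`. -/
def spike : Particle → ℂ → ℂ → Config
  | p1, z, s => fun | p1 => s + z | p2 => s | p3 => s
  | p2, z, s => fun | p1 => s | p2 => s + z | p3 => s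
  | p3, z, s => fun | p1 => s | p2 => s | p3 => s + z

section Lines

variable {a b : ℝ}

open ComplexConjugate

lemma mass_pos (ha : 0 < a) (hb : 0 < b) (k : Particle) : 0 < mass a b k := by
  cases k <;> simp [mass, ha, hb]

lemma onLine_spike (k : Particle) (z s : ℂ) : OnLine k (spike k z s) := by
  intro i j hi hj
  cases k <;> cases i <;> cases j <;> simp_all [spike]

lemma OnLine.exists_spike {k : Particle} {x : Config} (h : OnLine k x) :
    ∃ z s, x = spike k z s := by
  cases k
  · refine ⟨x p1 - x p2, x p2, funext fun i => ?_⟩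
    have := h p2 p3 (by simp) (by simp)
    cases i <;> simp [spike, this]
  · refine ⟨x p2 - x p1, x p1, funext fun i => ?_⟩
    have := h p1 p3 (by simp) (by simp)
    cases i <;> simp [spike, this]
  · refine ⟨x p3 - x p1, x p1, funext fun i => ?_⟩
    have := h p1 p2 (by simp) (by simp)
    cases i <;> simp [spike, this]

/-- Only the velocity of particle `k` relative to the centre of mass enters. For a spectator of
fixed velocity, conservation of this product is therefore conservation of momentum. -/
lemma herm_spike (k : Particle) (z s : ℂ) (v : Config) :
    herm a b (spike k z s) v =
      mass a b k * (z * conj ((1 + a + b) * v k - (a * v p1 + v p2 + b * v p3))) := by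
  cases k <;> simp only [herm, spike, mass, map_add, map_mul, map_sub, Complex.conj_ofReal,
    map_one, Complex.ofReal_one] <;> ring

lemma nsq_spike (k : Particle) (z s : ℂ) :
    nsq a b (spike k z s) = mass a b k * (1 + a + b - mass a b k) * ‖z‖ ^ 2 := by
  cases k <;> simp [nsq, spike, mass] <;> ring

lemma herm_spike_spike {k l : Particle} (h : k ≠ l) (z s w t : ℂ) :
    herm a b (spike k z s) (spike l w t) = -(mass a b k * mass a b l * (z * conj w)) := by
  cases k <;> cases l <;> simp only [ne_eq, not_true_eq_false] at h <;>
    simp only [herm, spike, mass, map_add, map_sub, Complex.ofReal_one] <;> ring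

lemma cos_sq_lineAngle (ha : 0 < a) (hb : 0 < b) {k l : Particle} (h : k ≠ l) :
    Real.cos (lineAngle a b k l) ^ 2 * ((1 + a + b - mass a b k) * (1 + a + b - mass a b l)) =
      mass a b k * mass a b l := by
  obtain ⟨h1, h2, h3⟩ := cos_sq_midAngle ha hb
  cases k <;> cases l <;> simp only [ne_eq, not_true_eq_false] at h <;>
    simp only [lineAngle, mass, h1, h2, h3] <;> field_simp <;> ring

/-- Collision lines are one-dimensional over ℂ, so the normalised modulus depends only on the two
lines; `lineAngle` is their Hermitian angle. -/
lemma OnLine.normSq_herm (ha : 0 < a) (hb : 0 < b) {k l : Particle} {x y : Config}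
    (hx : OnLine k x) (hy : OnLine l y) :
    Complex.normSq (herm a b x y) =
      Real.cos (lineAngle a b k l) ^ 2 * nsq a b x * nsq a b y := by
  obtain ⟨z, s, rfl⟩ := hx.exists_spike
  obtain ⟨w, t, rfl⟩ := hy.exists_spike
  by_cases h : k = l
  · subst h
    rw [lineAngle_self, Real.cos_zero, nsq_spike, nsq_spike]
    cases k <;>
    · simp only [herm, spike, mass, ← Complex.normSq_eq_norm_sq]
      simp only [Complex.normSq_apply, Complex.add_re, Complex.add_im, Complex.mul_re,
        Complex.mul_im, Complex.sub_re, Complex.sub_im, Complex.conj_re, Complex.conj_im,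
        Complex.ofReal_re, Complex.ofReal_im]
      ring
  · rw [herm_spike_spike h, nsq_spike, nsq_spike]
    simp only [Complex.normSq_neg, map_mul, Complex.normSq_ofReal, Complex.normSq_conj,
      ← Complex.normSq_eq_norm_sq]
    linear_combination -(mass a b k * mass a b l * Complex.normSq z * Complex.normSq w) *
      cos_sq_lineAngle ha hb h

/-- The phases cancel in the cyclic product, and three factors −1 remain. `not_straight` needs this
sign for a product known only in modulus. -/
lemma herm_triple (ha : 0 < a) (hb : 0 < b) {k l m : Particle} (h1 : k ≠ l) (h2 : l ≠ m)
    (h3 : k ≠ m) {x q y : Config} (hx : OnLine k x) (hq : OnLine l q) (hy : OnLine m y) :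
    ∃ N : ℝ, 0 ≤ N ∧ herm a b x q * herm a b q y * herm a b y x = -(N : ℂ) := by
  obtain ⟨z, s, rfl⟩ := hx.exists_spike
  obtain ⟨w, t, rfl⟩ := hq.exists_spike
  obtain ⟨u, r, rfl⟩ := hy.exists_spike
  have := mass_pos ha hb k
  have := mass_pos ha hb l
  have := mass_pos ha hb m
  refine ⟨(mass a b k * mass a b l * mass a b m) ^ 2 *
    (Complex.normSq z * Complex.normSq w * Complex.normSq u), ?_, ?_⟩
  · have := Complex.normSq_nonneg z
    have := Complex.normSq_nonneg w
    have := Complex.normSq_nonneg u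
    positivity
  · rw [herm_spike_spike h1, herm_spike_spike h2, herm_spike_spike h3.symm]
    push_cast
    rw [← Complex.mul_conj z, ← Complex.mul_conj w, ← Complex.mul_conj u]
    ring

lemma nsq_eq_energy (v : Config) :
    nsq a b v = (1 + a + b) * (a * ‖v p1‖ ^ 2 + ‖v p2‖ ^ 2 + b * ‖v p3‖ ^ 2) -
      ‖(a : ℂ) * v p1 + v p2 + (b : ℂ) * v p3‖ ^ 2 := by
  simp only [nsq, ← Complex.normSq_eq_norm_sq, Complex.normSq_apply, Complex.add_re,
    Complex.add_im, Complex.mul_re, Complex.mul_im, Complex.sub_re, Complex.sub_im,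
    Complex.ofReal_re, Complex.ofReal_im]
  ring

/-- Scattering at a nonzero configuration on a collision line, in terms of the form. -/
lemma scatters_iff (ha : 0 < a) (hb : 0 < b) {k : Particle} {r : Config} (hr : OnLine k r)
    (hr0 : nsq a b r ≠ 0) (v v' : Config) :
    Scatters a b k v v' ↔
      v' k = v k ∧ herm a b r v' = herm a b r v ∧ nsq a b v' = nsq a b v ∧ v' ≠ v := by
  obtain ⟨z, s, rfl⟩ := hr.exists_spike
  have hm : mass a b k ≠ 0 := (mass_pos ha hb k).ne'
  have hz : z ≠ 0 := by
    rintro rfl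
    simp [nsq_spike] at hr0
  rw [herm_spike, herm_spike, nsq_eq_energy, nsq_eq_energy]
  constructor
  · rintro ⟨h1, h2, h3, h4⟩
    exact ⟨h1, by rw [h1, h2], by rw [h2, h3], h4⟩
  · rintro ⟨h1, h2, h3, h4⟩
    have h5 : (a : ℂ) * v' p1 + v' p2 + (b : ℂ) * v' p3 =
        (a : ℂ) * v p1 + v p2 + (b : ℂ) * v p3 := by
      have hm' : (mass a b k : ℂ) ≠ 0 := by exact_mod_cast hm
      have h6 := (starRingEnd ℂ).injective (mul_left_cancel₀ hz (mul_left_cancel₀ hm' h2))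
      rw [h1] at h6
      linear_combination -h6
    refine ⟨h1, h5, ?_, h4⟩
    rw [h5] at h3
    have hM : 1 + a + b ≠ 0 := by positivity
    exact mul_left_cancel₀ hM (by linarith)

end Lines

/-! ### Planes of free motion and the relation between swept angles and line angles. -/

/-- The relative motion of free particles: `v` are the velocities, `n` is an orthogonal direction of
the same norm, and the configuration vector always points along `cos θ • v + sin θ • n`. -/
def Frame (a b E j : ℝ) (n v : Config) : Prop :=
  nsq a b n = E ∧ nsq a b v = E ∧ herm a b n v = (E * j : ℝ) * Complex.I

/-- The unit direction at the angle `θ` in a frame. -/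
def dir (n v : Config) (θ : ℝ) : Config := lin (Real.cos θ) v (Real.sin θ) n

section Frames

variable {a b E j κ : ℝ} {n v : Config}

open ComplexConjugate

/-- Here `j` is the cosine of the Kähler angle of the real plane of `n` and `v`: 0 for a totally
real plane, ±1 for a complex line. -/
lemma Frame.herm_dir (h : Frame a b E j n v) (s t : ℝ) :
    herm a b (dir n v s) (dir n v t) =
      E * (Real.cos (s - t) + j * Real.sin (s - t) * Complex.I) := by
  obtain ⟨h1, h2, h3⟩ := h
  have h4 : herm a b v n = -((E * j : ℝ) * Complex.I) := by
    rw [← herm_conj, h3]; simp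
  simp only [dir, herm_lin_left, herm_lin_right, herm_self, h1, h2, h3, h4, Real.cos_sub,
    Real.sin_sub]
  push_cast; ring

lemma Frame.nsq_dir (h : Frame a b E j n v) (s : ℝ) : nsq a b (dir n v s) = E := by
  have := h.herm_dir s s
  rw [herm_self] at this
  simp only [sub_self, Real.cos_zero, Real.sin_zero] at this
  exact_mod_cast (by simpa using this : ((nsq a b (dir n v s) : ℝ) : ℂ) = (E : ℂ))

/-- The basic relation. The squared modulus of cos σ + i j sin σ is 1 − κ² sin² σ, and by
`OnLine.normSq_herm` it is the squared cosine of the line angle. -/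
lemma sin_lineAngle_eq (ha : 0 < a) (hb : 0 < b) (hE : 0 < E) (hκ : 0 < κ)
    (hj : κ ^ 2 = 1 - j ^ 2) {k l : Particle} {x y : Config} {σ : ℝ} (hσ : 0 ≤ σ) (hσ' : σ ≤ Real.pi)
    (hk : OnLine k x) (hl : OnLine l y) (hx : nsq a b x = E) (hy : nsq a b y = E)
    (hxy : herm a b x y = E * (Real.cos σ + j * Real.sin σ * Complex.I)) :
    Real.sin (lineAngle a b k l) = κ * Real.sin σ := by
  have h1 := hk.normSq_herm ha hb hl
  rw [hxy, hx, hy] at h1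
  simp only [map_mul, Complex.normSq_ofReal] at h1
  have h2 : Complex.normSq (Real.cos σ + j * Real.sin σ * Complex.I) =
      Real.cos σ ^ 2 + j ^ 2 * Real.sin σ ^ 2 := by
    have := Complex.normSq_add_mul_I (Real.cos σ) (j * Real.sin σ)
    push_cast at this ⊢
    rw [this]; ring
  rw [h2] at h1
  have h3 : Real.cos σ ^ 2 + j ^ 2 * Real.sin σ ^ 2 = Real.cos (lineAngle a b k l) ^ 2 := by
    have : E * E ≠ 0 := by positivity
    exact mul_left_cancel₀ this (by linarith)
  have := Real.sin_nonneg_of_nonneg_of_le_pi hσ hσ'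
  refine (sq_eq_sq₀ (sin_lineAngle_nonneg ha hb k l) (by positivity)).1 ?_
  rw [mul_pow, hj]
  have := Real.sin_sq_add_cos_sq σ
  have := Real.sin_sq_add_cos_sq (lineAngle a b k l)
  linarith

lemma Frame.sin_lineAngle (h : Frame a b E j n v) (ha : 0 < a) (hb : 0 < b) (hE : 0 < E)
    (hκ : 0 < κ) (hj : κ ^ 2 = 1 - j ^ 2) {k l : Particle} {s t : ℝ} (hst : 0 ≤ s - t)
    (hst' : s - t ≤ Real.pi) (hk : OnLine k (dir n v s)) (hl : OnLine l (dir n v t)) :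
    Real.sin (lineAngle a b k l) = κ * Real.sin (s - t) :=
  sin_lineAngle_eq ha hb hE hκ hj hst hst' hk hl (h.nsq_dir s) (h.nsq_dir t) (h.herm_dir s t)

/-- A vector on another collision line with prescribed inner product. -/
lemma exists_onLine_herm (ha : 0 < a) (hb : 0 < b) (hE : 0 < E)
    (hj : κ ^ 2 = 1 - j ^ 2) {k l : Particle} (hkl : k ≠ l) {x : Config} {σ : ℝ}
    (hk : OnLine k x) (hx : nsq a b x = E)
    (hs : Real.sin (lineAngle a b k l) = κ * Real.sin σ) :
    ∃ y, OnLine l y ∧ nsq a b y = E ∧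
      herm a b x y = E * (Real.cos σ + j * Real.sin σ * Complex.I) := by
  obtain ⟨z, s, rfl⟩ := hk.exists_spike
  have hz : z ≠ 0 := by
    rintro rfl
    simp [nsq_spike] at hx
    exact hE.ne hx
  have hmk : (mass a b k : ℂ) ≠ 0 := by exact_mod_cast (mass_pos ha hb k).ne'
  have hml : (mass a b l : ℂ) ≠ 0 := by exact_mod_cast (mass_pos ha hb l).ne'
  set c : ℂ := E * (Real.cos σ + j * Real.sin σ * Complex.I) with hc
  -- The complex factor `w` is the only freedom on the line `l`, so the prescribed product forces
  -- it; the relation between the sines then makes the norm equal to `E`.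
  set w : ℂ := conj (-c / (mass a b k * mass a b l * z)) with hw
  have hherm : herm a b (spike k z s) (spike l w 0) = c := by
    rw [herm_spike_spike hkl, hw, Complex.conj_conj]
    field_simp
  refine ⟨spike l w 0, onLine_spike _ _ _, ?_, hherm⟩
  have h1 := (onLine_spike k z s).normSq_herm ha hb (onLine_spike l w 0)
  rw [hherm, hx, hc] at h1
  simp only [map_mul, Complex.normSq_ofReal] at h1
  have h2 : Complex.normSq (Real.cos σ + j * Real.sin σ * Complex.I) =
      Real.cos σ ^ 2 + j ^ 2 * Real.sin σ ^ 2 := by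
    have := Complex.normSq_add_mul_I (Real.cos σ) (j * Real.sin σ)
    push_cast at this ⊢
    rw [this]; ring
  rw [h2] at h1
  have h3 : Real.cos σ ^ 2 + j ^ 2 * Real.sin σ ^ 2 = Real.cos (lineAngle a b k l) ^ 2 := by
    have := Real.sin_sq_add_cos_sq σ
    have := Real.sin_sq_add_cos_sq (lineAngle a b k l)
    rw [hs, mul_pow, hj] at this
    linarith
  rw [h3] at h1
  have := cos_lineAngle_pos ha hb k l
  have h4 : Real.cos (lineAngle a b k l) ^ 2 * E ≠ 0 := by positivity
  exact mul_left_cancel₀ h4 (by linarith)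

/-- The frame spanned by two given directions. -/
lemma exists_frame {x y : Config} {s t : ℝ} (hst : Real.sin (s - t) ≠ 0) (hx : nsq a b x = E)
    (hy : nsq a b y = E)
    (hxy : herm a b x y = E * (Real.cos (s - t) + j * Real.sin (s - t) * Complex.I)) :
    ∃ n v, Frame a b E j n v ∧ dir n v s = x ∧ dir n v t = y := by
  set D := Real.sin (s - t) with hD
  have hyx : herm a b y x = E * (Real.cos (s - t) - j * D * Complex.I) := by
    rw [← herm_conj, hxy]
    simp only [map_mul, map_add, Complex.conj_ofReal, Complex.conj_I]; ring
  have hD' : (D : ℂ) ≠ 0 := by exact_mod_cast hst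
  have es := Real.sin_sq_add_cos_sq s
  have et := Real.sin_sq_add_cos_sq t
  have hre : (herm a b x y).re = E * Real.cos (s - t) := by
    rw [hxy, ← Complex.ofReal_mul]
    simp only [Complex.re_ofReal_mul, Complex.add_re, Complex.ofReal_re, Complex.I_re]
    ring
  have hDe : D = Real.sin s * Real.cos t - Real.cos s * Real.sin t := Real.sin_sub s t
  have hCe : Real.cos (s - t) = Real.cos s * Real.cos t + Real.sin s * Real.sin t :=
    Real.cos_sub s t
  -- Cramer's rule for x = cos s • v + sin s • n and y = cos t • v + sin t • n.
  refine ⟨lin (Real.cos t / D) x (-Real.cos s / D) y, lin (-Real.sin t / D) x (Real.sin s / D) y,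
    ⟨?_, ?_, ?_⟩, ?_, ?_⟩
  · rw [nsq_lin, hx, hy, hre]
    field_simp
    rw [hCe, hDe]
    linear_combination (-E * Real.cos s^2) * et - E * Real.cos t ^2 * es
  · rw [nsq_lin, hx, hy, hre]
    field_simp
    rw [hCe, hDe]
    linear_combination (-E * Real.sin s^2) * et - E * Real.sin t ^2 * es
  · simp only [herm_lin_left, herm_lin_right, herm_self, hx, hy, hxy, hyx]
    push_cast
    field_simp
    have hC : (Real.cos (s - t) : ℂ) = Real.cos s * Real.cos t + Real.sin s * Real.sin t := by
      exact_mod_cast hCe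
    have hDc : (D : ℂ) = Real.sin s * Real.cos t - Real.cos s * Real.sin t := by
      exact_mod_cast hDe
    have es' : (Real.sin s : ℂ) ^ 2 + (Real.cos s : ℂ) ^ 2 = 1 := by exact_mod_cast es
    have et' : (Real.sin t : ℂ) ^ 2 + (Real.cos t : ℂ) ^ 2 = 1 := by exact_mod_cast et
    push_cast at hC hDc es' et'
    rw [hC, hDc]
    linear_combination (E * Complex.sin t * Complex.cos t : ℂ) * es' +
      (E * Complex.sin s * Complex.cos s : ℂ) * et'
  · funext i
    simp only [dir, lin]
    push_cast
    field_simp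
    have hDc : (D : ℂ) = Real.sin s * Real.cos t - Real.cos s * Real.sin t := by
      exact_mod_cast hDe
    push_cast at hDc
    rw [hDc]; ring
  · funext i
    simp only [dir, lin]
    push_cast
    field_simp
    have hDc : (D : ℂ) = Real.sin s * Real.cos t - Real.cos s * Real.sin t := by
      exact_mod_cast hDe
    push_cast at hDc
    rw [hDc]; ring

end Frames

/-! ### One collision in angular terms. -/

/-- The angular description of a capture process from a collision with spectator `k` at the
angle `Θ` on, the previous event having been on the line `m` at the angle `Φ`. -/
def AngularProcess (a b κ : ℝ) : List Particle → Particle → Particle → ℝ → ℝ → Prop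
  | [], m, k, Φ, Θ => Real.sin (lineAngle a b k p3) = κ * Real.sin Θ ∧
      (m ≠ p3 → Real.sin (lineAngle a b m p3) ≠ κ * Real.sin Φ)
  | l :: w, m, k, Φ, Θ => ∃ Ψ, 0 < Ψ ∧ Ψ < Θ ∧ Real.sin (lineAngle a b k l) = κ * Real.sin (Θ - Ψ) ∧
      (m ≠ l → Real.sin (lineAngle a b m l) ≠ κ * Real.sin (Φ - Ψ)) ∧ AngularProcess a b κ w k l Θ Ψ

/-- The normal direction after a change of velocities from `v` to `v'` at the angle `Θ`. -/
def turn (n v : Config) (Θ : ℝ) (v' : Config) : Config :=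
  lin (1 / Real.sin Θ) (dir n v Θ) (-Real.cos Θ / Real.sin Θ) v'

section Turn

variable {a b E j κ : ℝ} {n v : Config}

/-- Triangles whose angles have proportional sines have proportional sides and are similar; the law
of cosines recovers the angle. -/
lemma eq_of_sin_eq_mul_sin {A B C X Y Z : ℝ} (hA : 0 < A) (hB : 0 < B) (hC : 0 < C)
    (hABC : A + B + C = Real.pi) (hX : 0 < X) (hY : 0 < Y) (hZ : 0 < Z)
    (hXYZ : X + Y + Z = Real.pi) (hκ : 0 < κ) (h1 : Real.sin A = κ * Real.sin X)
    (h2 : Real.sin B = κ * Real.sin Y) (h3 : Real.sin C = κ * Real.sin Z) : A = X := by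
  have key : ∀ A B C : ℝ, A + B + C = Real.pi →
      Real.sin A ^ 2 = Real.sin B ^ 2 + Real.sin C ^ 2 - 2 * Real.sin B * Real.sin C * Real.cos A := by
    intro A B C h
    have : A = Real.pi - (B + C) := by linarith
    rw [this, Real.sin_pi_sub, Real.cos_pi_sub, Real.sin_add, Real.cos_add]
    have h1 := Real.sin_sq_add_cos_sq B
    have h2 := Real.sin_sq_add_cos_sq C
    linear_combination Real.sin C ^ 2 * h1 + Real.sin B ^ 2 * h2
  have e1 := key A B C hABC
  have e2 := key X Y Z hXYZ
  have sY := Real.sin_pos_of_pos_of_lt_pi hY (by linarith)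
  have sZ := Real.sin_pos_of_pos_of_lt_pi hZ (by linarith)
  rw [h1, h2, h3] at e1
  have hne : 2 * κ ^ 2 * Real.sin Y * Real.sin Z ≠ 0 := by positivity
  have : Real.cos A = Real.cos X := mul_left_cancel₀ hne (by linear_combination e1 - κ ^ 2 * e2)
  exact Real.injOn_cos ⟨hA.le, by linarith⟩ ⟨hX.le, by linarith⟩ this

lemma dir_zero (n v : Config) : dir n v 0 = v := by
  funext i; simp [dir, lin]

lemma dir_comb (n v : Config) (s t u : ℝ) (i : Particle) :
    (Real.sin (s - t) : ℂ) * dir n v u i =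
      Real.sin (u - t) * dir n v s i + Real.sin (s - u) * dir n v t i := by
  have e1 : Real.sin (s - t) * Real.cos u =
      Real.sin (u - t) * Real.cos s + Real.sin (s - u) * Real.cos t := by
    simp only [Real.sin_sub]; ring
  have e2 : Real.sin (s - t) * Real.sin u =
      Real.sin (u - t) * Real.sin s + Real.sin (s - u) * Real.sin t := by
    simp only [Real.sin_sub]; ring
  have e1' := congrArg (Complex.ofReal) e1
  have e2' := congrArg (Complex.ofReal) e2
  simp only [Complex.ofReal_mul, Complex.ofReal_add] at e1' e2'
  simp only [dir, lin]
  linear_combination v i * e1' + n i * e2'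

lemma dir_turn_self {Θ : ℝ} (hΘ : Real.sin Θ ≠ 0) (v' : Config) :
    dir (turn n v Θ v') v' Θ = dir n v Θ := by
  have h : (Real.sin Θ : ℂ) ≠ 0 := by exact_mod_cast hΘ
  funext i
  rw [dir, lin, turn, lin]
  push_cast at h ⊢
  field_simp
  ring

lemma sin_mul_dir_turn {Θ : ℝ} (hΘ : Real.sin Θ ≠ 0) (v' : Config) (t : ℝ) (i : Particle) :
    (Real.sin Θ : ℂ) * dir (turn n v Θ v') v' t i =
      Real.sin t * dir n v Θ i + Real.sin (Θ - t) * v' i := by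
  have := dir_comb (turn n v Θ v') v' Θ 0 t i
  rwa [dir_turn_self hΘ, dir_zero, sub_zero, sub_zero] at this

/-- The plane of motion turns about the position vector; the conserved quantities keep both the
angle Θ and `j`. -/
lemma Frame.turn (h : Frame a b E j n v) {Θ : ℝ} (hΘ : Real.sin Θ ≠ 0) {v' : Config}
    (h1 : herm a b (dir n v Θ) v' = herm a b (dir n v Θ) v) (h2 : nsq a b v' = nsq a b v) :
    Frame a b E j (turn n v Θ v') v' := by
  have hq := h.nsq_dir Θ
  have hqv := h.herm_dir Θ 0
  rw [dir_zero, sub_zero, ← h1] at hqv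
  rw [h.2.1] at h2
  have hre : (herm a b (dir n v Θ) v').re = E * Real.cos Θ := by
    rw [hqv]
    simp only [Complex.re_ofReal_mul, Complex.add_re, Complex.ofReal_re, ← Complex.ofReal_mul,
      Complex.I_re]
    ring
  have es := Real.sin_sq_add_cos_sq Θ
  refine ⟨?_, h2, ?_⟩
  · rw [_root_.turn, nsq_lin, hq, h2, hre]
    field_simp
    linear_combination -E * es
  · have h' : (Real.sin Θ : ℂ) ≠ 0 := by exact_mod_cast hΘ
    rw [_root_.turn, herm_lin_left, hqv, herm_self, h2]
    push_cast at h' ⊢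
    field_simp
    ring

variable {m k l : Particle} {Φ Θ Ψ : ℝ}

lemma scatters_frame (h : Frame a b E j n v) (ha : 0 < a) (hb : 0 < b) (hE : 0 < E)
    (hΘ : Real.sin Θ ≠ 0) (hk : OnLine k (dir n v Θ)) {v' : Config} (hs : Scatters a b k v v') :
    Frame a b E j (turn n v Θ v') v' := by
  obtain ⟨-, h1, h2, -⟩ := (scatters_iff ha hb hk (by rw [h.nsq_dir]; exact hE.ne') v v').1 hs
  exact h.turn hΘ h1 h2

lemma ne_of_sin_lineAngle (hκ : 0 < κ) {σ : ℝ} (h0 : 0 < σ) (h1 : σ < Real.pi)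
    (h : Real.sin (lineAngle a b k l) = κ * Real.sin σ) : k ≠ l := by
  rintro rfl
  rw [lineAngle_self, Real.sin_zero] at h
  have := mul_pos hκ (Real.sin_pos_of_pos_of_lt_pi h0 h1)
  linarith

/-- If all three sine relations held, the triangle of line angles and the one with angles Φ−Θ, Θ−Ψ,
π−(Φ−Ψ) would be similar, which forces κ = 1 and j = 0. The direction at Ψ is then that of
undeflected flight up to translation, against `v' ≠ v`. With `exists_scatters` this shows that the
inequality of sines in `AngularProcess` expresses deflection. -/
lemma not_straight (h : Frame a b E j n v) (ha : 0 < a) (hb : 0 < b) (hE : 0 < E) (hκ : 0 < κ)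
    (hj : κ ^ 2 = 1 - j ^ 2) (h0 : 0 ≤ Ψ) (h1 : Ψ < Θ) (h2 : Θ < Φ) (h3 : Φ ≤ Real.pi)
    (hm : OnLine m (dir n v Φ)) (hk : OnLine k (dir n v Θ)) {v' : Config}
    (hs : Scatters a b k v v') (hl : OnLine l (dir (turn n v Θ v') v' Ψ)) (hml : m ≠ l) :
    Real.sin (lineAngle a b m l) ≠ κ * Real.sin (Φ - Ψ) := by
  intro hsin
  have hΘ : Real.sin Θ ≠ 0 := (Real.sin_pos_of_pos_of_lt_pi (by linarith) (by linarith)).ne'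
  obtain ⟨s1, s2, s3, s4⟩ :=
    (scatters_iff ha hb hk (by rw [h.nsq_dir]; exact hE.ne') v v').1 hs
  have h' := h.turn hΘ s2 s3
  have hk' : OnLine k (dir (turn n v Θ v') v' Θ) := by rwa [dir_turn_self hΘ]
  have e1 := h.sin_lineAngle ha hb hE hκ hj (by linarith) (by linarith) hm hk
  have e2 := h'.sin_lineAngle ha hb hE hκ hj (by linarith) (by linarith) hk' hl
  have hmk : m ≠ k := ne_of_sin_lineAngle hκ (by linarith) (by linarith) e1
  have hkl : k ≠ l := ne_of_sin_lineAngle hκ (by linarith) (by linarith) e2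
  have hlt : Φ - Ψ < Real.pi := by
    refine lt_of_le_of_ne (by linarith) fun h5 => ?_
    rw [h5, Real.sin_pi, mul_zero] at hsin
    exact (sin_lineAngle_pos ha hb hml).ne' hsin
  have hsum := lineAngle_triangle ha hb hmk hkl hml
  have hsin' : Real.sin (lineAngle a b m l) = κ * Real.sin (Real.pi - (Φ - Ψ)) := by
    rw [hsin, Real.sin_pi_sub]
  have pos1 := lineAngle_pos ha hb hmk
  have pos2 := lineAngle_pos ha hb hkl
  have pos3 := lineAngle_pos ha hb hml
  have A1 : lineAngle a b m k = Φ - Θ :=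
    eq_of_sin_eq_mul_sin pos1 pos2 pos3 hsum (by linarith) (by linarith : 0 < Θ - Ψ)
      (by linarith : 0 < Real.pi - (Φ - Ψ)) (by ring) hκ e1 e2 hsin'
  have A2 : lineAngle a b k l = Θ - Ψ :=
    eq_of_sin_eq_mul_sin pos2 pos1 pos3 (by linarith) (by linarith) (by linarith : 0 < Φ - Θ)
      (by linarith : 0 < Real.pi - (Φ - Ψ)) (by ring) hκ e2 e1 hsin'
  have A3 : lineAngle a b m l = Real.pi - (Φ - Ψ) := by linarith
  have hκ1 : κ = 1 := by
    rw [A1] at e1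
    have := Real.sin_pos_of_pos_of_lt_pi (by linarith : 0 < Φ - Θ) (by linarith)
    exact (mul_right_cancel₀ this.ne' (by linarith) : (1 : ℝ) = κ).symm
  have hj0 : j = 0 := by
    rw [hκ1] at hj
    exact pow_eq_zero_iff (n := 2) (by norm_num) |>.1 (by linarith)
  subst hj0
  set x := dir n v Φ
  set q := dir n v Θ with hq
  set y := dir (turn n v Θ v') v' Ψ
  have hxq : herm a b x q = E * Real.cos (Φ - Θ) := by rw [h.herm_dir]; simp
  have hqy : herm a b q y = E * Real.cos (Θ - Ψ) := by
    rw [hq, ← dir_turn_self hΘ v', h'.herm_dir]; simp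
  have hc1 : 0 < Real.cos (Φ - Θ) := A1 ▸ cos_lineAngle_pos ha hb m k
  have hc2 : 0 < Real.cos (Θ - Ψ) := A2 ▸ cos_lineAngle_pos ha hb k l
  -- The product of `y` and `x` is thus real and nonpositive, and the angle between their lines
  -- gives its modulus; it is the product that undeflected flight would give.
  obtain ⟨N, hN, hN'⟩ := herm_triple ha hb hmk hkl hml hm hk hl
  have hyx : herm a b y x = ((-N / (E * Real.cos (Φ - Θ) * (E * Real.cos (Θ - Ψ))) : ℝ) : ℂ) := by
    have c1 : (Real.cos (Φ - Θ) : ℂ) ≠ 0 := by exact_mod_cast hc1.ne'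
    have c2 : (Real.cos (Θ - Ψ) : ℂ) ≠ 0 := by exact_mod_cast hc2.ne'
    have cE : (E : ℂ) ≠ 0 := by exact_mod_cast hE.ne'
    rw [hxq, hqy] at hN'
    push_cast at c1 c2 hN' ⊢
    rw [eq_div_iff (by simp [c1, c2, cE])]
    linear_combination hN'
  set R : ℝ := -N / (E * Real.cos (Φ - Θ) * (E * Real.cos (Θ - Ψ))) with hR
  have hR0 : R ≤ 0 := by
    rw [hR]; exact div_nonpos_of_nonpos_of_nonneg (by linarith) (by positivity)
  have hR1 : R = E * Real.cos (Φ - Ψ) := by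
    have h5 := hl.normSq_herm ha hb hm
    rw [hyx, Complex.normSq_ofReal, h'.nsq_dir, h.nsq_dir, lineAngle_comm, A3,
      Real.cos_pi_sub] at h5
    have h6 : 0 < -Real.cos (Φ - Ψ) := by
      rw [← Real.cos_pi_sub, ← A3]; exact cos_lineAngle_pos ha hb m l
    have h7 : (-R) = E * -Real.cos (Φ - Ψ) :=
      (sq_eq_sq₀ (by linarith) (by positivity)).1 (by linarith)
    linarith
  have hxy : herm a b x y = E * Real.cos (Φ - Ψ) := by
    rw [← herm_conj, hyx, Complex.conj_ofReal, hR1]; push_cast; ring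
  set y0 := dir n v Ψ
  have hS : Real.sin (Φ - Θ) ≠ 0 := (Real.sin_pos_of_pos_of_lt_pi (by linarith) (by linarith)).ne'
  have hy0 : y0 = lin (Real.sin (Ψ - Θ) / Real.sin (Φ - Θ)) x
      (Real.sin (Φ - Ψ) / Real.sin (Φ - Θ)) q := by
    funext i
    have h5 := dir_comb n v Φ Θ Ψ i
    have hS' : (Real.sin (Φ - Θ) : ℂ) ≠ 0 := by exact_mod_cast hS
    have h6 : y0 i = dir n v Ψ i := rfl
    rw [h6]
    simp only [lin]
    rw [Complex.ofReal_div, Complex.ofReal_div]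
    field_simp
    linear_combination h5
  -- `y0` lies in the real span of `x` and `q`, with which it has the same products as `y`. This is
  -- equality in Cauchy–Schwarz, so `y0` and `y` differ by a translation.
  have hy0y : herm a b y0 y = E := by
    have e3 : herm a b y0 y0 = E := by rw [herm_self, h.nsq_dir]
    have e4 : herm a b x y0 = herm a b x y := by rw [hxy, h.herm_dir]; simp
    have e5 : herm a b q y0 = herm a b q y := by rw [hqy, h.herm_dir]; simp
    rw [← e3]
    conv_lhs => rw [hy0]
    rw [herm_lin_left, ← e4, ← e5, ← herm_lin_left, ← hy0]
  have hd : nsq a b (lin 1 y0 (-1) y) = 0 := by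
    rw [nsq_lin, hy0y, h.nsq_dir, h'.nsq_dir, Complex.ofReal_re]; ring
  have hconst := nsq_eq_zero ha hb hd
  have hS2 : (Real.sin (Θ - Ψ) : ℂ) ≠ 0 := by
    exact_mod_cast (Real.sin_pos_of_pos_of_lt_pi (by linarith) (by linarith)).ne'
  -- The translation drops out because the spectator keeps its velocity.
  apply s4
  funext i
  have h5 := sin_mul_dir_turn (n := n) (v := v) hΘ v' Ψ i
  have h6 := sin_mul_dir_turn (n := n) (v := v) hΘ v' Ψ k
  have h7 := dir_comb n v Θ 0 Ψ i
  have h8 := dir_comb n v Θ 0 Ψ k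
  rw [dir_zero, sub_zero, sub_zero] at h7 h8
  have h9 := hconst i k
  simp only [lin] at h9
  apply mul_left_cancel₀ hS2
  change (Real.sin Θ : ℂ) * y i = _ at h5
  change (Real.sin Θ : ℂ) * y k = _ at h6
  change (Real.sin Θ : ℂ) * y0 i = _ at h7
  change (Real.sin Θ : ℂ) * y0 k = _ at h8
  rw [s1] at h6
  push_cast at *
  linear_combination -h5 + h6 + h7 - h8 - Complex.sin Θ * h9

/-- Choose a direction on the line `l` with the right product with the direction at Θ; the frame
through both has a velocity `v0`. The conserved quantities depend only on E, Θ and j, so they agree,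
and the translation `τ` restores the spectator's velocity. Undeflected flight could return to its
own line only after a half turn, whence the last hypothesis. -/
lemma exists_scatters (h : Frame a b E j n v) (ha : 0 < a) (hb : 0 < b) (hE : 0 < E) (hκ : 0 < κ)
    (hj : κ ^ 2 = 1 - j ^ 2) (h0 : 0 ≤ Ψ) (h1 : Ψ < Θ) (h2 : Θ < Φ) (h3 : Φ ≤ Real.pi)
    (hm : OnLine m (dir n v Φ)) (hk : OnLine k (dir n v Θ))
    (hkl : Real.sin (lineAngle a b k l) = κ * Real.sin (Θ - Ψ))
    (hml : m ≠ l → Real.sin (lineAngle a b m l) ≠ κ * Real.sin (Φ - Ψ))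
    (hml' : m = l → Φ - Ψ < Real.pi) :
    ∃ v', Scatters a b k v v' ∧ OnLine l (dir (turn n v Θ v') v' Ψ) := by
  have hΘ : Real.sin Θ ≠ 0 := (Real.sin_pos_of_pos_of_lt_pi (by linarith) (by linarith)).ne'
  have hσ : Real.sin (Θ - Ψ) ≠ 0 :=
    (Real.sin_pos_of_pos_of_lt_pi (by linarith) (by linarith)).ne'
  have hne : k ≠ l := ne_of_sin_lineAngle hκ (by linarith) (by linarith) hkl
  obtain ⟨y, hy, hyE, hqy⟩ := exists_onLine_herm ha hb hE hj hne hk (h.nsq_dir Θ) hkl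
  obtain ⟨n', v0, h', hq', hy'⟩ := exists_frame hσ (h.nsq_dir Θ) hyE hqy
  set τ : ℂ := v k - v0 k with hτ
  set v' : Config := fun i => v0 i + τ with hv'
  have t1 : herm a b (dir n v Θ) v' = herm a b (dir n v Θ) v0 := by simp [herm, hv']
  have t2 : nsq a b v' = nsq a b v0 := by simp [nsq, hv']
  have hl : OnLine l (dir (turn n v Θ v') v' Ψ) := by
    have hΘ' : (Real.sin Θ : ℂ) ≠ 0 := by exact_mod_cast hΘ
    have key : ∀ i, (Real.sin Θ : ℂ) * dir (turn n v Θ v') v' Ψ i =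
        Real.sin Θ * y i + Real.sin (Θ - Ψ) * τ := by
      intro i
      have h5 := dir_comb n' v0 Θ 0 Ψ i
      rw [dir_zero, sub_zero, sub_zero, hq', hy'] at h5
      rw [sin_mul_dir_turn hΘ, h5, hv']; ring
    intro i i' hi hi'
    apply mul_left_cancel₀ hΘ'
    rw [key, key, hy i i' hi hi']
  have hvq : herm a b (dir n v Θ) v' = herm a b (dir n v Θ) v := by
    have e1 := h.herm_dir Θ 0
    have e2 := h'.herm_dir Θ 0
    rw [hq'] at e2
    rw [dir_zero] at e1 e2
    rw [t1, e1, e2]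
  have hvE : nsq a b v' = nsq a b v := by rw [t2, h.2.1, h'.2.1]
  refine ⟨v', (scatters_iff ha hb hk (by rw [h.nsq_dir]; exact hE.ne') v v').2
    ⟨by simp [hv', hτ], hvq, hvE, fun hvv => ?_⟩, hl⟩
  rw [hvv] at hl
  have hdir : dir (turn n v Θ v) v Ψ = dir n v Ψ := by
    have hΘ' : (Real.sin Θ : ℂ) ≠ 0 := by exact_mod_cast hΘ
    funext i
    apply mul_left_cancel₀ hΘ'
    have h5 := dir_comb n v Θ 0 Ψ i
    rw [dir_zero, sub_zero, sub_zero] at h5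
    rw [sin_mul_dir_turn hΘ, h5]
  rw [hdir] at hl
  have e := h.sin_lineAngle ha hb hE hκ hj (by linarith) (by linarith) hm hl
  by_cases hml0 : m = l
  · have := hml' hml0
    exact ne_of_sin_lineAngle hκ (by linarith) this e hml0
  · exact hml hml0 e

end Turn

/-! ### From motions to angular processes and back. -/

section Equivalence

variable {a b E j κ c : ℝ} {n v r : Config} {k l m : Particle} {Φ Θ Ψ : ℝ}

/-- The time of flight is c (cot Ψ − cot Θ), where `c` is the constant coefficient of the position
along the normal `n`. So Ψ is found from cot Ψ = cot Θ + t / c. -/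
lemma exists_angle_of_time (hc : 0 < c) (hΘ0 : 0 < Θ) (hΘ1 : Θ < Real.pi) {t : ℝ} (ht : 0 < t) :
    ∃ Ψ, 0 < Ψ ∧ Ψ < Θ ∧ t = c * Real.sin (Θ - Ψ) / (Real.sin Θ * Real.sin Ψ) := by
  have sΘ := Real.sin_pos_of_pos_of_lt_pi hΘ0 hΘ1
  set x := Real.cos Θ / Real.sin Θ + t / c with hx
  have h1 := Real.arctan_lt_pi_div_two x
  have h2 := Real.neg_pi_div_two_lt_arctan x
  have sΨ : Real.sin (Real.pi / 2 - Real.arctan x) = Real.cos (Real.arctan x) :=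
    Real.sin_pi_div_two_sub _
  have cΨ : Real.cos (Real.pi / 2 - Real.arctan x) = Real.sin (Real.arctan x) :=
    Real.cos_pi_div_two_sub _
  have hcos := Real.cos_arctan_pos x
  have hcot : Real.sin (Real.arctan x) = x * Real.cos (Real.arctan x) := by
    rw [← div_eq_iff hcos.ne', ← Real.tan_eq_sin_div_cos, Real.tan_arctan]
  have hsub : Real.sin (Θ - (Real.pi / 2 - Real.arctan x)) =
      t / c * Real.sin Θ * Real.cos (Real.arctan x) := by
    rw [Real.sin_sub, sΨ, cΨ, hcot, hx]; field_simp; ring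
  refine ⟨Real.pi / 2 - Real.arctan x, by linarith, ?_, ?_⟩
  · by_contra h
    push Not at h
    have h3 : Real.sin (Θ - (Real.pi / 2 - Real.arctan x)) ≤ 0 :=
      Real.sin_nonpos_of_nonpos_of_neg_pi_le (by linarith) (by linarith)
    rw [hsub] at h3
    have : 0 < t / c * Real.sin Θ * Real.cos (Real.arctan x) := by positivity
    linarith
  · rw [hsub, sΨ]; field_simp

lemma position_flight (hΘ : Real.sin Θ ≠ 0) (hΨ : Real.sin Ψ ≠ 0)
    (hr : ∀ i, r i = ((c / Real.sin Θ : ℝ) : ℂ) * dir n v Θ i) (i : Particle) :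
    r i + ((c * Real.sin (Θ - Ψ) / (Real.sin Θ * Real.sin Ψ) : ℝ) : ℂ) * v i =
      ((c / Real.sin Ψ : ℝ) : ℂ) * dir n v Ψ i := by
  have h := dir_comb n v Θ 0 Ψ i
  rw [dir_zero, sub_zero, sub_zero] at h
  have h1 : (Real.sin Θ : ℂ) ≠ 0 := by exact_mod_cast hΘ
  have h2 : (Real.sin Ψ : ℂ) ≠ 0 := by exact_mod_cast hΨ
  rw [hr]
  simp only [Complex.ofReal_mul, Complex.ofReal_div]
  field_simp
  linear_combination -(c : ℂ) * h

lemma onLine_smul_iff {x y : Config} {s : ℝ} (hs : s ≠ 0) (h : ∀ i, y i = (s : ℂ) * x i) :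
    OnLine k y ↔ OnLine k x := by
  have hs' : (s : ℂ) ≠ 0 := by exact_mod_cast hs
  refine ⟨fun H i i' hi hi' => ?_, fun H i i' hi hi' => ?_⟩
  · have := H i i' hi hi'
    rw [h, h] at this
    exact mul_left_cancel₀ hs' this
  · rw [h, h, H i i' hi hi']

/-- Induction on the collisions: `E`, `j` and `c` survive each of them, so only angles are handed
on. The condition for `m = p3` excludes a half turn from that line to itself. -/
theorem capturesFrom_iff (ha : 0 < a) (hb : 0 < b) (hE : 0 < E) (hκ : 0 < κ)
    (hj : κ ^ 2 = 1 - j ^ 2) (hc : 0 < c) (w : List Particle) :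
    ∀ (n v r : Config) (m k : Particle) (Φ Θ : ℝ), Frame a b E j n v → 0 < Θ → Θ < Φ →
      Φ ≤ Real.pi → OnLine m (dir n v Φ) → OnLine k (dir n v Θ) →
      (∀ i, r i = ((c / Real.sin Θ : ℝ) : ℂ) * dir n v Θ i) → (m = p3 → Φ < Real.pi) →
      ((∃ v', Scatters a b k v v' ∧ CapturesFrom a b w r v') ↔ AngularProcess a b κ w m k Φ Θ) := by
  induction w with
  | nil =>
    intro n v r m k Φ Θ h h0 h1 h2 hm hk hr h3
    have hΘ := (Real.sin_pos_of_pos_of_lt_pi h0 (by linarith)).ne'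
    constructor
    · rintro ⟨v', hs, hcap⟩
      have h' := scatters_frame h ha hb hE hΘ hk hs
      have hk' : OnLine k (dir (turn n v Θ v') v' Θ) := by rwa [dir_turn_self hΘ]
      have hl : OnLine p3 (dir (turn n v Θ v') v' 0) := by
        rw [dir_zero]
        intro i i' hi hi'
        simp only [CapturesFrom] at hcap
        cases i <;> cases i' <;> simp_all
      refine ⟨?_, fun hm3 => ?_⟩
      · have := h'.sin_lineAngle ha hb hE hκ hj (by linarith) (by linarith) hk' hl
        rwa [sub_zero] at this
      · have := not_straight h ha hb hE hκ hj le_rfl h0 h1 h2 hm hk hs hl hm3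
        rwa [sub_zero] at this
    · rintro ⟨e1, e2⟩
      obtain ⟨v', hs, hl⟩ := exists_scatters (l := p3) h ha hb hE hκ hj le_rfl h0 h1 h2 hm hk
        (by rwa [sub_zero]) (by rwa [sub_zero]) (by rwa [sub_zero])
      rw [dir_zero] at hl
      exact ⟨v', hs, hl p1 p2 (by simp) (by simp)⟩
  | cons l w ih =>
    intro n v r m k Φ Θ h h0 h1 h2 hm hk hr h3
    have hΘ := Real.sin_pos_of_pos_of_lt_pi h0 (by linarith)
    constructor
    · rintro ⟨v', hs, t, ht, v'', hcon, hs', hcap⟩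
      have h' := scatters_frame h ha hb hE hΘ.ne' hk hs
      obtain ⟨Ψ, p0, p1', rfl⟩ := exists_angle_of_time hc h0 (by linarith : Θ < Real.pi) ht
      have hΨ := Real.sin_pos_of_pos_of_lt_pi p0 (by linarith)
      have hk' : OnLine k (dir (turn n v Θ v') v' Θ) := by rwa [dir_turn_self hΘ.ne']
      have hr' : ∀ i, r i = ((c / Real.sin Θ : ℝ) : ℂ) * dir (turn n v Θ v') v' Θ i := by
        rwa [dir_turn_self hΘ.ne']
      have hpos := position_flight hΘ.ne' hΨ.ne' hr'
      have hl : OnLine l (dir (turn n v Θ v') v' Ψ) :=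
        (onLine_smul_iff (by positivity) hpos).1 hcon
      refine ⟨Ψ, p0, p1', h'.sin_lineAngle ha hb hE hκ hj (by linarith) (by linarith) hk' hl,
        not_straight h ha hb hE hκ hj p0.le p1' h1 h2 hm hk hs hl, ?_⟩
      exact (ih _ _ _ k l Θ Ψ h' p0 p1' (by linarith) hk' hl hpos (fun _ => by linarith)).1
        ⟨v'', hs', hcap⟩
    · rintro ⟨Ψ, p0, p1', e1, e2, e3⟩
      have hΨ := Real.sin_pos_of_pos_of_lt_pi p0 (by linarith)
      obtain ⟨v', hs, hl⟩ := exists_scatters h ha hb hE hκ hj p0.le p1' h1 h2 hm hk e1 e2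
        (fun _ => by linarith)
      have h' := scatters_frame h ha hb hE hΘ.ne' hk hs
      have hk' : OnLine k (dir (turn n v Θ v') v' Θ) := by rwa [dir_turn_self hΘ.ne']
      have hr' : ∀ i, r i = ((c / Real.sin Θ : ℝ) : ℂ) * dir (turn n v Θ v') v' Θ i := by
        rwa [dir_turn_self hΘ.ne']
      have hpos := position_flight hΘ.ne' hΨ.ne' hr'
      obtain ⟨v'', hs', hcap⟩ := (ih _ _ _ k l Θ Ψ h' p0 p1' (by linarith) hk' hl hpos
        (fun _ => by linarith)).2 e3
      refine ⟨v', hs, _, ?_, v'', (onLine_smul_iff (by positivity) hpos).2 hl, hs', hcap⟩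
      have := Real.sin_pos_of_pos_of_lt_pi (by linarith : 0 < Θ - Ψ) (by linarith)
      positivity

lemma onLine_initialVelocity (u : ℂ) : OnLine p1 (initialVelocity u) := by
  intro i i' hi hi'
  cases i <;> cases i' <;> simp_all [initialVelocity]

lemma nsq_initialVelocity (u : ℂ) : nsq a b (initialVelocity u) = a * (1 + b) * ‖u‖ ^ 2 := by
  simp only [nsq, initialVelocity, sub_zero, norm_zero]; ring

/-- Capture with the sequence `k :: w` in terms of the angles swept between the events. -/
theorem captureAllowed_cons_iff (ha : 0 < a) (hb : 0 < b) (k : Particle) (w : List Particle) :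
    CaptureAllowed a b (k :: w) ↔ ∃ κ Θ, 0 < κ ∧ κ ≤ 1 ∧ 0 < Θ ∧ Θ < Real.pi ∧
      Real.sin (lineAngle a b p1 k) = κ * Real.sin Θ ∧ AngularProcess a b κ w p1 k Real.pi Θ := by
  constructor
  · rintro ⟨u, r₀, hu, hr₀, t, ht, v', hcon, hs, hcap⟩
    set v := initialVelocity u with hv
    set r : Config := fun i => r₀ i + (t : ℂ) * v i with hr
    have hk : OnLine k r := hcon
    have hv1 : OnLine p1 v := onLine_initialVelocity u
    -- Particles 2 and 3 rest at distinct points and cannot be the first to collide.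
    have hne : k ≠ p1 := by
      rintro rfl
      have := hk p2 p3 (by simp) (by simp)
      simp only [hr, hv, initialVelocity, mul_zero, add_zero] at this
      exact hr₀ this
    set E := nsq a b v with hE'
    have hE : 0 < E := by rw [hE', nsq_initialVelocity]; have := norm_pos_iff.2 hu; positivity
    have hρ : 0 < nsq a b r := by
      refine lt_of_le_of_ne (nsq_nonneg ha hb r) fun h => hr₀ ?_
      have := nsq_eq_zero ha hb h.symm p2 p3
      simpa only [hr, hv, initialVelocity, mul_zero, add_zero] using this
    set H := herm a b r v with hH
    have hnormSq := hk.normSq_herm ha hb hv1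
    rw [← hH, Complex.normSq_apply] at hnormSq
    have hsl := sin_lineAngle_pos ha hb hne
    have hsc := Real.sin_sq_add_cos_sq (lineAngle a b k p1)
    -- Strict Cauchy–Schwarz, since `r` and `v` lie on distinct complex lines; this gives κ > 0.
    have hS2 : 0 < E * nsq a b r - H.re ^ 2 - H.im ^ 2 := by
      have h5 : E * nsq a b r - H.re ^ 2 - H.im ^ 2 =
          Real.sin (lineAngle a b k p1) ^ 2 * (E * nsq a b r) := by
        linear_combination -hnormSq - E * nsq a b r * hsc
      rw [h5]; positivity
    have hS2' : 0 < E * nsq a b r - H.re ^ 2 := by linarith [sq_nonneg H.im]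
    -- S / E will be the constant `c` of the flight; the real and imaginary parts of the product,
    -- divided by S, are cot Θ and `j`.
    set S := √(E * nsq a b r - H.re ^ 2) with hS
    have hS0 : 0 < S := Real.sqrt_pos.2 hS2'
    have hSsq : S ^ 2 = E * nsq a b r - H.re ^ 2 := Real.sq_sqrt hS2'.le
    set j := H.im / S with hj'
    set κ := √(1 - j ^ 2) with hκ'
    have hjpos : 0 < 1 - j ^ 2 := by
      have : 1 - j ^ 2 = (E * nsq a b r - H.re ^ 2 - H.im ^ 2) / S ^ 2 := by
        rw [hj', ← hSsq]; field_simp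
      rw [this]; positivity
    have hκ : 0 < κ := Real.sqrt_pos.2 hjpos
    have hκj : κ ^ 2 = 1 - j ^ 2 := Real.sq_sqrt hjpos.le
    set x := H.re / S with hx
    set Θ := Real.pi / 2 - Real.arctan x with hΘ
    have hΘ0 : 0 < Θ := by have := Real.arctan_lt_pi_div_two x; linarith
    have hΘ1 : Θ < Real.pi := by have := Real.neg_pi_div_two_lt_arctan x; linarith
    have hsinΘ : 0 < Real.sin Θ := Real.sin_pos_of_pos_of_lt_pi hΘ0 hΘ1
    have hcosΘ : Real.cos Θ = x * Real.sin Θ := by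
      rw [hΘ, Real.cos_pi_div_two_sub, Real.sin_pi_div_two_sub,
        ← div_eq_iff (Real.cos_arctan_pos x).ne', ← Real.tan_eq_sin_div_cos, Real.tan_arctan]
    set n : Config := lin (E / S) r (-x) v with hn
    have hframe : Frame a b E j n v := by
      refine ⟨?_, rfl, ?_⟩
      · rw [hn, nsq_lin, ← hE', ← hH, hx]
        field_simp
        linear_combination -hSsq
      · rw [hn, herm_lin_left, herm_self, ← hE', ← hH, hx, hj']
        have hS0' : (S : ℂ) ≠ 0 := by exact_mod_cast hS0.ne'
        have := Complex.re_add_im H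
        push_cast
        field_simp
        linear_combination -(E : ℂ) * this
    have hpos : ∀ i, r i = ((S / E / Real.sin Θ : ℝ) : ℂ) * dir n v Θ i := by
      intro i
      simp only [dir, lin, hcosΘ, hn]
      have hS0' : (S : ℂ) ≠ 0 := by exact_mod_cast hS0.ne'
      have hE0 : (E : ℂ) ≠ 0 := by exact_mod_cast hE.ne'
      have hs0 : (Real.sin Θ : ℂ) ≠ 0 := by exact_mod_cast hsinΘ.ne'
      push_cast at hs0 ⊢
      field_simp
      ring
    have hdk : OnLine k (dir n v Θ) := (onLine_smul_iff (by positivity) hpos).1 hk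
    have hd1 : OnLine p1 (dir n v Real.pi) := by
      refine (onLine_smul_iff (s := -1) (x := v) (by norm_num) fun i => ?_).2 hv1
      simp [dir, lin]
    refine ⟨κ, Θ, hκ, ?_, hΘ0, hΘ1, ?_, ?_⟩
    · rw [hκ']; exact Real.sqrt_le_one.2 (by linarith [sq_nonneg j])
    · have := hframe.sin_lineAngle ha hb hE hκ hκj (by linarith) (by linarith) hd1 hdk
      rwa [Real.sin_pi_sub] at this
    · exact (capturesFrom_iff ha hb hE hκ hκj (by positivity : 0 < S / E) w n v r p1 k Real.pi Θ
        hframe hΘ0 hΘ1 le_rfl hd1 hdk hpos (by simp)).1 ⟨v', hs, hcap⟩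
  · rintro ⟨κ, Θ, hκ, hκ1, h0, h1, hs, hA⟩
    set j := √(1 - κ ^ 2) with hj'
    have hj : κ ^ 2 = 1 - j ^ 2 := by
      rw [hj', Real.sq_sqrt (by nlinarith)]; ring
    set v := initialVelocity 1 with hv
    set E := nsq a b v with hE'
    have hE : 0 < E := by rw [hE', nsq_initialVelocity]; simp; positivity
    have hs' : Real.sin (lineAngle a b p1 k) = κ * Real.sin (Real.pi - Θ) := by
      rwa [Real.sin_pi_sub]
    have hne : p1 ≠ k := ne_of_sin_lineAngle hκ (by linarith) (by linarith) hs'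
    -- At the angle π the direction is `-v`.
    set x : Config := lin (-1) v 0 v with hx
    have hxE : nsq a b x = E := by rw [hx, nsq_lin]; ring
    have hx1 : OnLine p1 x := (onLine_initialVelocity 1).lin (onLine_initialVelocity 1) _ _
    obtain ⟨y, hy, hyE, hxy⟩ := exists_onLine_herm ha hb hE hj hne hx1 hxE hs'
    have hsinΘ := Real.sin_pos_of_pos_of_lt_pi h0 h1
    obtain ⟨n, v0, hframe, hd1, hdk⟩ :=
      exists_frame (s := Real.pi) (t := Θ) (by rw [Real.sin_pi_sub]; exact hsinΘ.ne') hxE hyE hxy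
    have hv0 : v0 = v := by
      funext i
      have := congrFun hd1 i
      simpa [dir, lin, hx] using this
    rw [hv0] at hframe hd1 hdk
    have hd1' : OnLine p1 (dir n v Real.pi) := by rwa [hd1]
    have hdk' : OnLine k (dir n v Θ) := by rwa [hdk]
    set r : Config := fun i => ((1 / Real.sin Θ : ℝ) : ℂ) * dir n v Θ i with hr
    have hrk : OnLine k r := (onLine_smul_iff (by positivity) (fun i => rfl)).2 hdk'
    obtain ⟨v', hsc, hcap⟩ := (capturesFrom_iff ha hb hE hκ hj one_pos w n v r p1 k Real.pi Θ
        hframe h0 h1 le_rfl hd1' hdk' (fun _ => rfl) (by simp)).2 hA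
    have hfun : (fun i => r i - v i + ((1 : ℝ) : ℂ) * v i) = r := by
      funext i; simp
    -- The motion starts one unit of time before the first collision.
    refine ⟨1, fun i => r i - v i, one_ne_zero, fun h => ?_, 1, one_pos, v', ?_, hsc, ?_⟩
    · have h23 : r p2 = r p3 := by simpa [hv, initialVelocity] using h
      have hr1 : OnLine p1 r := by
        intro i i' hi hi'
        cases i <;> cases i' <;> first | rfl | exact h23 | exact h23.symm | exact absurd rfl hi | exact absurd rfl hi'
      have hd : OnLine p1 (dir n v Θ) :=
        (onLine_smul_iff (by positivity : (1 / Real.sin Θ) ≠ 0) (fun i => rfl)).1 hr1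
      have := hd.nsq_eq_zero (a := a) (b := b) hne hdk'
      rw [hframe.nsq_dir] at this
      exact hE.ne' this
    · intro i i' hi hi'
      have := hrk i i' hi hi'
      change r i - v i + ((1 : ℝ) : ℂ) * v i = r i' - v i' + ((1 : ℝ) : ℂ) * v i'
      rw [Complex.ofReal_one, one_mul, one_mul, sub_add_cancel, sub_add_cancel, this]
    · change CapturesFrom a b w (fun i => r i - v i + ((1 : ℝ) : ℂ) * v i) v'
      rwa [hfun]

lemma not_captureAllowed_nil : ¬ CaptureAllowed a b [] := by
  rintro ⟨u, r, hu, -, h⟩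
  exact hu h

end Equivalence

/-! ### Inscribed polygons. -/

section Trigonometry

/-- The quotient sin(qz) / sin(pz) decreases: the numerator `h` of its derivative vanishes at 0 and
has the negative derivative (p² − q²) sin(qz) sin(pz). -/
lemma sin_mul_lt_sin_mul {p q x y : ℝ} (hp : 0 < p) (hpq : p < q) (hx : 0 < x) (hxy : x < y)
    (hy : q * y ≤ Real.pi) :
    Real.sin (q * y) * Real.sin (p * x) < Real.sin (q * x) * Real.sin (p * y) := by
  have hq : 0 < q := hp.trans hpq
  have hy0 : 0 < y := hx.trans hxy
  have posq : ∀ z, 0 < z → z < y → 0 < Real.sin (q * z) := fun z hz hzy =>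
    Real.sin_pos_of_pos_of_lt_pi (by positivity) (by nlinarith)
  have posp : ∀ z, 0 < z → z ≤ y → 0 < Real.sin (p * z) := fun z hz hzy =>
    Real.sin_pos_of_pos_of_lt_pi (by positivity) (by nlinarith)
  set h : ℝ → ℝ := fun z => q * Real.cos (q * z) * Real.sin (p * z) -
    p * Real.sin (q * z) * Real.cos (p * z) with hh
  have dsin : ∀ c z : ℝ, HasDerivAt (fun z => Real.sin (c * z)) (c * Real.cos (c * z)) z := by
    intro c z
    have := ((hasDerivAt_id z).const_mul c).sin
    simpa [mul_comm] using this
  have dcos : ∀ c z : ℝ, HasDerivAt (fun z => Real.cos (c * z)) (-(c * Real.sin (c * z))) z := by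
    intro c z
    have := ((hasDerivAt_id z).const_mul c).cos
    simpa [mul_comm] using this
  have dh : ∀ z, HasDerivAt h ((p ^ 2 - q ^ 2) * (Real.sin (q * z) * Real.sin (p * z))) z := by
    intro z
    exact ((((dcos q z).const_mul q).mul (dsin p z)).sub
      (((dsin q z).const_mul p).mul (dcos p z))).congr_deriv (by ring)
  have hanti : StrictAntiOn h (Icc 0 y) := by
    refine strictAntiOn_of_deriv_neg (convex_Icc 0 y)
      (fun z _ => (dh z).continuousAt.continuousWithinAt) fun z hz => ?_
    rw [interior_Icc] at hz
    rw [(dh z).deriv]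
    exact mul_neg_of_neg_of_pos (by nlinarith) (mul_pos (posq z hz.1 hz.2) (posp z hz.1 hz.2.le))
  have hneg : ∀ z, 0 < z → z ≤ y → h z < 0 := by
    intro z hz hzy
    have := hanti (left_mem_Icc.2 hy0.le) ⟨hz.le, hzy⟩ hz
    simpa [hh] using this
  have dr : ∀ z, 0 < z → z ≤ y → HasDerivAt (fun z => Real.sin (q * z) / Real.sin (p * z))
      (h z / Real.sin (p * z) ^ 2) z := by
    intro z hz hzy
    exact ((dsin q z).div (dsin p z) (posp z hz hzy).ne').congr_deriv (by simp only [hh]; ring)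
  have hr : StrictAntiOn (fun z => Real.sin (q * z) / Real.sin (p * z)) (Icc x y) := by
    refine strictAntiOn_of_deriv_neg (convex_Icc x y) (fun z hz =>
      (dr z (hx.trans_le hz.1) hz.2).continuousAt.continuousWithinAt) fun z hz => ?_
    rw [interior_Icc] at hz
    have hz0 : 0 < z := hx.trans hz.1
    rw [(dr z hz0 hz.2.le).deriv]
    exact div_neg_of_neg_of_pos (hneg z hz0 hz.2.le) (pow_pos (posp z hz0 hz.2.le) 2)
  have := hr (left_mem_Icc.2 hxy.le) (right_mem_Icc.2 hxy.le) hxy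
  rwa [div_lt_div_iff₀ (posp y hy0 le_rfl) (posp x hx hxy.le)] at this

lemma eq_or_eq_of_sin_eq {x s : ℝ} (hx : 0 < x) (hx' : x < Real.pi) (hs : 0 < s)
    (hs' : s ≤ Real.pi / 2) (h : Real.sin x = Real.sin s) : x = s ∨ x = Real.pi - s := by
  rcases le_total x (Real.pi / 2) with h1 | h1
  · exact Or.inl (Real.injOn_sin ⟨by linarith, h1⟩ ⟨by linarith, hs'⟩ h)
  · right
    rw [← Real.sin_pi_sub] at h
    have := Real.injOn_sin ⟨by linarith, by linarith⟩ ⟨by linarith, hs'⟩ h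
    linarith

lemma exists_acute {x : ℝ} (hx : 0 < x) (hx' : x < Real.pi) :
    ∃ s, 0 < s ∧ s ≤ Real.pi / 2 ∧ Real.sin s = Real.sin x ∧ (x = s ∨ x = Real.pi - s) := by
  rcases le_total x (Real.pi / 2) with h1 | h1
  · exact ⟨x, hx, h1, rfl, Or.inl rfl⟩
  · exact ⟨Real.pi - x, by linarith, by linarith, Real.sin_pi_sub x, Or.inr (by ring)⟩

lemma le_of_sin_eq_mul {κ x y : ℝ} (hκ : κ ≤ 1) (hx : 0 ≤ x) (hx' : x ≤ Real.pi / 2)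
    (hy : 0 < y) (hy' : y < Real.pi) (h : Real.sin x = κ * Real.sin y) : x ≤ y := by
  rcases le_or_gt y (Real.pi / 2) with h1 | h1
  · have : Real.sin x ≤ Real.sin y := by
      rw [h]; have := Real.sin_pos_of_pos_of_lt_pi hy hy'; nlinarith
    exact (Real.strictMonoOn_sin.le_iff_le ⟨by linarith, hx'⟩ ⟨by linarith, h1⟩).1 this
  · linarith

/-- The polygon inequality for one side `A` and `N` sides `B` of an inscribed polygon. -/
lemma le_mul_of_inscribed {κ A B s Θ : ℝ} {N : ℕ} (hN : 1 ≤ N) (hκ : 0 < κ) (hκ1 : κ ≤ 1)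
    (hA : 0 < A) (hA' : A < Real.pi / 2) (hB : 0 < B) (hB' : B < Real.pi / 2) (hs : 0 < s)
    (hs' : s ≤ Real.pi / 2) (hΘ' : Θ < Real.pi)
    (h1 : Real.sin A = κ * Real.sin Θ) (h2 : Real.sin B = κ * Real.sin s)
    (h : Θ = N * s ∨ Real.pi - s ≤ Θ) : A ≤ N * B := by
  have hN' : (1 : ℝ) ≤ N := by exact_mod_cast hN
  have hBN : B ≤ N * B := by nlinarith
  have hAB : Real.sin A ≤ Real.sin B → A ≤ N * B := fun h =>
    ((Real.strictMonoOn_sin.le_iff_le ⟨by linarith, by linarith⟩ ⟨by linarith, by linarith⟩).1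
      h).trans hBN
  rcases h with h | h
  -- As B ≤ s and sin(Nz) / sin z decreases, sin A / sin B = sin(Ns) / sin s ≤ sin(NB) / sin B,
  -- against N B < A.
  · by_contra hlt
    push Not at hlt
    have hBs : B ≤ s := le_of_sin_eq_mul hκ1 hB.le hB'.le hs (by linarith) h2
    have hsA : Real.sin (N * B) < Real.sin A :=
      Real.strictMonoOn_sin ⟨by nlinarith, by linarith⟩ ⟨by linarith, by linarith⟩ hlt
    have hsB : 0 < Real.sin B := Real.sin_pos_of_pos_of_lt_pi hB (by linarith)
    rw [h] at h1
    rcases hBs.eq_or_lt with rfl | hBs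
    · have hκ : κ = 1 := (mul_right_cancel₀ hsB.ne' (by linarith) : (1 : ℝ) = κ).symm
      rw [hκ, one_mul] at h1
      linarith
    · rcases hN'.eq_or_lt with hN1 | hN1
      · rw [← hN1, one_mul] at h1 hsA
        linarith
      · have := sin_mul_lt_sin_mul one_pos hN1 hB hBs (by linarith)
        rw [one_mul, one_mul] at this
        have h3 := mul_lt_mul_of_pos_left this hκ
        have h4 : Real.sin A * Real.sin B < Real.sin (N * B) * Real.sin B := by
          calc Real.sin A * Real.sin B = κ * (Real.sin (N * s) * Real.sin B) := by rw [h1]; ring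
            _ < κ * (Real.sin (N * B) * Real.sin s) := h3
            _ = _ := by rw [h2]; ring
        exact absurd (lt_of_mul_lt_mul_right h4 hsB.le) (by linarith)
  -- Here sin Θ ≤ sin s, so one side B already suffices.
  · apply hAB
    rw [h1, h2, ← Real.sin_pi_sub Θ]
    refine mul_le_mul_of_nonneg_left ?_ hκ.le
    exact Real.strictMonoOn_sin.monotoneOn ⟨by linarith, by linarith⟩
      ⟨by linarith, by linarith⟩ (by linarith)

/-- Eliminating κ leaves sin(Ns) sin B = sin A sin s, to be solved between s = B, where the two
bounds give sin A ≤ sin(NB), and s = π/N, where the left side vanishes. From s ≥ B follows κ ≤ 1. -/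
lemma exists_inscribed {A B N : ℝ} (hN : 2 ≤ N) (hA : 0 < A) (hA' : A < Real.pi / 2) (hB : 0 < B)
    (h1 : A ≤ N * B) (h2 : A + N * B < Real.pi) :
    ∃ κ s, 0 < κ ∧ κ ≤ 1 ∧ 0 < s ∧ N * s < Real.pi ∧
      Real.sin B = κ * Real.sin s ∧ Real.sin A = κ * Real.sin (N * s) := by
  have hBlt : B ≤ Real.pi / N := by rw [le_div_iff₀ (by linarith)]; nlinarith
  have hpiN : Real.pi / N ≤ Real.pi / 2 := by
    gcongr
  have hpi := Real.pi_pos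
  have hsA : 0 < Real.sin A := Real.sin_pos_of_pos_of_lt_pi hA (by linarith)
  have hsB : 0 < Real.sin B := Real.sin_pos_of_pos_of_lt_pi hB (by linarith)
  set f : ℝ → ℝ := fun s => Real.sin (N * s) * Real.sin B - Real.sin A * Real.sin s with hf
  have hfc : ContinuousOn f (Icc B (Real.pi / N)) := by fun_prop
  have hpos : 0 < Real.pi / N := by positivity
  have hle : Real.sin A ≤ Real.sin (N * B) := by
    rcases le_total (N * B) (Real.pi / 2) with h | h
    · exact Real.strictMonoOn_sin.monotoneOn ⟨by linarith, by linarith⟩ ⟨by linarith, h⟩ h1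
    · rw [← Real.sin_pi_sub (N * B)]
      exact Real.strictMonoOn_sin.monotoneOn ⟨by linarith, by linarith⟩
        ⟨by linarith, by linarith⟩ (by linarith)
  have hfB : 0 ≤ f B := by simp only [hf]; nlinarith
  have hfe : f (Real.pi / N) < 0 := by
    have e : N * (Real.pi / N) = Real.pi := by field_simp
    simp only [hf, e, Real.sin_pi, zero_mul, zero_sub]
    have := Real.sin_pos_of_pos_of_lt_pi hpos (by linarith)
    have := mul_pos hsA this
    linarith
  obtain ⟨s, hs, hfs⟩ := intermediate_value_Icc' hBlt hfc ⟨hfe.le, hfB⟩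
  have hs1 : s < Real.pi / N := lt_of_le_of_ne hs.2 fun h => by rw [h] at hfs; linarith
  have hs0 : 0 < s := hB.trans_le hs.1
  have hss : 0 < Real.sin s := Real.sin_pos_of_pos_of_lt_pi hs0 (by linarith)
  have hBs : Real.sin B ≤ Real.sin s := Real.strictMonoOn_sin.monotoneOn
    ⟨by linarith, by linarith⟩ ⟨by linarith, by linarith⟩ hs.1
  refine ⟨Real.sin B / Real.sin s, s, by positivity, (div_le_one hss).2 hBs, hs0, ?_, ?_, ?_⟩
  · rw [lt_div_iff₀ (by linarith)] at hs1; linarith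
  · field_simp
  · simp only [hf] at hfs
    field_simp
    linarith

end Trigonometry

/-! ### Necessary conditions: the sum of the line angles and the shuttle legs. -/

/-- The sum of the angles between successive collision lines, from `k` through `w` to the line of
the captured pair. -/
def pathAngle (a b : ℝ) : List Particle → Particle → ℝ
  | [], k => lineAngle a b k p3
  | l :: w, k => lineAngle a b k l + pathAngle a b w l

/-- Successive spectators differ, and the last one is not particle 3. -/
def ProperPath : List Particle → Particle → Prop
  | [], k => k ≠ p3
  | l :: w, k => k ≠ l ∧ ProperPath w l

section Necessity

variable {a b κ : ℝ} {m k l : Particle} {Φ Θ : ℝ} {w : List Particle}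

lemma lineAngle_le (hκ1 : κ ≤ 1) (ha : 0 < a) (hb : 0 < b) {σ : ℝ}
    (h0 : 0 < σ) (h1 : σ < Real.pi) (h : Real.sin (lineAngle a b k l) = κ * Real.sin σ) :
    lineAngle a b k l ≤ σ :=
  le_of_sin_eq_mul hκ1 (lineAngle_nonneg ha hb k l) (lineAngle_lt k l).le h0 h1 h

/-- Since κ ≤ 1 and line angles are acute, each swept angle is at least the line angle. -/
lemma AngularProcess.pathAngle_le (hκ1 : κ ≤ 1) (ha : 0 < a) (hb : 0 < b) (h0 : 0 < Θ)
    (h1 : Θ < Real.pi) (h : AngularProcess a b κ w m k Φ Θ) : pathAngle a b w k ≤ Θ := by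
  induction w generalizing m k Φ Θ with
  | nil => exact lineAngle_le hκ1 ha hb h0 h1 h.1
  | cons l w ih =>
    obtain ⟨Ψ, p0, p1', e1, -, e3⟩ := h
    have := lineAngle_le hκ1 ha hb (by linarith : 0 < Θ - Ψ) (by linarith) e1
    have := ih p0 (by linarith) e3
    simp only [pathAngle]; linarith

lemma AngularProcess.properPath (hκ : 0 < κ) (h0 : 0 < Θ)
    (h1 : Θ < Real.pi) (h : AngularProcess a b κ w m k Φ Θ) : ProperPath w k := by
  induction w generalizing m k Φ Θ with
  | nil => exact ne_of_sin_lineAngle hκ h0 h1 h.1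
  | cons l w ih =>
    obtain ⟨Ψ, p0, p1', e1, -, e3⟩ := h
    have h2 : k ≠ l := ne_of_sin_lineAngle hκ (by linarith : 0 < Θ - Ψ) (by linarith) e1
    have h3 : ProperPath w l := ih p0 (by linarith) e3
    exact ⟨h2, h3⟩

lemma CaptureAllowed.pathAngle_le (ha : 0 < a) (hb : 0 < b) (h : CaptureAllowed a b w) :
    w ≠ [] ∧ ProperPath w p1 ∧ pathAngle a b w p1 ≤ Real.pi := by
  cases w with
  | nil => exact absurd h not_captureAllowed_nil
  | cons k w =>
    obtain ⟨κ, Θ, hκ, hκ1, h0, h1, hs, hA⟩ := (captureAllowed_cons_iff ha hb k w).1 h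
    rw [← Real.sin_pi_sub Θ] at hs
    have := hA.pathAngle_le hκ1 ha hb h0 h1
    have := lineAngle_le hκ1 ha hb (by linarith : 0 < Real.pi - Θ) (by linarith) hs
    have h2 : p1 ≠ k := ne_of_sin_lineAngle hκ (by linarith : 0 < Real.pi - Θ) (by linarith) hs
    have h3 : ProperPath w k := hA.properPath hκ h0 h1
    refine ⟨by simp, ⟨h2, h3⟩, ?_⟩
    simp only [pathAngle]; linarith

/-- Equality would give κ = 1, and then sin(σ + τ) would be the sine of the third line angle,
because the three add up to π: no deflection. -/
lemma not_straight_sum (ha : 0 < a) (hb : 0 < b) (hκ1 : κ ≤ 1) {σ τ : ℝ}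
    (hmk : m ≠ k) (hkl : k ≠ l) (hml : m ≠ l) (h0 : 0 < σ) (h1 : 0 < τ) (h2 : σ + τ ≤ Real.pi)
    (e1 : Real.sin (lineAngle a b m k) = κ * Real.sin σ)
    (e2 : Real.sin (lineAngle a b k l) = κ * Real.sin τ)
    (e3 : Real.sin (lineAngle a b m l) ≠ κ * Real.sin (σ + τ)) :
    lineAngle a b m k + lineAngle a b k l < σ + τ := by
  have l1 := lineAngle_le hκ1 ha hb h0 (by linarith) e1
  have l2 := lineAngle_le hκ1 ha hb h1 (by linarith) e2
  refine lt_of_le_of_ne (by linarith) fun h => e3 ?_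
  have hσ : lineAngle a b m k = σ := by linarith
  have hκ : κ = 1 := by
    rw [← hσ] at e1
    exact (mul_right_cancel₀ (sin_lineAngle_pos ha hb hmk).ne' (by linarith) : (1 : ℝ) = κ).symm
  rw [← h, hκ, one_mul, ← Real.sin_pi_sub]
  congr 1
  linarith [lineAngle_triangle ha hb hmk hkl hml]

lemma AngularProcess.lt_of_distinct (ha : 0 < a) (hb : 0 < b) (hκ : 0 < κ) (hκ1 : κ ≤ 1)
    (h1 : Θ < Φ) (h2 : Φ ≤ Real.pi)
    (e : Real.sin (lineAngle a b m k) = κ * Real.sin (Φ - Θ)) (hml : m ≠ l)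
    (h : AngularProcess a b κ (l :: w) m k Φ Θ) :
    lineAngle a b m k + pathAngle a b (l :: w) k < Φ := by
  obtain ⟨Ψ, p0, p1', e1, e2, e3⟩ := h
  have := not_straight_sum ha hb hκ1 (ne_of_sin_lineAngle hκ (by linarith) (by linarith) e)
    (ne_of_sin_lineAngle hκ (by linarith) (by linarith) e1) hml (by linarith) (by linarith)
    (by linarith) e e1 (by rw [sub_add_sub_cancel]; exact e2 hml)
  have := e3.pathAngle_le hκ1 ha hb p0 (by linarith)
  simp only [pathAngle]; linarith

/-- Strictness comes from the first three consecutive distinct lines. They occur at the latest when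
an alternation of 1 and 2 ends on the line of spectator 3. -/
lemma AngularProcess.lt_of_ne_three (ha : 0 < a) (hb : 0 < b) (hκ : 0 < κ) (hκ1 : κ ≤ 1)
    (h0 : 0 < Θ) (h1 : Θ < Φ) (h2 : Φ ≤ Real.pi)
    (e : Real.sin (lineAngle a b m k) = κ * Real.sin (Φ - Θ)) (hm : m ≠ p3) (hk : k ≠ p3)
    (h : AngularProcess a b κ w m k Φ Θ) :
    lineAngle a b m k + pathAngle a b w k < Φ := by
  induction w generalizing m k Φ Θ with
  | nil =>
    have := not_straight_sum ha hb hκ1 (ne_of_sin_lineAngle hκ (by linarith) (by linarith) e)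
      hk hm (by linarith) h0 (by linarith) e h.1 (by rw [sub_add_cancel]; exact h.2 hm)
    simp only [pathAngle]; linarith
  | cons l w ih =>
    by_cases hml : m = l
    · subst hml
      obtain ⟨Ψ, p0, p1', e1, e2, e3⟩ := h
      have := ih p0 p1' (by linarith) e1 hk hm e3
      have := lineAngle_le hκ1 ha hb (by linarith : 0 < Φ - Θ) (by linarith) e
      simp only [pathAngle]; linarith
    · exact h.lt_of_distinct ha hb hκ hκ1 h1 h2 e hml

lemma lineAngle_of_ne_one (hk : k ≠ p1) (hl : l ≠ p1) (hkl : k ≠ l) :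
    lineAngle a b k l = midAngle a b p1 := by
  cases k <;> cases l <;> simp_all [lineAngle]

lemma lineAngle_of_ne_three (hk : k ≠ p3) (hl : l ≠ p3) (hkl : k ≠ l) :
    lineAngle a b k l = midAngle a b p3 := by
  cases k <;> cases l <;> simp_all [lineAngle]

/-- A final part of the process with particle 1 going back and forth. -/
lemma AngularProcess.shuttle_one (hκ : 0 < κ) (h0 : 0 < Θ) (h1 : Θ < Real.pi)
    (hk : k ≠ p1) (hw : ∀ x ∈ w, x ≠ p1) (h : AngularProcess a b κ w m k Φ Θ) :
    ∃ s, 0 < s ∧ s ≤ Real.pi / 2 ∧ Real.sin (midAngle a b p1) = κ * Real.sin s ∧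
      (Θ = (w.length + 1 : ℕ) * s ∨ Real.pi - s ≤ Θ) := by
  induction w generalizing m k Φ Θ with
  | nil =>
    obtain ⟨s, s0, s1, s2, s3⟩ := exists_acute h0 h1
    refine ⟨s, s0, s1, ?_, ?_⟩
    · rw [s2, ← h.1, lineAngle_of_ne_one hk (by simp) (ne_of_sin_lineAngle hκ h0 h1 h.1)]
    · simpa using s3.imp id (fun h => h.ge)
  | cons l w ih =>
    obtain ⟨Ψ, p0, p1', e1, e2, e3⟩ := h
    obtain ⟨s, s0, s1, s2, s3⟩ := ih p0 (by linarith) (hw l (by simp))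
      (fun x hx => hw x (by simp [hx])) e3
    refine ⟨s, s0, s1, s2, ?_⟩
    rw [lineAngle_of_ne_one hk (hw l (by simp))
      (ne_of_sin_lineAngle hκ (by linarith) (by linarith) e1), s2] at e1
    -- A leg sweeps s or π − s, and one long leg already gives the second alternative.
    rcases s3 with s3 | s3
    · rcases eq_or_eq_of_sin_eq (by linarith : 0 < Θ - Ψ) (by linarith) s0 s1
        (mul_left_cancel₀ hκ.ne' e1).symm with h | h
      · left
        rw [List.length_cons, Nat.cast_add, add_mul, ← s3]; push_cast; linarith
      · right; linarith
    · right; linarith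

/-- A process with particle 3 going back and forth until the last collision. -/
lemma AngularProcess.shuttle_three (hκ : 0 < κ) (h0 : 0 < Θ) (hΦ : Θ < Φ) (h1 : Φ ≤ Real.pi)
    (hm : m ≠ p3) (hk : k ≠ p3) (hw : ∀ x ∈ w, x ≠ p3)
    (e : Real.sin (lineAngle a b m k) = κ * Real.sin (Φ - Θ))
    (h : AngularProcess a b κ w m k Φ Θ) :
    ∃ s t l, 0 < s ∧ s ≤ Real.pi / 2 ∧ Real.sin (midAngle a b p3) = κ * Real.sin s ∧
      l ≠ p3 ∧ Real.sin (lineAngle a b l p3) = κ * Real.sin t ∧ 0 < t ∧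
      lineAngle a b m k + pathAngle a b w k =
        (w.length + 1 : ℕ) * midAngle a b p3 + lineAngle a b l p3 ∧
      (Φ = (w.length + 1 : ℕ) * s + t ∨ Real.pi - s + t ≤ Φ) := by
  have hmk := ne_of_sin_lineAngle hκ (by linarith) (by linarith) e
  rw [lineAngle_of_ne_three hm hk hmk] at e ⊢
  induction w generalizing m k Φ Θ with
  | nil =>
    obtain ⟨s, s0, s1, s2, s3⟩ := exists_acute (by linarith : 0 < Φ - Θ) (by linarith)
    refine ⟨s, Θ, k, s0, s1, by rw [e, s2], hk, h.1, h0, by simp [pathAngle], ?_⟩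
    rcases s3 with s3 | s3
    · left; simp; linarith
    · right; linarith
  | cons l w ih =>
    obtain ⟨Ψ, p0, p1', e1, e2, e3⟩ := h
    have hkl := ne_of_sin_lineAngle hκ (by linarith) (by linarith) e1
    have hl := hw l (by simp)
    rw [lineAngle_of_ne_three hk hl hkl] at e1
    obtain ⟨s, t, l', s0, s1, s2, hl', ht, t0, hp, s3⟩ := ih p0 p1' (by linarith) hk hl
      (fun x hx => hw x (by simp [hx])) e1 e3 hkl
    refine ⟨s, t, l', s0, s1, s2, hl', ht, t0, ?_, ?_⟩
    · simp only [pathAngle]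
      rw [lineAngle_of_ne_three hk hl hkl, hp, List.length_cons]; push_cast; ring
    · rw [s2] at e
      rcases s3 with s3 | s3
      · rcases eq_or_eq_of_sin_eq (by linarith : 0 < Φ - Θ) (by linarith) s0 s1
          (mul_left_cancel₀ hκ.ne' e).symm with h | h
        · left
          rw [List.length_cons]; push_cast at s3 ⊢; linarith
        · right
          have : 0 ≤ ((w.length + 1 : ℕ) : ℝ) * s := by positivity
          linarith
      · right; linarith

end Necessity

/-! ### Exact conditions for the five families and the single collision. -/

section Families

variable {a b κ s t T : ℝ} {m k : Particle} {Φ Θ : ℝ}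

lemma pairPow_zero (x y : Particle) : pairPow x y 0 = [] := rfl

lemma pairPow_succ (x y : Particle) (n : ℕ) : pairPow x y (n + 1) = x :: y :: pairPow x y n := by
  simp [pairPow, List.replicate_succ]

lemma length_pairPow (x y : Particle) (n : ℕ) : (pairPow x y n).length = 2 * n := by
  induction n with
  | zero => rfl
  | succ n ih => rw [pairPow_succ]; simp [ih]; ring

lemma mem_pairPow {x y z : Particle} {n : ℕ} (h : z ∈ pairPow x y n) : z = x ∨ z = y := by
  induction n with
  | zero => simp [pairPow_zero] at h
  | succ n ih =>
    rw [pairPow_succ] at h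
    rcases List.mem_cons.1 h with h | h
    · exact Or.inl h
    · rcases List.mem_cons.1 h with h | h
      · exact Or.inr h
      · exact ih h

lemma pathAngle_pairPow_two (n : ℕ) :
    pathAngle a b (pairPow p3 p2 n) p2 = (2 * n + 1) * midAngle a b p1 := by
  induction n with
  | zero => simp [pairPow_zero, pathAngle, lineAngle]
  | succ n ih => rw [pairPow_succ]; simp only [pathAngle, lineAngle, ih]; push_cast; ring

lemma pathAngle_pairPow_append (n : ℕ) (w : List Particle) :
    pathAngle a b (pairPow p2 p1 n ++ w) p1 = 2 * n * midAngle a b p3 + pathAngle a b w p1 := by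
  induction n with
  | zero => simp [pairPow_zero]
  | succ n ih =>
    rw [pairPow_succ]; simp only [List.cons_append, pathAngle, lineAngle, ih]; push_cast; ring

lemma pathAngle_seq31 (n : ℕ) :
    pathAngle a b (seq31 n) p1 = (2 * n + 1) * midAngle a b p2 := by
  induction n with
  | zero => simp [seq31, pairPow_zero, pathAngle, lineAngle]
  | succ n ih =>
    rw [seq31] at ih ⊢
    rw [pairPow_succ]; simp only [pathAngle, lineAngle, ih]; push_cast; ring

/-- All legs sweep `s`. From the second collision on, the lines before and after coincide, so `hΦ`
is the only deflection condition. -/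
lemma angularProcess_pairPow_two (hs : 0 < s) (h : Real.sin (midAngle a b p1) = κ * Real.sin s)
    (n : ℕ) (hΦ : m ≠ p3 → Real.sin (lineAngle a b m p3) ≠ κ * Real.sin (Φ - 2 * n * s)) :
    AngularProcess a b κ (pairPow p3 p2 n) m p2 Φ ((2 * n + 1) * s) := by
  induction n generalizing m Φ with
  | zero => exact ⟨by simpa [lineAngle] using h, by simpa using hΦ⟩
  | succ n ih =>
    rw [pairPow_succ]
    push_cast at hΦ ⊢
    refine ⟨2 * (n + 1) * s, by positivity, by linarith, ?_, hΦ, (2 * n + 1) * s, by positivity,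
      by linarith, ?_, fun h => absurd rfl h, ih fun h => absurd rfl h⟩
    · rw [show (2 * ((n : ℝ) + 1) + 1) * s - 2 * (n + 1) * s = s by ring]; exact h
    · rw [show 2 * ((n : ℝ) + 1) * s - (2 * n + 1) * s = s by ring]; exact h

lemma angularProcess_pairPow_append (hs : 0 < s) (hT : 0 < T)
    (h : Real.sin (midAngle a b p3) = κ * Real.sin s) {w : List Particle}
    (hw : AngularProcess a b κ w p2 p1 (s + T) T) (n : ℕ) :
    AngularProcess a b κ (pairPow p2 p1 n ++ w) p2 p1 ((2 * n + 1) * s + T) (2 * n * s + T) := by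
  induction n with
  | zero => simpa [pairPow_zero] using hw
  | succ n ih =>
    rw [pairPow_succ]
    push_cast
    refine ⟨(2 * n + 1) * s + T, by positivity, by linarith, ?_, fun h => absurd rfl h,
      2 * n * s + T, by positivity, by linarith, ?_, fun h => absurd rfl h, ih⟩
    · rw [show (2 * ((n : ℝ) + 1)) * s + T - ((2 * n + 1) * s + T) = s by ring]; exact h
    · rw [show (2 * (n : ℝ) + 1) * s + T - (2 * n * s + T) = s by ring]; exact h

lemma angularProcess_pairPow_one (hs : 0 < s) (h : Real.sin (midAngle a b p2) = κ * Real.sin s)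
    (n : ℕ) : AngularProcess a b κ (pairPow p3 p1 n) p3 p1 Φ ((2 * n + 1) * s) := by
  induction n generalizing Φ with
  | zero => exact ⟨by simpa [lineAngle] using h, fun h => absurd rfl h⟩
  | succ n ih =>
    rw [pairPow_succ]
    push_cast
    refine ⟨2 * (n + 1) * s, by positivity, by linarith, ?_, fun h => absurd rfl h,
      (2 * n + 1) * s, by positivity, by linarith, ?_, fun h => absurd rfl h, ih⟩
    · rw [show (2 * ((n : ℝ) + 1) + 1) * s - 2 * (n + 1) * s = s by ring]; exact h
    · rw [show 2 * ((n : ℝ) + 1) * s - (2 * n + 1) * s = s by ring]; exact h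

/-- All 2n+3 sides are sin ω₂, so the angles may be taken equal. No three consecutive lines are
distinct, hence equality is allowed. -/
theorem captureAllowed_seq31_iff (ha : 0 < a) (hb : 0 < b) (n : ℕ) :
    CaptureAllowed a b (seq31 (n + 1)) ↔ (2 * (n + 1 : ℕ) + 1) * midAngle a b p2 ≤ Real.pi := by
  constructor
  · intro h
    rw [← pathAngle_seq31]
    exact (h.pathAngle_le ha hb).2.2
  · intro h
    push_cast at h
    have hpi := Real.pi_pos
    set s := Real.pi / (2 * n + 3) with hs
    have hs0 : 0 < s := by positivity
    have hsn : (2 * n + 3) * s = Real.pi := by rw [hs]; field_simp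
    have hWs : midAngle a b p2 ≤ s := by rw [hs, le_div_iff₀ (by positivity)]; linarith
    have hs2 : s ≤ Real.pi / 2 := by
      have : 0 ≤ n * s := by positivity
      linarith
    have hW := midAngle_pos ha hb p2
    have hsW : 0 < Real.sin (midAngle a b p2) := Real.sin_pos_of_pos_of_lt_pi hW (by linarith)
    have hss : 0 < Real.sin s := Real.sin_pos_of_pos_of_lt_pi hs0 (by linarith)
    have hle : Real.sin (midAngle a b p2) ≤ Real.sin s := Real.strictMonoOn_sin.monotoneOn
      ⟨by linarith, by linarith⟩ ⟨by linarith, by linarith⟩ hWs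
    have he : Real.sin (midAngle a b p2) =
        Real.sin (midAngle a b p2) / Real.sin s * Real.sin s := by field_simp
    rw [seq31, pairPow_succ, captureAllowed_cons_iff ha hb]
    refine ⟨Real.sin (midAngle a b p2) / Real.sin s, Real.pi - s, by positivity,
      (div_le_one hss).2 hle, by linarith, by linarith, by rw [Real.sin_pi_sub]; exact he,
      (2 * n + 1) * s, by positivity, by linarith, ?_, fun h => absurd rfl h,
      angularProcess_pairPow_one hs0 he n⟩
    rw [show Real.pi - s - (2 * n + 1) * s = s by linarith]
    exact he

theorem captureAllowed_seq32_iff (ha : 0 < a) (hb : 0 < b) (n : ℕ) :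
    CaptureAllowed a b (seq32 (n + 1)) ↔
      midAngle a b p2 ≤ (2 * n + 2 : ℕ) * midAngle a b p1 ∧
      midAngle a b p2 + (2 * n + 2 : ℕ) * midAngle a b p1 < Real.pi := by
  have W1 := midAngle_pos ha hb p1
  have W2 := midAngle_pos ha hb p2
  have W1' := midAngle_lt (a := a) (b := b) p1
  have W2' := midAngle_lt (a := a) (b := b) p2
  rw [seq32, pairPow_succ, captureAllowed_cons_iff ha hb]
  constructor
  · rintro ⟨κ, Θ, hκ, hκ1, h0, h1, hs, hA⟩
    constructor
    · obtain ⟨s, s0, s1, s2, s3⟩ := hA.shuttle_one hκ h0 h1 (by simp) (by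
        intro x hx
        rcases List.mem_cons.1 hx with rfl | hx
        · simp
        · rcases mem_pairPow hx with rfl | rfl <;> simp)
      rw [List.length_cons, length_pairPow] at s3
      exact le_mul_of_inscribed (by lia) hκ hκ1 W2 W2' W1 W1' s0 s1 h1 hs s2 s3
    · have := hA.lt_of_distinct ha hb hκ hκ1 h1 le_rfl (by rwa [Real.sin_pi_sub]) (by simp)
      simp only [pathAngle, pathAngle_pairPow_two, lineAngle] at this
      push_cast; linarith
  · rintro ⟨h1, h2⟩
    obtain ⟨κ, s, hκ, hκ1, hs, hNs, e1, e2⟩ :=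
      exists_inscribed (by push_cast; linarith [(n.cast_nonneg : (0 : ℝ) ≤ n)]) W2 W2' W1 h1 h2
    push_cast at h1 h2 hNs e2
    have hn : 0 ≤ n * s := by positivity
    refine ⟨κ, (2 * n + 2) * s, hκ, hκ1, by positivity, hNs, e2, (2 * n + 1) * s, by positivity,
      by linarith, ?_, fun _ e3 => ?_, angularProcess_pairPow_two hs e1 n fun h => absurd rfl h⟩
    · rw [show (2 * (n : ℝ) + 2) * s - (2 * n + 1) * s = s by ring]; exact e1
    -- Without deflection at the first collision, similarity of triangles would give ω₁ = s and ω₂ =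
    -- π − (2n+2)s, against the strict bound.
    · rw [Real.sin_pi_sub] at e3
      have sum := midAngle_sum ha hb
      have W3 := midAngle_pos ha hb p3
      rw [← Real.sin_pi_sub ((2 * n + 2) * s)] at e2
      have i1 := eq_of_sin_eq_mul_sin W1 W2 W3 sum hs (by linarith) (by positivity) (by ring)
        hκ e1 e2 e3
      have i2 := eq_of_sin_eq_mul_sin W2 W1 W3 (by linarith)
        (by linarith : 0 < Real.pi - (2 * n + 2) * s) hs
        (by positivity : 0 < (2 * n + 1) * s) (by ring) hκ e2 e1 e3
      rw [i1, i2] at h2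
      linarith

theorem captureAllowed_seq232_iff (ha : 0 < a) (hb : 0 < b) (n : ℕ) :
    CaptureAllowed a b (seq232 (n + 1)) ↔
      midAngle a b p3 ≤ (2 * n + 3 : ℕ) * midAngle a b p1 ∧
      midAngle a b p3 + (2 * n + 3 : ℕ) * midAngle a b p1 < Real.pi := by
  have W1 := midAngle_pos ha hb p1
  have W3 := midAngle_pos ha hb p3
  have W1' := midAngle_lt (a := a) (b := b) p1
  have W3' := midAngle_lt (a := a) (b := b) p3
  rw [seq232, captureAllowed_cons_iff ha hb]
  constructor
  · rintro ⟨κ, Θ, hκ, hκ1, h0, h1, hs, hA⟩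
    constructor
    · obtain ⟨s, s0, s1, s2, s3⟩ := hA.shuttle_one hκ h0 h1 (by simp) (by
        intro x hx
        rcases mem_pairPow hx with rfl | rfl <;> simp)
      rw [length_pairPow] at s3
      exact le_mul_of_inscribed (by lia) hκ hκ1 W3 W3' W1 W1' s0 s1 h1 hs s2 s3
    · rw [pairPow_succ] at hA
      have := hA.lt_of_distinct ha hb hκ hκ1 h1 le_rfl (by rwa [Real.sin_pi_sub]) (by simp)
      rw [← pairPow_succ, pathAngle_pairPow_two] at this
      simp only [lineAngle] at this
      push_cast at this ⊢; linarith
  · rintro ⟨h1, h2⟩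
    obtain ⟨κ, s, hκ, hκ1, hs, hNs, e1, e2⟩ :=
      exists_inscribed (by push_cast; linarith [(n.cast_nonneg : (0 : ℝ) ≤ n)]) W3 W3' W1 h1 h2
    push_cast at h1 h2 hNs e2
    have hn : 0 ≤ n * s := by positivity
    refine ⟨κ, (2 * n + 3) * s, hκ, hκ1, by positivity, hNs, e2, ?_⟩
    have := angularProcess_pairPow_two (m := p1) (Φ := Real.pi) hs e1 (n + 1) (fun _ e3 => ?_)
    · rwa [show (2 * ((n + 1 : ℕ) : ℝ) + 1) * s = (2 * n + 3) * s by push_cast; ring] at this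
    · push_cast at e3
      rw [Real.sin_pi_sub] at e3
      have sum := midAngle_sum ha hb
      have W2 := midAngle_pos ha hb p2
      rw [← Real.sin_pi_sub ((2 * n + 3) * s)] at e2
      have i1 := eq_of_sin_eq_mul_sin W1 W3 W2 (by linarith) hs (by linarith)
        (by positivity : 0 < 2 * (n + 1) * s) (by ring) hκ e1 e2 e3
      have i2 := eq_of_sin_eq_mul_sin W3 W1 W2 (by linarith)
        (by linarith : 0 < Real.pi - (2 * n + 3) * s) hs
        (by positivity : 0 < 2 * (n + 1) * s) (by ring) hκ e2 e1 e3
      rw [i1, i2] at h2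
      linarith

/-- The reversed polygon of (32)ⁿ⁺¹ with ω₁ and ω₃ exchanged; only the last collision carries a
deflection condition. -/
theorem captureAllowed_seq21_iff (ha : 0 < a) (hb : 0 < b) (n : ℕ) :
    CaptureAllowed a b (seq21 (n + 1)) ↔
      midAngle a b p2 ≤ (2 * n + 2 : ℕ) * midAngle a b p3 ∧
      midAngle a b p2 + (2 * n + 2 : ℕ) * midAngle a b p3 < Real.pi := by
  have W3 := midAngle_pos ha hb p3
  have W2 := midAngle_pos ha hb p2
  have W3' := midAngle_lt (a := a) (b := b) p3
  have W2' := midAngle_lt (a := a) (b := b) p2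
  have hpath : pathAngle a b (seq21 (n + 1)) p1 =
      (2 * n + 2) * midAngle a b p3 + midAngle a b p2 := by
    have := pathAngle_pairPow_append (a := a) (b := b) (n + 1) []
    rw [List.append_nil] at this
    rw [seq21, this]; simp only [pathAngle, lineAngle]; push_cast; ring
  have hsucc : seq21 (n + 1) = p2 :: p1 :: pairPow p2 p1 n := pairPow_succ _ _ _
  rw [hsucc] at hpath ⊢
  rw [captureAllowed_cons_iff ha hb]
  constructor
  · rintro ⟨κ, Θ, hκ, hκ1, h0, h1, hs, hA⟩
    have hs' := hs
    rw [← Real.sin_pi_sub Θ] at hs'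
    constructor
    · obtain ⟨s, t, l, s0, s1, s2, hl, ht, t0, hp, s3⟩ := hA.shuttle_three hκ h0 h1 le_rfl
        (by simp) (by simp) (by
          intro x hx
          rcases List.mem_cons.1 hx with rfl | hx
          · simp
          · rcases mem_pairPow hx with rfl | rfl <;> simp) hs'
      rw [pathAngle] at hpath
      rw [hpath, List.length_cons, length_pairPow] at hp
      push_cast at hp
      -- Comparing two expressions for the path sum identifies the last leg without inspecting the
      -- end of the list.
      have hl2 : lineAngle a b l p3 = midAngle a b p2 := by linarith
      rw [hl2] at ht
      rw [List.length_cons, length_pairPow] at s3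
      refine le_mul_of_inscribed (by lia) hκ hκ1 W2 W2' W3 W3' s0 s1
        (by linarith : Real.pi - t < Real.pi) ?_ s2 ?_
      · rw [ht, Real.sin_pi_sub]
      · rcases s3 with s3 | s3
        · left; linarith
        · right; linarith
    · have := hA.lt_of_ne_three ha hb hκ hκ1 h0 h1 le_rfl hs' (by simp) (by simp)
      rw [pathAngle] at hpath
      push_cast; linarith
  · rintro ⟨h1, h2⟩
    obtain ⟨κ, s, hκ, hκ1, hs, hNs, e1, e2⟩ :=
      exists_inscribed (by push_cast; linarith [(n.cast_nonneg : (0 : ℝ) ≤ n)]) W2 W2' W3 h1 h2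
    push_cast at h1 h2 hNs e2
    have hn : 0 ≤ n * s := by positivity
    rw [← Real.sin_pi_sub ((2 * n + 2) * s)] at e2
    set t := Real.pi - (2 * n + 2) * s with ht
    have ht0 : 0 < t := by linarith
    have hend : AngularProcess a b κ [] p2 p1 (s + t) t := by
      refine ⟨e2, fun _ e3 => ?_⟩
      have sum := midAngle_sum ha hb
      have W1 := midAngle_pos ha hb p1
      rw [← Real.sin_pi_sub (s + t)] at e3
      have i1 := eq_of_sin_eq_mul_sin W3 W2 W1 (by linarith) hs ht0
        (by linarith : 0 < Real.pi - (s + t)) (by ring) hκ e1 e2 e3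
      have i2 := eq_of_sin_eq_mul_sin W2 W3 W1 (by linarith) ht0 hs
        (by linarith : 0 < Real.pi - (s + t)) (by ring) hκ e2 e1 e3
      rw [i1, i2] at h2
      linarith
    have := angularProcess_pairPow_append hs ht0 e1 hend n
    rw [List.append_nil] at this
    refine ⟨κ, (2 * n + 1) * s + t, hκ, hκ1, by positivity, by linarith, ?_, 2 * n * s + t,
      by positivity, by linarith, ?_, fun h => absurd rfl h, this⟩
    · rw [← Real.sin_pi_sub ((2 * n + 1) * s + t),
        show Real.pi - ((2 * n + 1) * s + t) = s by rw [ht]; ring]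
      exact e1
    · rw [show (2 * (n : ℝ) + 1) * s + t - (2 * n * s + t) = s by ring]; exact e1

theorem captureAllowed_seq212_iff (ha : 0 < a) (hb : 0 < b) (n : ℕ) :
    CaptureAllowed a b (seq212 (n + 1)) ↔
      midAngle a b p1 ≤ (2 * n + 3 : ℕ) * midAngle a b p3 ∧
      midAngle a b p1 + (2 * n + 3 : ℕ) * midAngle a b p3 < Real.pi := by
  have W3 := midAngle_pos ha hb p3
  have W1 := midAngle_pos ha hb p1
  have W3' := midAngle_lt (a := a) (b := b) p3
  have W1' := midAngle_lt (a := a) (b := b) p1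
  have hpath : pathAngle a b (seq212 (n + 1)) p1 =
      (2 * n + 3) * midAngle a b p3 + midAngle a b p1 := by
    rw [seq212, pathAngle_pairPow_append]; simp only [pathAngle, lineAngle]; push_cast; ring
  have hsucc : seq212 (n + 1) = p2 :: p1 :: (pairPow p2 p1 n ++ [p2]) := by
    rw [seq212, pairPow_succ]; rfl
  rw [hsucc] at hpath ⊢
  rw [captureAllowed_cons_iff ha hb]
  constructor
  · rintro ⟨κ, Θ, hκ, hκ1, h0, h1, hs, hA⟩
    have hs' := hs
    rw [← Real.sin_pi_sub Θ] at hs'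
    constructor
    · obtain ⟨s, t, l, s0, s1, s2, hl, ht, t0, hp, s3⟩ := hA.shuttle_three hκ h0 h1 le_rfl
        (by simp) (by simp) (by
          intro x hx
          rcases List.mem_cons.1 hx with rfl | hx
          · simp
          · rcases List.mem_append.1 hx with hx | hx
            · rcases mem_pairPow hx with rfl | rfl <;> simp
            · rw [List.mem_singleton.1 hx]; simp) hs'
      rw [pathAngle] at hpath
      rw [hpath, List.length_cons, List.length_append, length_pairPow] at hp
      push_cast at hp
      have hl2 : lineAngle a b l p3 = midAngle a b p1 := by
        simp only [List.length_singleton] at hp; push_cast at hp; linarith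
      rw [hl2] at ht
      rw [List.length_cons, List.length_append, length_pairPow] at s3
      refine le_mul_of_inscribed (by lia) hκ hκ1 W1 W1' W3 W3' s0 s1
        (by linarith : Real.pi - t < Real.pi) ?_ s2 ?_
      · rw [ht, Real.sin_pi_sub]
      · rcases s3 with s3 | s3
        · left
          simp only [List.length_singleton] at s3
          rw [show 2 * n + 3 = 2 * n + 1 + 1 + 1 by ring]
          linarith
        · right; linarith
    · have := hA.lt_of_ne_three ha hb hκ hκ1 h0 h1 le_rfl hs' (by simp) (by simp)
      rw [pathAngle] at hpath
      push_cast; linarith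
  · rintro ⟨h1, h2⟩
    obtain ⟨κ, s, hκ, hκ1, hs, hNs, e1, e2⟩ :=
      exists_inscribed (by push_cast; linarith [(n.cast_nonneg : (0 : ℝ) ≤ n)]) W1 W1' W3 h1 h2
    push_cast at h1 h2 hNs e2
    have hn : 0 ≤ n * s := by positivity
    rw [← Real.sin_pi_sub ((2 * n + 3) * s)] at e2
    set t := Real.pi - (2 * n + 3) * s with ht
    have ht0 : 0 < t := by linarith
    have hend : AngularProcess a b κ [p2] p2 p1 (s + (s + t)) (s + t) := by
      refine ⟨t, ht0, by linarith, ?_, fun h => absurd rfl h, e2, fun _ e3 => ?_⟩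
      · rw [add_sub_cancel_right]; exact e1
      have sum := midAngle_sum ha hb
      have W2 := midAngle_pos ha hb p2
      rw [← Real.sin_pi_sub (s + t)] at e3
      have i1 := eq_of_sin_eq_mul_sin W3 W1 W2 (by linarith) hs ht0
        (by linarith : 0 < Real.pi - (s + t)) (by ring) hκ e1 e2 e3
      have i2 := eq_of_sin_eq_mul_sin W1 W3 W2 (by linarith) ht0 hs
        (by linarith : 0 < Real.pi - (s + t)) (by ring) hκ e2 e1 e3
      rw [i1, i2] at h2
      linarith
    have := angularProcess_pairPow_append hs (by positivity) e1 hend n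
    refine ⟨κ, (2 * n + 1) * s + (s + t), hκ, hκ1, by positivity, by linarith, ?_,
      2 * n * s + (s + t), by positivity, by linarith, ?_, fun h => absurd rfl h, this⟩
    · rw [← Real.sin_pi_sub ((2 * n + 1) * s + (s + t)),
        show Real.pi - ((2 * n + 1) * s + (s + t)) = s by rw [ht]; ring]
      exact e1
    · rw [show (2 * (n : ℝ) + 1) * s + (s + t) - (2 * n * s + (s + t)) = s by ring]; exact e1

/-- A polygon of two sides closes only if they are equal: the swept angles are Θ and π − Θ. -/
theorem captureAllowed_single_iff (ha : 0 < a) (hb : 0 < b) :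
    CaptureAllowed a b [p2] ↔ midAngle a b p1 = midAngle a b p3 := by
  have W1 := midAngle_pos ha hb p1
  have W1' := midAngle_lt (a := a) (b := b) p1
  have W3 := midAngle_pos ha hb p3
  have W3' := midAngle_lt (a := a) (b := b) p3
  rw [captureAllowed_cons_iff ha hb]
  constructor
  · rintro ⟨κ, Θ, hκ, hκ1, h0, h1, hs, hA⟩
    have := hA.1
    rw [← hs] at this
    exact Real.injOn_sin ⟨by linarith, by linarith⟩ ⟨by linarith, by linarith⟩ this
  · intro h
    refine ⟨1, midAngle a b p1, one_pos, le_rfl, W1, by linarith, ?_, ?_, fun _ => ?_⟩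
    · rw [one_mul, h]; rfl
    · rw [one_mul]; rfl
    · rw [Real.sin_pi, mul_zero]
      exact (sin_lineAngle_pos ha hb (by simp)).ne'

end Families

/-! ### Excluding all other sequences by the path sum. -/

section Uniqueness

variable {a b : ℝ}

/-- Repeated triangle inequality: the ω's are acute with sum π, so none exceeds the sum of the
others. -/
lemma lineAngle_le_pathAngle (ha : 0 < a) (hb : 0 < b) (w : List Particle) (k : Particle) :
    lineAngle a b k p3 ≤ pathAngle a b w k := by
  induction w generalizing k with
  | nil => exact le_rfl
  | cons l w ih =>
    have h1 := ih l
    have h2 := midAngle_sum ha hb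
    have h3 := midAngle_lt (a := a) (b := b) p1
    have h4 := midAngle_lt (a := a) (b := b) p2
    have h5 := midAngle_lt (a := a) (b := b) p3
    have h6 := midAngle_pos ha hb p1
    have h7 := midAngle_pos ha hb p2
    have h8 := midAngle_pos ha hb p3
    simp only [pathAngle]
    cases k <;> cases l <;> simp only [lineAngle] at h1 ⊢ <;> linarith

lemma exists_pairPow_of_two (ha : 0 < a) (hb : 0 < b) (h2 : Real.pi / 3 < midAngle a b p2) :
    ∀ w : List Particle, ProperPath w p2 → pathAngle a b w p2 ≤ midAngle a b p3 →
      ∃ n, w = pairPow p3 p2 n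
  | [], _, _ => ⟨0, rfl⟩
  | [p1], _, h => by
    have := midAngle_pos ha hb p2
    simp only [pathAngle, lineAngle] at h
    linarith
  | [p2], h, _ => absurd rfl h.1
  | [p3], h, _ => absurd rfl h.2
  | p1 :: y :: w, _, h => by
    have := lineAngle_le_pathAngle ha hb (y :: w) p1
    have := midAngle_pos ha hb p2
    simp only [pathAngle, lineAngle] at *
    linarith
  | p2 :: _ :: _, h, _ => absurd rfl h.1
  | p3 :: p3 :: _, h, _ => absurd rfl h.2.1
  | p3 :: p1 :: w, _, h => by
    have := lineAngle_le_pathAngle ha hb w p1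
    have := midAngle_pos ha hb p1
    have := midAngle_lt (a := a) (b := b) p3
    simp only [pathAngle, lineAngle] at *
    linarith [Real.pi_pos]
  | p3 :: p2 :: w, hp, h => by
    have := midAngle_pos ha hb p1
    simp only [pathAngle, lineAngle] at h
    obtain ⟨n, rfl⟩ := exists_pairPow_of_two ha hb h2 w hp.2.2 (by linarith)
    exact ⟨n + 1, (pairPow_succ _ _ _).symm⟩

lemma exists_pairPow_of_one (ha : 0 < a) (hb : 0 < b) (h2 : Real.pi / 3 < midAngle a b p2) :
    ∀ w : List Particle, ProperPath w p1 →
      pathAngle a b w p1 ≤ Real.pi - 2 * midAngle a b p3 →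
      ∃ n, w = pairPow p2 p1 n ∨ w = pairPow p2 p1 n ++ [p2]
  | [], _, _ => ⟨0, Or.inl rfl⟩
  | [p2], _, _ => ⟨0, Or.inr rfl⟩
  | [p1], h, _ => absurd rfl h.1
  | [p3], h, _ => absurd rfl h.2
  | p1 :: _ :: _, h, _ => absurd rfl h.1
  | p3 :: p3 :: _, h, _ => absurd rfl h.2.1
  | p2 :: p2 :: _, h, _ => absurd rfl h.2.1
  | p3 :: p1 :: w, _, h => by
    have := lineAngle_le_pathAngle ha hb w p1
    have := midAngle_pos ha hb p3
    simp only [pathAngle, lineAngle] at *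
    linarith
  | p3 :: p2 :: w, _, h => by
    have := lineAngle_le_pathAngle ha hb w p2
    have := midAngle_sum ha hb
    have := midAngle_lt (a := a) (b := b) p2
    simp only [pathAngle, lineAngle] at *
    linarith [Real.pi_pos]
  | p2 :: p3 :: [], h, _ => absurd rfl h.2.2
  | p2 :: p3 :: p3 :: _, h, _ => absurd rfl h.2.2.1
  | p2 :: p3 :: p2 :: w, _, h => by
    have := lineAngle_le_pathAngle ha hb w p2
    have := midAngle_sum ha hb
    have := midAngle_lt (a := a) (b := b) p2
    simp only [pathAngle, lineAngle] at *
    linarith [Real.pi_pos]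
  | p2 :: p3 :: p1 :: w, _, h => by
    have := lineAngle_le_pathAngle ha hb w p1
    have := midAngle_sum ha hb
    have := midAngle_pos ha hb p3
    have := midAngle_pos ha hb p2
    simp only [pathAngle, lineAngle] at *
    linarith [Real.pi_pos]
  | p2 :: p1 :: w, hp, h => by
    have := midAngle_pos ha hb p3
    simp only [pathAngle, lineAngle] at h
    obtain ⟨n, h⟩ := exists_pairPow_of_one ha hb h2 w hp.2.2 (by linarith)
    refine ⟨n + 1, h.imp (fun h => ?_) (fun h => ?_)⟩
    · rw [h, pairPow_succ]
    · rw [h, pairPow_succ]; rfl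

/-- Where the double collision (31) is impossible, only the single collision and the sequences of
the four shuttle types can lead to capture. -/
theorem CaptureAllowed.mem_seqs (ha : 0 < a) (hb : 0 < b) (h2 : Real.pi / 3 < midAngle a b p2)
    {w : List Particle} (h : CaptureAllowed a b w) : w = [p2] ∨ w ∈ upperSeqs ∪ lowerSeqs := by
  obtain ⟨hne, hp, hle⟩ := h.pathAngle_le ha hb
  clear h
  have sum := midAngle_sum ha hb
  have lt2 := midAngle_lt (a := a) (b := b) p2
  have W1 := midAngle_pos ha hb p1
  have W3 := midAngle_pos ha hb p3
  match w with
  | [] => exact absurd rfl hne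
  | [p2] => exact Or.inl rfl
  | [p1] => exact absurd rfl hp.1
  | [p3] => exact absurd rfl hp.2
  | p1 :: _ :: _ => exact absurd rfl hp.1
  | p2 :: p2 :: _ => exact absurd rfl hp.2.1
  | p3 :: p3 :: _ => exact absurd rfl hp.2.1
  | p3 :: p1 :: w =>
    have := lineAngle_le_pathAngle ha hb w p1
    simp only [pathAngle, lineAngle] at *
    linarith
  | p3 :: p2 :: w =>
    simp only [pathAngle, lineAngle] at hle
    obtain ⟨n, rfl⟩ := exists_pairPow_of_two ha hb h2 w hp.2.2 (by linarith)
    exact Or.inr (Or.inl ⟨n + 1, by lia, Or.inl (pairPow_succ _ _ _).symm⟩)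
  | p2 :: p1 :: w =>
    simp only [pathAngle, lineAngle] at hle
    obtain ⟨n, rfl | rfl⟩ := exists_pairPow_of_one ha hb h2 w hp.2.2 (by linarith)
    · exact Or.inr (Or.inr ⟨n + 1, by lia, Or.inl (pairPow_succ _ _ _).symm⟩)
    · exact Or.inr (Or.inr ⟨n + 1, by lia, Or.inr (by rw [seq212, pairPow_succ]; rfl)⟩)
  | p2 :: p3 :: [] => exact absurd rfl hp.2.2
  | p2 :: p3 :: p3 :: _ => exact absurd rfl hp.2.2.1
  | p2 :: p3 :: p1 :: w =>
    have := lineAngle_le_pathAngle ha hb w p1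
    simp only [pathAngle, lineAngle] at *
    linarith
  | p2 :: p3 :: p2 :: w =>
    simp only [pathAngle, lineAngle] at hle
    -- What remains is at most π − ω₃ − 2ω₁ = ω₂ − ω₁, which is below ω₃ since ω₂ is acute.
    obtain ⟨n, rfl⟩ := exists_pairPow_of_two ha hb h2 w hp.2.2.2 (by linarith)
    exact Or.inr (Or.inl ⟨n + 1, by lia, Or.inr (by rw [seq232, pairPow_succ])⟩)

end Uniqueness

/-! ### Margins, bands and their zero curves. -/

/-- The amount by which the alternating angle (`ω₂` for even, `ω₃` for odd `k`) exceeds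
`k` times the first one. -/
def margin (k : ℕ) (p : ℝ × ℝ) : ℝ :=
  (if Even k then midAngle p.1 p.2 p2 else midAngle p.1 p.2 p3) - k * midAngle p.1 p.2 p1

/-- The region between the `k`-th and the next curve. -/
def band (k : ℕ) : Set (ℝ × ℝ) := {p | p ∈ massQuadrant ∧ 0 < margin k p ∧ margin (k + 1) p ≤ 0}

/-- The `k`-th curve. -/
def marginCurve (k : ℕ) : Set (ℝ × ℝ) := {p | p ∈ massQuadrant ∧ margin k p = 0}

section Margin

variable {p : ℝ × ℝ} {a b b' : ℝ}

lemma margin_even (n : ℕ) (p : ℝ × ℝ) :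
    margin (2 * n) p = midAngle p.1 p.2 p2 - (2 * n) * midAngle p.1 p.2 p1 := by
  simp [margin]

lemma margin_odd (n : ℕ) (p : ℝ × ℝ) :
    margin (2 * n + 1) p = midAngle p.1 p.2 p3 - (2 * n + 1) * midAngle p.1 p.2 p1 := by
  have : ¬ Even (2 * n + 1) := by simp
  simp [margin, this]

/-- The two alternating angles add up to π − ω₁ and are acute, so either exceeds the other minus ω₁.
-/
lemma margin_pos_of_succ (hp : p ∈ massQuadrant) {k : ℕ} (h : 0 ≤ margin (k + 1) p) :
    0 < margin k p := by
  have sum := midAngle_sum hp.1 hp.2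
  have l2 := midAngle_lt (a := p.1) (b := p.2) p2
  have l3 := midAngle_lt (a := p.1) (b := p.2) p3
  rcases Nat.even_or_odd' k with ⟨n, rfl | rfl⟩
  · rw [margin_odd] at h; rw [margin_even]; linarith
  · rw [show 2 * n + 1 + 1 = 2 * (n + 1) by ring, margin_even] at h
    rw [margin_odd]; push_cast at h; linarith

lemma margin_pos_of_le (hp : p ∈ massQuadrant) {k l : ℕ} (hkl : k ≤ l) (h : 0 < margin l p) :
    0 < margin k p := by
  induction l, hkl using Nat.le_induction with
  | base => exact h
  | succ l _ ih => exact ih (margin_pos_of_succ hp h.le)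

lemma disjoint_band {k l : ℕ} (hkl : k < l) : Disjoint (band k) (band l) := by
  rw [Set.disjoint_left]
  rintro p ⟨hp, -, h⟩ ⟨-, h', -⟩
  exact absurd (margin_pos_of_le hp hkl h') (by simpa using h)

lemma continuousOn_midAngle (k : Particle) :
    ContinuousOn (fun p : ℝ × ℝ => midAngle p.1 p.2 k) massQuadrant := by
  cases k <;> simp only [midAngle] <;>
    refine Real.continuous_arctan.comp_continuousOn (ContinuousOn.sqrt ?_) <;>
    refine ContinuousOn.div (by fun_prop) (by fun_prop) fun p hp => ?_
  · exact hp.2.ne'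
  · exact (mul_pos hp.1 hp.2).ne'
  · exact hp.1.ne'

lemma continuousOn_margin (k : ℕ) : ContinuousOn (margin k) massQuadrant := by
  unfold margin
  split_ifs
  · exact (continuousOn_midAngle p2).sub (continuousOn_const.mul (continuousOn_midAngle p1))
  · exact (continuousOn_midAngle p3).sub (continuousOn_const.mul (continuousOn_midAngle p1))

lemma isOpen_massQuadrant : IsOpen massQuadrant :=
  (isOpen_lt continuous_const continuous_fst).inter (isOpen_lt continuous_const continuous_snd)

lemma isOpen_margin_pos (k : ℕ) : IsOpen {p | p ∈ massQuadrant ∧ 0 < margin k p} :=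
  (continuousOn_margin k).isOpen_inter_preimage isOpen_massQuadrant isOpen_Ioi

lemma isOpen_margin_neg (k : ℕ) : IsOpen {p | p ∈ massQuadrant ∧ margin k p < 0} :=
  (continuousOn_margin k).isOpen_inter_preimage isOpen_massQuadrant isOpen_Iio

lemma midAngle_one_lt (ha : 0 < a) (hb : 0 < b) (h : b < b') :
    midAngle a b' p1 < midAngle a b p1 := by
  have hb' := hb.trans h
  refine Real.arctan_strictMono (Real.sqrt_lt_sqrt (by positivity) ?_)
  rw [div_lt_div_iff₀ hb' hb]
  nlinarith [mul_pos ha (sub_pos.2 h), mul_pos (mul_pos ha ha) (sub_pos.2 h)]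

lemma midAngle_three_lt (ha : 0 < a) (hb : 0 < b) (h : b < b') :
    midAngle a b p3 < midAngle a b' p3 := by
  have hb' := hb.trans h
  refine Real.arctan_strictMono (Real.sqrt_lt_sqrt (by positivity) ?_)
  rw [div_lt_div_iff_of_pos_right ha]
  nlinarith

/-- The quotient tan(kx) / tan x is (r+1)/(r−1) with r = sin((k+1)x) / sin((k−1)x), which decreases
by `sin_mul_lt_sin_mul`. -/
lemma tan_mul_lt {k x y : ℝ} (hk : 1 < k) (hy : 0 < y) (hyx : y < x) (hx : k * x < Real.pi / 2) :
    Real.tan (k * y) * Real.tan x < Real.tan (k * x) * Real.tan y := by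
  have hx0 := hy.trans hyx
  have h := sin_mul_lt_sin_mul (p := k - 1) (q := k + 1) (by linarith) (by linarith) hy hyx
    (by nlinarith)
  have hky : k * y < Real.pi / 2 := by nlinarith
  have hky0 : 0 < k * y := by positivity
  have hkx0 : 0 < k * x := by positivity
  have hx1 : x < Real.pi / 2 := by nlinarith
  have c1 := Real.cos_pos_of_mem_Ioo ⟨by linarith, hx⟩
  have c2 := Real.cos_pos_of_mem_Ioo ⟨by linarith, hky⟩
  have c3 := Real.cos_pos_of_mem_Ioo ⟨by linarith, hx1⟩
  have c4 := Real.cos_pos_of_mem_Ioo ⟨by linarith, hyx.trans hx1⟩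
  simp only [add_mul, sub_mul, one_mul, Real.sin_add, Real.sin_sub] at h
  simp only [Real.tan_eq_sin_div_cos]
  rw [div_mul_div_comm, div_mul_div_comm, div_lt_div_iff₀ (by positivity) (by positivity)]
  nlinarith

/-- As b grows, ω₁ falls and ω₃ rises, which settles odd k. For even k, tan ω₁ / tan ω₂ = a stays
fixed while tan(kω₁) / tan ω₁ falls with ω₁. -/
lemma margin_pos_of_lt {k : ℕ} (hk : 1 ≤ k) (ha : 0 < a) (hb : 0 < b) (h : b < b')
    (hm : 0 ≤ margin k (a, b)) : 0 < margin k (a, b') := by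
  have hb' := hb.trans h
  have h1 := midAngle_one_lt ha hb h
  rcases Nat.even_or_odd' k with ⟨n, rfl | rfl⟩
  · rw [margin_even] at *
    have hn : (1 : ℝ) ≤ n := by exact_mod_cast (by lia : 1 ≤ n)
    simp only at *
    set x := midAngle a b p1
    set y := midAngle a b' p1
    have hy : 0 < y := midAngle_pos ha hb' p1
    have hx : 0 < x := midAngle_pos ha hb p1
    have l2 := midAngle_lt (a := a) (b := b) p2
    have key := tan_mul_lt (k := 2 * n) (by linarith) hy h1 (by linarith)
    have hx1 : x < Real.pi / 2 := midAngle_lt p1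
    have e1 : Real.tan x = a * Real.tan (midAngle a b p2) := tan_midAngle_one ha hb
    have e2 : Real.tan y = a * Real.tan (midAngle a b' p2) := tan_midAngle_one ha hb'
    have tx : 0 < Real.tan x := Real.tan_pos_of_pos_of_lt_pi_div_two hx hx1
    have ty : 0 < Real.tan y := Real.tan_pos_of_pos_of_lt_pi_div_two hy (h1.trans hx1)
    have hle : Real.tan (2 * n * x) ≤ Real.tan (midAngle a b p2) :=
      Real.strictMonoOn_tan.monotoneOn ⟨by nlinarith, by linarith⟩
        ⟨by nlinarith, by linarith⟩ (by linarith)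
    have hlt : Real.tan (2 * n * y) < Real.tan (midAngle a b' p2) := by
      have h3 : Real.tan (2 * n * y) * Real.tan x < Real.tan (midAngle a b' p2) * Real.tan x :=
        calc _ < Real.tan (2 * n * x) * Real.tan y := key
          _ ≤ Real.tan (midAngle a b p2) * Real.tan y := mul_le_mul_of_nonneg_right hle ty.le
          _ = _ := by rw [e1, e2]; ring
      exact lt_of_mul_lt_mul_right h3 tx.le
    have := (Real.strictMonoOn_tan.lt_iff_lt (a := 2 * n * y) (b := midAngle a b' p2)
      ⟨by nlinarith, by nlinarith⟩ ⟨by linarith [midAngle_pos ha hb' p2], midAngle_lt p2⟩).1 hlt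
    linarith
  · rw [margin_odd] at *
    have h3 := midAngle_three_lt ha hb h
    have : (0 : ℝ) ≤ 2 * n + 1 := by positivity
    simp only at *
    nlinarith

/-- On a = b the triangle is isosceles, ω₁ = ω₃ > π/4, so ω₂ < 2ω₁. -/
lemma margin_diag_nonpos {k : ℕ} (hk : 1 ≤ k) (ha : 0 < a) : margin k (a, a) ≤ 0 := by
  have e13 : midAngle a a p3 = midAngle a a p1 := rfl
  have pos := midAngle_pos ha ha p1
  rcases Nat.even_or_odd' k with ⟨n, rfl | rfl⟩
  · rw [margin_even]
    have hn : (1 : ℝ) ≤ n := by exact_mod_cast (by lia : 1 ≤ n)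
    have sum := midAngle_sum ha ha
    have h4 : Real.pi / 4 < midAngle a a p1 := by
      rw [← Real.arctan_one]
      refine Real.arctan_strictMono (Real.lt_sqrt_of_sq_lt ?_)
      rw [lt_div_iff₀ ha]; nlinarith
    simp only; nlinarith
  · rw [margin_odd]
    have : (0 : ℝ) ≤ n := by positivity
    simp only; rw [e13]; nlinarith

lemma lt_of_margin_pos {k : ℕ} (hk : 1 ≤ k) (hp : p ∈ massQuadrant) (h : 0 < margin k p) :
    p.1 < p.2 := by
  by_contra hle
  push Not at hle
  have hd := margin_diag_nonpos hk hp.1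
  rcases hle.eq_or_lt with he | hlt
  · have : p = (p.1, p.1) := Prod.ext rfl he
    rw [this] at h
    exact absurd h (by simpa using hd)
  · have := margin_pos_of_lt hk hp.1 hp.2 hlt h.le
    linarith

lemma margin_one_pos_iff (hp : p ∈ massQuadrant) : 0 < margin 1 p ↔ p.1 < p.2 := by
  refine ⟨lt_of_margin_pos le_rfl hp, fun h => ?_⟩
  have : 0 ≤ margin 1 (p.1, p.1) := by
    have := margin_odd 0 (p.1, p.1)
    rw [mul_zero, zero_add] at this
    rw [this]
    simp [midAngle]
  exact margin_pos_of_lt le_rfl hp.1 hp.1 h this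

lemma exists_margin_eq_zero_below {k : ℕ} (hk : 1 ≤ k) (hp : p ∈ massQuadrant)
    (h : 0 < margin k p) : ∃ y, (p.1, y) ∈ marginCurve k ∧ y < p.2 := by
  have hlt := lt_of_margin_pos hk hp h
  have hc : ContinuousOn (fun y => margin k (p.1, y)) (Icc p.1 p.2) :=
    (continuousOn_margin k).comp (by fun_prop) fun y hy => ⟨hp.1, lt_of_lt_of_le hp.1 hy.1⟩
  obtain ⟨y, hy, hy0⟩ := intermediate_value_Icc hlt.le hc ⟨margin_diag_nonpos hk hp.1, h.le⟩
  refine ⟨y, ⟨⟨hp.1, lt_of_lt_of_le hp.1 hy.1⟩, hy0⟩, lt_of_le_of_ne hy.2 fun he => ?_⟩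
  rw [he] at hy0
  exact h.ne' hy0

lemma mem_strictlyAbove_iff {k : ℕ} (hk : 1 ≤ k) (hp : p ∈ massQuadrant) :
    p ∈ strictlyAbove (marginCurve k) ↔ 0 < margin k p := by
  refine ⟨fun ⟨y, hy, hlt⟩ => ?_, exists_margin_eq_zero_below hk hp⟩
  exact margin_pos_of_lt hk hp.1 hy.1.2 hlt hy.2.ge

lemma band_eq {k : ℕ} (hk : 1 ≤ k) :
    band k = between (marginCurve k) (marginCurve (k + 1)) ∩ massQuadrant := by
  ext p
  constructor
  · rintro ⟨hp, h1, h2⟩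
    exact ⟨⟨(mem_strictlyAbove_iff hk hp).2 h1,
      fun h => absurd ((mem_strictlyAbove_iff (by lia) hp).1 h) (by simpa using h2)⟩, hp⟩
  · rintro ⟨⟨h1, h2⟩, hp⟩
    exact ⟨hp, (mem_strictlyAbove_iff hk hp).1 h1,
      not_lt.1 fun h => h2 ((mem_strictlyAbove_iff (by lia) hp).2 h)⟩

lemma tendsto_vertical (p : ℝ × ℝ) : Tendsto (fun y => (p.1, y)) (𝓝[>] p.2) (𝓝 p) :=
  (((Continuous.prodMk_right p.1).tendsto p.2).mono_left nhdsWithin_le_nhds)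

/-- Going up from the lower curve enters the band and from the upper one leaves it, by
`margin_pos_of_lt`; off the curves continuity decides. -/
lemma frontier_band {k : ℕ} (hk : 1 ≤ k) :
    frontier (band k) ∩ massQuadrant = marginCurve k ∪ marginCurve (k + 1) := by
  ext p
  constructor
  · rintro ⟨⟨hcl, hint⟩, hp⟩
    have h1 : 0 ≤ margin k p := by
      by_contra h
      obtain ⟨q, ⟨-, hq⟩, -, hq', -⟩ :=
        mem_closure_iff.1 hcl _ (isOpen_margin_neg k) ⟨hp, not_le.1 h⟩
      linarith
    have h2 : margin (k + 1) p ≤ 0 := by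
      by_contra h
      obtain ⟨q, ⟨-, hq⟩, -, -, hq'⟩ :=
        mem_closure_iff.1 hcl _ (isOpen_margin_pos (k + 1)) ⟨hp, not_le.1 h⟩
      linarith
    rcases h1.eq_or_lt with h1 | h1
    · exact Or.inl ⟨hp, h1.symm⟩
    rcases h2.eq_or_lt with h2 | h2
    · exact Or.inr ⟨hp, h2⟩
    refine absurd (mem_interior.2 ⟨_, ?_, (isOpen_margin_pos k).inter (isOpen_margin_neg (k + 1)),
      ⟨hp, h1⟩, hp, h2⟩) hint
    rintro q ⟨⟨hq, hq1⟩, -, hq2⟩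
    exact ⟨hq, hq1, hq2.le⟩
  · have hev : ∀ l, 1 ≤ l → p ∈ massQuadrant → 0 ≤ margin l p →
        ∀ᶠ y in 𝓝[>] p.2, 0 < margin l (p.1, y) := fun l hl hp hm => by
      filter_upwards [self_mem_nhdsWithin] with y hy
      exact margin_pos_of_lt hl hp.1 hp.2 hy hm
    rintro (⟨hp, h⟩ | ⟨hp, h⟩)
    · have h2 : margin (k + 1) p < 0 := by
        by_contra h2
        exact (margin_pos_of_succ hp (not_lt.1 h2)).ne' h
      refine ⟨⟨mem_closure_of_tendsto (tendsto_vertical p) ?_, fun hint => ?_⟩, hp⟩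
      · filter_upwards [hev k hk hp h.ge,
          (tendsto_vertical p).eventually ((isOpen_margin_neg (k + 1)).mem_nhds ⟨hp, h2⟩)]
          with y hy1 hy2
        exact ⟨hy2.1, hy1, hy2.2.le⟩
      · exact (interior_subset hint).2.1.ne' h
    · have h1 := margin_pos_of_succ hp h.ge
      refine ⟨⟨subset_closure ⟨hp, h1, h.le⟩, fun hint => ?_⟩, hp⟩
      have := (tendsto_vertical p).eventually (isOpen_interior.mem_nhds hint)
      obtain ⟨y, hy1, hy2⟩ := (this.and (hev (k + 1) (by lia) hp h.ge)).exists
      exact absurd (interior_subset hy1).2.2 (by simpa using hy2)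

/-- For small a the angle ω₁ is small while ω₂, ω₃ ≥ π/4; at a = b the margin is nonpositive. -/
lemma exists_mem_marginCurve {k : ℕ} (hk : 1 ≤ k) (hb : 0 < b) :
    ∃ a, (a, b) ∈ marginCurve k := by
  set g : ℝ → ℝ := fun a => k * midAngle a b p1 with hg
  have hgc : Continuous g := by
    simp only [hg, midAngle]
    exact continuous_const.mul (Real.continuous_arctan.comp (by fun_prop))
  have hg0 : g 0 = 0 := by simp [hg, midAngle]
  have hev : ∀ᶠ a in 𝓝[>] (0 : ℝ), g a < Real.pi / 4 ∧ a < 1 ∧ a < b ∧ 0 < a := by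
    have h1 : ∀ᶠ a in 𝓝 (0 : ℝ), g a < Real.pi / 4 ∧ a < 1 ∧ a < b :=
      (hgc.continuousAt.eventually_lt continuousAt_const (by rw [hg0]; positivity)).and
        ((eventually_lt_nhds one_pos).and (eventually_lt_nhds hb))
    filter_upwards [nhdsWithin_le_nhds h1, self_mem_nhdsWithin] with a h2 h3
    exact ⟨h2.1, h2.2.1, h2.2.2, h3⟩
  obtain ⟨a₀, h1, h2, h3, h4⟩ := hev.exists
  have hpos : 0 ≤ margin k (a₀, b) := by
    have w2 : Real.pi / 4 ≤ midAngle a₀ b p2 := by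
      rw [← Real.arctan_one]
      refine Real.arctan_mono (Real.le_sqrt_of_sq_le ?_)
      rw [le_div_iff₀ (by positivity)]; nlinarith
    have w3 : Real.pi / 4 ≤ midAngle a₀ b p3 := by
      rw [← Real.arctan_one]
      refine Real.arctan_mono (Real.le_sqrt_of_sq_le ?_)
      rw [le_div_iff₀ (by positivity)]; nlinarith
    simp only [hg] at h1
    unfold margin
    split_ifs <;> simp only <;> linarith
  have hc : ContinuousOn (fun a => margin k (a, b)) (Icc a₀ b) :=
    (continuousOn_margin k).comp (by fun_prop) fun y hy => ⟨lt_of_lt_of_le h4 hy.1, hb⟩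
  obtain ⟨a, ha, ha0⟩ := intermediate_value_Icc' h3.le hc ⟨margin_diag_nonpos hk hb, hpos⟩
  exact ⟨a, ⟨lt_of_lt_of_le h4 ha.1, hb⟩, ha0⟩

lemma interior_band_nonempty {k : ℕ} (hk : 1 ≤ k) : (interior (band k)).Nonempty := by
  obtain ⟨a, hp, h⟩ := exists_mem_marginCurve hk one_pos
  have h2 : margin (k + 1) (a, 1) < 0 := by
    by_contra h2
    exact (margin_pos_of_succ hp (not_lt.1 h2)).ne' h
  have h3 := (tendsto_vertical (a, 1)).eventually ((isOpen_margin_neg (k + 1)).mem_nhds ⟨hp, h2⟩)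
  obtain ⟨y, hy, hy'⟩ := (h3.and self_mem_nhdsWithin).exists
  refine ⟨(a, y), mem_interior.2 ⟨_, ?_, (isOpen_margin_pos k).inter (isOpen_margin_neg (k + 1)),
    ⟨hy.1, margin_pos_of_lt hk hp.1 hp.2 hy' h.ge⟩, hy⟩⟩
  rintro q ⟨⟨hq, hq1⟩, -, hq2⟩
  exact ⟨hq, hq1, hq2.le⟩

lemma exists_mem_band (hp : p ∈ massQuadrant) (h : p.1 < p.2) : ∃ k, p ∈ band (k + 1) := by
  have hex : ∃ k, margin (k + 1 + 1) p ≤ 0 := by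
    have pos := midAngle_pos hp.1 hp.2 p1
    obtain ⟨n, hn⟩ := exists_nat_gt (Real.pi / 2 / midAngle p.1 p.2 p1)
    rw [div_lt_iff₀ pos] at hn
    refine ⟨n, ?_⟩
    have l2 := midAngle_lt (a := p.1) (b := p.2) p2
    have l3 := midAngle_lt (a := p.1) (b := p.2) p3
    unfold margin
    push_cast
    split_ifs <;> nlinarith
  classical
  -- The first sign change. At index 0 the positive margin is `margin 1`, that is a < b.
  refine ⟨Nat.find hex, hp, ?_, Nat.find_spec hex⟩
  rcases Nat.eq_zero_or_pos (Nat.find hex) with h0 | h0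
  · rw [h0]; exact (margin_one_pos_iff hp).2 h
  · have := Nat.find_min hex (Nat.sub_lt h0 one_pos)
    rw [show Nat.find hex - 1 + 1 = Nat.find hex by lia] at this
    exact not_le.1 this

end Margin

/-! ### Parametrisation and asymptotes of the curves. -/

section Curves

lemma cot_nat_mul_pi_add (n : ℕ) (x : ℝ) : Real.cot (n * Real.pi + x) = Real.cot x := by
  have h : ((-1 : ℝ)) ^ n ≠ 0 := by simp
  rw [Real.cot_eq_cos_div_sin, Real.cot_eq_cos_div_sin, add_comm, Real.cos_add_nat_mul_pi,
    Real.sin_add_nat_mul_pi, mul_div_mul_left _ _ h]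

lemma cot_pi_div_two_sub (x : ℝ) : Real.cot (Real.pi / 2 - x) = Real.tan x := by
  rw [Real.cot_eq_cos_div_sin, Real.cos_pi_div_two_sub, Real.sin_pi_div_two_sub,
    Real.tan_eq_sin_div_cos]

lemma cot_neg (x : ℝ) : Real.cot (-x) = -Real.cot x := by
  rw [Real.cot_eq_cos_div_sin, Real.cot_eq_cos_div_sin, Real.cos_neg, Real.sin_neg, div_neg]

lemma cot_eq_inv_tan (x : ℝ) : Real.cot x = (Real.tan x)⁻¹ := by
  rw [Real.cot_eq_cos_div_sin, Real.tan_eq_sin_div_cos, inv_div]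

/-- Every acute triangle is the triangle of angles of a pair of mass ratios. -/
lemma midAngle_tan_div_tan {x y z : ℝ} (hx : 0 < x) (hx' : x < Real.pi / 2) (hy : 0 < y)
    (hy' : y < Real.pi / 2) (hz : 0 < z) (hz' : z < Real.pi / 2) (h : x + y + z = Real.pi) :
    (Real.tan x / Real.tan y, Real.tan z / Real.tan y) ∈ massQuadrant ∧
    midAngle (Real.tan x / Real.tan y) (Real.tan z / Real.tan y) p1 = x ∧
    midAngle (Real.tan x / Real.tan y) (Real.tan z / Real.tan y) p2 = y ∧
    midAngle (Real.tan x / Real.tan y) (Real.tan z / Real.tan y) p3 = z := by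
  have tx := Real.tan_pos_of_pos_of_lt_pi_div_two hx hx'
  have ty := Real.tan_pos_of_pos_of_lt_pi_div_two hy hy'
  have tz := Real.tan_pos_of_pos_of_lt_pi_div_two hz hz'
  have sum : Real.tan x + Real.tan y + Real.tan z = Real.tan x * Real.tan y * Real.tan z := by
    have cx := (Real.cos_pos_of_mem_Ioo ⟨by linarith, hx'⟩).ne'
    have cy := (Real.cos_pos_of_mem_Ioo ⟨by linarith, hy'⟩).ne'
    have cz := (Real.cos_pos_of_mem_Ioo ⟨by linarith, hz'⟩).ne'
    have s := Real.sin_pi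
    rw [← h, Real.sin_add, Real.sin_add, Real.cos_add] at s
    simp only [Real.tan_eq_sin_div_cos]
    field_simp
    linear_combination s
  have harc : ∀ {t T : ℝ}, 0 < t → t < Real.pi / 2 → T = Real.tan t ^ 2 →
      Real.arctan (√T) = t := by
    intro t T h0 h1 hT
    rw [hT, Real.sqrt_sq (Real.tan_pos_of_pos_of_lt_pi_div_two h0 h1).le,
      Real.arctan_tan (by linarith) h1]
  refine ⟨⟨by positivity, by positivity⟩, harc hx hx' ?_, harc hy hy' ?_, harc hz hz' ?_⟩
  all_goals
    field_simp
    rw [add_comm (Real.tan y), sum] <;> ring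

/-- Put θ = π − 2ω₁. On the curve ω₃ = (2n+1)ω₁ and ω₂ = π − (2n+2)ω₁, and a, b are quotients of
tangents. The range of θ says that ω₂ and ω₃ are acute. -/
lemma oddCurve_eq (n : ℕ) : oddCurve (n + 1) = marginCurve (2 * n + 1) := by
  have hpi := Real.pi_pos
  have form : ∀ x : ℝ,
      Real.cot ((Real.pi - 2 * x) / 2) * Real.cot ((n + 1 : ℕ) * (Real.pi - 2 * x)) =
        Real.tan x / Real.tan (Real.pi - (2 * n + 2) * x) ∧
      Real.cot ((n + 1 : ℕ) * (Real.pi - 2 * x)) *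
        Real.cot (((n + 1 : ℕ) - 1 / 2) * (Real.pi - 2 * x)) =
        Real.tan ((2 * n + 1) * x) / Real.tan (Real.pi - (2 * n + 2) * x) := by
    intro x
    rw [show (Real.pi - 2 * x) / 2 = Real.pi / 2 - x by ring, cot_pi_div_two_sub,
      show ((n + 1 : ℕ) : ℝ) * (Real.pi - 2 * x) = n * Real.pi + (Real.pi - (2 * n + 2) * x) by
        push_cast; ring, cot_nat_mul_pi_add,
      show (((n + 1 : ℕ) : ℝ) - 1 / 2) * (Real.pi - 2 * x) =
        n * Real.pi + (Real.pi / 2 - (2 * n + 1) * x) by push_cast; ring,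
      cot_nat_mul_pi_add, cot_pi_div_two_sub, cot_eq_inv_tan]
    exact ⟨by rw [div_eq_mul_inv], by rw [div_eq_mul_inv, mul_comm]⟩
  ext p
  constructor
  · rintro ⟨θ, ⟨h1, h2⟩, e1, e2⟩
    obtain ⟨x, rfl⟩ : ∃ x, θ = Real.pi - 2 * x := ⟨(Real.pi - θ) / 2, by ring⟩
    obtain ⟨f1, f2⟩ := form x
    rw [f1] at e1; rw [f2] at e2
    push_cast at h1 h2
    rw [div_lt_iff₀ (by linarith [(n.cast_nonneg : (0 : ℝ) ≤ n)])] at h1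
    rw [lt_div_iff₀ (by linarith [(n.cast_nonneg : (0 : ℝ) ≤ n)])] at h2
    have hx : 0 < x := by
      have : 0 < (2 * n + 2) * x := by linarith
      exact pos_of_mul_pos_right this (by positivity)
    have hnx : 0 ≤ n * x := by positivity
    obtain ⟨hQ, m1, m2, m3⟩ := midAngle_tan_div_tan (x := x) (y := Real.pi - (2 * n + 2) * x)
      (z := (2 * n + 1) * x) hx (by linarith) (by linarith) (by linarith)
      (by positivity) (by linarith) (by ring)
    have hp : p = (_, _) := Prod.ext e1 e2
    rw [hp]
    refine ⟨hQ, ?_⟩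
    rw [margin_odd, m1, m3]; ring
  · rintro ⟨hp, h⟩
    rw [margin_odd] at h
    have t1 := tan_midAngle_one hp.1 hp.2
    have t3 := tan_midAngle_three hp.1 hp.2
    have t2 := tan_midAngle_pos hp.1 hp.2 p2
    have sum := midAngle_sum hp.1 hp.2
    have l2 := midAngle_lt (a := p.1) (b := p.2) p2
    have l3 := midAngle_lt (a := p.1) (b := p.2) p3
    set x := midAngle p.1 p.2 p1
    have e3 : midAngle p.1 p.2 p3 = (2 * n + 1) * x := by linarith
    have e2 : midAngle p.1 p.2 p2 = Real.pi - (2 * n + 2) * x := by linarith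
    refine ⟨Real.pi - 2 * x, ⟨?_, ?_⟩, ?_, ?_⟩
    · push_cast
      rw [div_lt_iff₀ (by linarith [(n.cast_nonneg : (0 : ℝ) ≤ n)])]
      linarith
    · push_cast
      rw [lt_div_iff₀ (by linarith [(n.cast_nonneg : (0 : ℝ) ≤ n)])]
      linarith
    · rw [(form x).1, ← e2, t1]; field_simp
    · rw [(form x).2, ← e2, ← e3, t3]; field_simp

lemma evenCurve_eq (n : ℕ) : evenCurve (n + 1) = marginCurve (2 * n + 2) := by
  have hpi := Real.pi_pos
  have form : ∀ x : ℝ,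
      -(Real.cot ((Real.pi - 2 * x) / 2) * Real.cot ((n + 1 : ℕ) * (Real.pi - 2 * x))) =
        Real.tan x / Real.tan ((2 * n + 2) * x) ∧
      Real.cot ((n + 1 : ℕ) * (Real.pi - 2 * x)) *
        Real.cot (((n + 1 : ℕ) + 1 / 2) * (Real.pi - 2 * x)) =
        Real.tan (Real.pi - (2 * n + 3) * x) / Real.tan ((2 * n + 2) * x) := by
    intro x
    rw [show (Real.pi - 2 * x) / 2 = Real.pi / 2 - x by ring, cot_pi_div_two_sub,
      show ((n + 1 : ℕ) : ℝ) * (Real.pi - 2 * x) =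
        (n + 1 : ℕ) * Real.pi + -((2 * n + 2) * x) by push_cast; ring,
      cot_nat_mul_pi_add,
      show (((n + 1 : ℕ) : ℝ) + 1 / 2) * (Real.pi - 2 * x) =
        (n + 1 : ℕ) * Real.pi + (Real.pi / 2 - (2 * n + 3) * x) by push_cast; ring,
      cot_nat_mul_pi_add, cot_pi_div_two_sub, cot_neg, cot_eq_inv_tan, Real.tan_pi_sub]
    exact ⟨by rw [div_eq_mul_inv]; ring, by rw [div_eq_mul_inv]; ring⟩
  ext p
  constructor
  · rintro ⟨θ, ⟨h1, h2⟩, e1, e2⟩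
    obtain ⟨x, rfl⟩ : ∃ x, θ = Real.pi - 2 * x := ⟨(Real.pi - θ) / 2, by ring⟩
    obtain ⟨f1, f2⟩ := form x
    rw [f1] at e1; rw [f2] at e2
    push_cast at h1 h2
    rw [div_lt_iff₀ (by linarith [(n.cast_nonneg : (0 : ℝ) ≤ n)])] at h1
    rw [lt_div_iff₀ (by linarith [(n.cast_nonneg : (0 : ℝ) ≤ n)])] at h2
    have hx : 0 < x := by
      have : 0 < (2 * n + 3) * x := by linarith
      exact pos_of_mul_pos_right this (by positivity)
    have hnx : 0 ≤ n * x := by positivity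
    obtain ⟨hQ, m1, m2, m3⟩ := midAngle_tan_div_tan (x := x) (y := (2 * n + 2) * x)
      (z := Real.pi - (2 * n + 3) * x) hx (by linarith) (by positivity) (by linarith)
      (by linarith) (by linarith) (by ring)
    have hp : p = (_, _) := Prod.ext e1 e2
    rw [hp]
    refine ⟨hQ, ?_⟩
    rw [show 2 * n + 2 = 2 * (n + 1) by ring, margin_even, m1, m2]; push_cast; ring
  · rintro ⟨hp, h⟩
    rw [show 2 * n + 2 = 2 * (n + 1) by ring, margin_even] at h
    push_cast at h
    have t1 := tan_midAngle_one hp.1 hp.2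
    have t3 := tan_midAngle_three hp.1 hp.2
    have t2 := tan_midAngle_pos hp.1 hp.2 p2
    have sum := midAngle_sum hp.1 hp.2
    have l2 := midAngle_lt (a := p.1) (b := p.2) p2
    have l3 := midAngle_lt (a := p.1) (b := p.2) p3
    set x := midAngle p.1 p.2 p1
    have e2 : midAngle p.1 p.2 p2 = (2 * n + 2) * x := by linarith
    have e3 : midAngle p.1 p.2 p3 = Real.pi - (2 * n + 3) * x := by linarith
    refine ⟨Real.pi - 2 * x, ⟨?_, ?_⟩, ?_, ?_⟩
    · push_cast
      rw [div_lt_iff₀ (by linarith [(n.cast_nonneg : (0 : ℝ) ≤ n)])]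
      linarith
    · push_cast
      rw [lt_div_iff₀ (by linarith [(n.cast_nonneg : (0 : ℝ) ≤ n)])]
      linarith
    · rw [(form x).1, ← e2, t1]; field_simp
    · rw [(form x).2, ← e2, ← e3, t3]; field_simp

/-- The asymptote of a curve on which `ω₁` is a continuous function of `ω₃` and `a < 1`. -/
lemma hasVerticalAsymptote_marginCurve {k : ℕ} (hk : 2 ≤ k) {c d : ℝ}
    (hlin : ∀ p ∈ marginCurve k, midAngle p.1 p.2 p1 = c + d * midAngle p.1 p.2 p3)
    (h0 : 0 ≤ c + d * (Real.pi / 2)) (h1 : c + d * (Real.pi / 2) < Real.pi / 2) :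
    HasVerticalAsymptote (marginCurve k) (Real.tan (c + d * (Real.pi / 2)) ^ 2) := by
  set l : Filter (ℝ × ℝ) := comap Prod.snd atTop ⊓ 𝓟 (marginCurve k) with hl
  have hsnd : Tendsto Prod.snd l atTop := tendsto_comap.mono_left inf_le_left
  have hC : ∀ᶠ p in l, p ∈ marginCurve k := mem_inf_of_right (mem_principal_self _)
  constructor
  · rw [(atTop_basis.comap Prod.snd).inf_principal_neBot_iff]
    intro B _
    obtain ⟨a, ha⟩ := exists_mem_marginCurve (k := k) (b := max B 1) (by lia) (by positivity)
    exact ⟨(a, max B 1), le_max_left B 1, ha⟩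
  -- For k ≥ 2 the curve lies where 2ω₁ ≤ ω₂, and tan ω₁ = a tan ω₂.
  have ha1 : ∀ p ∈ marginCurve k, p.1 < 1 := by
    rintro p ⟨hp, hm⟩
    have h2 : 0 ≤ margin 2 p := by
      rcases hk.eq_or_lt with rfl | hk
      · exact hm.ge
      · refine (margin_pos_of_le hp (by lia : 2 ≤ k - 1) (margin_pos_of_succ hp ?_)).le
        rw [show k - 1 + 1 = k by lia]; exact hm.ge
    rw [show 2 = 2 * 1 by rfl, margin_even] at h2
    push_cast at h2
    have pos := midAngle_pos hp.1 hp.2 p1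
    have t1 := tan_midAngle_one hp.1 hp.2
    have t2 := tan_midAngle_pos hp.1 hp.2 p2
    have hlt : Real.tan (midAngle p.1 p.2 p1) < Real.tan (midAngle p.1 p.2 p2) :=
      Real.strictMonoOn_tan ⟨by linarith [Real.pi_pos], midAngle_lt _⟩
        ⟨by linarith [Real.pi_pos], midAngle_lt _⟩ (by linarith)
    rw [t1] at hlt
    by_contra h
    nlinarith
  -- From a < 1 follows tan² ω₃ ≥ b², so ω₃ is squeezed between arctan b and π/2.
  have hω3 : Tendsto (fun p : ℝ × ℝ => midAngle p.1 p.2 p3) l (𝓝 (Real.pi / 2)) := by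
    have h2 : Tendsto (fun p : ℝ × ℝ => Real.arctan p.2) l (𝓝 (Real.pi / 2)) :=
      (Real.tendsto_arctan_atTop.mono_right nhdsWithin_le_nhds).comp hsnd
    refine tendsto_of_tendsto_of_tendsto_of_le_of_le' h2 tendsto_const_nhds ?_
      (Eventually.of_forall fun p => (midAngle_lt p3).le)
    filter_upwards [hC] with p hp
    have ha := hp.1.1
    have hb := hp.1.2
    have h1 := ha1 p hp
    refine Real.arctan_mono (Real.le_sqrt_of_sq_le ?_)
    rw [le_div_iff₀ ha]
    nlinarith [mul_pos ha hb, mul_pos (mul_pos hb hb) (sub_pos.2 h1)]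
  have hω1 : Tendsto (fun p : ℝ × ℝ => Real.tan (midAngle p.1 p.2 p1) ^ 2) l
      (𝓝 (Real.tan (c + d * (Real.pi / 2)) ^ 2)) := by
    have h2 : Tendsto (fun p : ℝ × ℝ => midAngle p.1 p.2 p1) l (𝓝 (c + d * (Real.pi / 2))) :=
      (tendsto_const_nhds.add (hω3.const_mul d)).congr' <| by
        filter_upwards [hC] with p hp
        exact (hlin p hp).symm
    have hcos : Real.cos (c + d * (Real.pi / 2)) ≠ 0 :=
      (Real.cos_pos_of_mem_Ioo ⟨by linarith [Real.pi_pos], h1⟩).ne'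
    exact (((Real.continuousAt_tan.2 hcos).tendsto).comp h2).pow 2
  -- The error term in a = tan² ω₁ − a(1+a)/b.
  have herr : Tendsto (fun p : ℝ × ℝ => p.1 * (1 + p.1) / p.2) l (𝓝 0) := by
    refine tendsto_of_tendsto_of_tendsto_of_le_of_le' tendsto_const_nhds
      (hsnd.const_div_atTop 2) ?_ ?_
    · filter_upwards [hC] with p hp
      have ha := hp.1.1
      have hb := hp.1.2
      positivity
    · filter_upwards [hC] with p hp
      have ha := hp.1.1
      have hb := hp.1.2
      have h1 := ha1 p hp
      rw [div_le_div_iff_of_pos_right hb]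
      nlinarith
  have := hω1.sub herr
  rw [sub_zero] at this
  refine this.congr' ?_
  filter_upwards [hC] with p hp
  have ha := hp.1.1
  have hb := hp.1.2
  rw [(tan_sq_midAngle ha hb).1]
  field_simp
  ring

end Curves

/-! ### Regions as bands, tiling and uniqueness. -/

section Regions

/-- By ω₁ + ω₂ + ω₃ = π the strict bound on ω₂ + (2n+2)ω₁ is positivity of the preceding margin. -/
lemma allowedRegion_seq32 (n : ℕ) : allowedRegion (seq32 (n + 1)) = band (2 * n + 1) := by
  ext p
  refine and_congr_right fun hp => ?_
  rw [captureAllowed_seq32_iff hp.1 hp.2, margin_odd, show 2 * n + 1 + 1 = 2 * (n + 1) by ring,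
    margin_even, and_comm]
  have := midAngle_sum hp.1 hp.2
  push_cast
  refine and_congr ⟨fun h => by linarith, fun h => by linarith⟩
    ⟨fun h => by linarith, fun h => by linarith⟩

lemma allowedRegion_seq232 (n : ℕ) : allowedRegion (seq232 (n + 1)) = band (2 * n + 2) := by
  ext p
  refine and_congr_right fun hp => ?_
  rw [captureAllowed_seq232_iff hp.1 hp.2, show 2 * n + 2 = 2 * (n + 1) by ring, margin_odd,
    margin_even, and_comm]
  have := midAngle_sum hp.1 hp.2
  push_cast
  refine and_congr ⟨fun h => by linarith, fun h => by linarith⟩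
    ⟨fun h => by linarith, fun h => by linarith⟩

lemma mem_allowedRegion_seq21 (n : ℕ) (a b : ℝ) :
    (b, a) ∈ allowedRegion (seq21 (n + 1)) ↔ (a, b) ∈ allowedRegion (seq32 (n + 1)) := by
  have hQ : (b, a) ∈ massQuadrant ↔ (a, b) ∈ massQuadrant := and_comm
  obtain ⟨-, s2, s3⟩ := midAngle_swap a b
  exact (and_congr_left' hQ).trans <| and_congr_right fun hp => by
    rw [captureAllowed_seq32_iff hp.1 hp.2, captureAllowed_seq21_iff hp.2 hp.1, s2, s3]

lemma mem_allowedRegion_seq212 (n : ℕ) (a b : ℝ) :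
    (b, a) ∈ allowedRegion (seq212 (n + 1)) ↔ (a, b) ∈ allowedRegion (seq232 (n + 1)) := by
  have hQ : (b, a) ∈ massQuadrant ↔ (a, b) ∈ massQuadrant := and_comm
  obtain ⟨s1, -, s3⟩ := midAngle_swap a b
  exact (and_congr_left' hQ).trans <| and_congr_right fun hp => by
    rw [captureAllowed_seq232_iff hp.1 hp.2, captureAllowed_seq212_iff hp.2 hp.1, s1, s3]

lemma allowedRegion_seq21 (n : ℕ) :
    allowedRegion (seq21 (n + 1)) = Prod.swap ⁻¹' band (2 * n + 1) := by
  ext ⟨a, b⟩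
  rw [mem_allowedRegion_seq21, allowedRegion_seq32]; rfl

lemma allowedRegion_seq212 (n : ℕ) :
    allowedRegion (seq212 (n + 1)) = Prod.swap ⁻¹' band (2 * n + 2) := by
  ext ⟨a, b⟩
  rw [mem_allowedRegion_seq212, allowedRegion_seq232]; rfl

/-- The sequences of collisions with particle 1 going back and forth, by their number. -/
lemma mem_upperSeqs_iff (w : List Particle) : w ∈ upperSeqs ↔
    ∃ n, (w = seq32 (n + 1) ∧ allowedRegion w = band (2 * n + 1)) ∨
      (w = seq232 (n + 1) ∧ allowedRegion w = band (2 * n + 2)) := by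
  constructor
  · rintro ⟨n, hn, rfl | rfl⟩ <;> obtain ⟨n, rfl⟩ := Nat.exists_eq_add_of_le' hn
    · exact ⟨n, Or.inl ⟨rfl, allowedRegion_seq32 n⟩⟩
    · exact ⟨n, Or.inr ⟨rfl, allowedRegion_seq232 n⟩⟩
  · rintro ⟨n, ⟨rfl, -⟩ | ⟨rfl, -⟩⟩
    exacts [⟨n + 1, by lia, Or.inl rfl⟩, ⟨n + 1, by lia, Or.inr rfl⟩]

lemma mem_lowerSeqs_iff (w : List Particle) : w ∈ lowerSeqs ↔
    ∃ n, (w = seq21 (n + 1) ∧ allowedRegion w = Prod.swap ⁻¹' band (2 * n + 1)) ∨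
      (w = seq212 (n + 1) ∧ allowedRegion w = Prod.swap ⁻¹' band (2 * n + 2)) := by
  constructor
  · rintro ⟨n, hn, rfl | rfl⟩ <;> obtain ⟨n, rfl⟩ := Nat.exists_eq_add_of_le' hn
    · exact ⟨n, Or.inl ⟨rfl, allowedRegion_seq21 n⟩⟩
    · exact ⟨n, Or.inr ⟨rfl, allowedRegion_seq212 n⟩⟩
  · rintro ⟨n, ⟨rfl, -⟩ | ⟨rfl, -⟩⟩
    exacts [⟨n + 1, by lia, Or.inl rfl⟩, ⟨n + 1, by lia, Or.inr rfl⟩]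

lemma iUnion_upper : (⋃ w ∈ upperSeqs, allowedRegion w) = {p : ℝ × ℝ | 0 < p.1 ∧ p.1 < p.2} := by
  ext p
  simp only [mem_iUnion, exists_prop]
  constructor
  · rintro ⟨w, hw, hp⟩
    obtain ⟨n, ⟨rfl, hr⟩ | ⟨rfl, hr⟩⟩ := (mem_upperSeqs_iff w).1 hw <;> rw [hr] at hp
    · exact ⟨hp.1.1, lt_of_margin_pos (by lia) hp.1 hp.2.1⟩
    · exact ⟨hp.1.1, lt_of_margin_pos (by lia) hp.1 hp.2.1⟩
  · rintro ⟨h0, h1⟩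
    obtain ⟨k, hk⟩ := exists_mem_band (p := p) ⟨h0, h0.trans h1⟩ h1
    obtain ⟨n, rfl | rfl⟩ := Nat.even_or_odd' k
    · exact ⟨_, (mem_upperSeqs_iff _).2 ⟨n, Or.inl ⟨rfl, allowedRegion_seq32 n⟩⟩,
        by rwa [allowedRegion_seq32]⟩
    · exact ⟨_, (mem_upperSeqs_iff _).2 ⟨n, Or.inr ⟨rfl, allowedRegion_seq232 n⟩⟩,
        by rwa [allowedRegion_seq232]⟩

lemma iUnion_lower : (⋃ w ∈ lowerSeqs, allowedRegion w) = {p : ℝ × ℝ | 0 < p.2 ∧ p.2 < p.1} := by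
  ext p
  have key := Set.ext_iff.1 iUnion_upper p.swap
  simp only [mem_iUnion, exists_prop] at key ⊢
  refine Iff.trans ⟨?_, ?_⟩ key
  · rintro ⟨w, hw, hp⟩
    obtain ⟨n, ⟨rfl, hr⟩ | ⟨rfl, hr⟩⟩ := (mem_lowerSeqs_iff w).1 hw <;> rw [hr] at hp
    · exact ⟨_, (mem_upperSeqs_iff _).2 ⟨n, Or.inl ⟨rfl, allowedRegion_seq32 n⟩⟩,
        by rwa [allowedRegion_seq32]⟩
    · exact ⟨_, (mem_upperSeqs_iff _).2 ⟨n, Or.inr ⟨rfl, allowedRegion_seq232 n⟩⟩,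
        by rwa [allowedRegion_seq232]⟩
  · rintro ⟨w, hw, hp⟩
    obtain ⟨n, ⟨rfl, hr⟩ | ⟨rfl, hr⟩⟩ := (mem_upperSeqs_iff w).1 hw <;> rw [hr] at hp
    · exact ⟨_, (mem_lowerSeqs_iff _).2 ⟨n, Or.inl ⟨rfl, allowedRegion_seq21 n⟩⟩,
        by rwa [allowedRegion_seq21]⟩
    · exact ⟨_, (mem_lowerSeqs_iff _).2 ⟨n, Or.inr ⟨rfl, allowedRegion_seq212 n⟩⟩,
        by rwa [allowedRegion_seq212]⟩

lemma disjoint_upper_lower {v w : List Particle} (hv : v ∈ upperSeqs) (hw : w ∈ lowerSeqs) :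
    Disjoint (allowedRegion v) (allowedRegion w) := by
  rw [Set.disjoint_left]
  intro p h1 h2
  have h1' : p ∈ ⋃ w ∈ upperSeqs, allowedRegion w := mem_biUnion hv h1
  have h2' : p ∈ ⋃ w ∈ lowerSeqs, allowedRegion w := mem_biUnion hw h2
  rw [iUnion_upper] at h1'
  rw [iUnion_lower] at h2'
  exact lt_asymm h1'.2 h2'.2

lemma disjoint_band_of_ne {k l : ℕ} (h : k ≠ l) : Disjoint (band k) (band l) := by
  rcases h.lt_or_gt with h | h
  · exact disjoint_band h
  · exact (disjoint_band h).symm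

lemma pairwiseDisjoint_allowedRegion : (upperSeqs ∪ lowerSeqs).PairwiseDisjoint allowedRegion := by
  rintro v (hv | hv) w (hw | hw) hne
  · obtain ⟨n, ⟨rfl, hr⟩ | ⟨rfl, hr⟩⟩ := (mem_upperSeqs_iff v).1 hv <;>
      obtain ⟨m, ⟨rfl, hr'⟩ | ⟨rfl, hr'⟩⟩ := (mem_upperSeqs_iff w).1 hw <;>
      simp only [Function.onFun, hr, hr'] <;> refine disjoint_band_of_ne fun h => ?_
    · obtain rfl : n = m := by lia
      exact hne rfl
    · lia
    · lia
    · obtain rfl : n = m := by lia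
      exact hne rfl
  · exact disjoint_upper_lower hv hw
  · exact (disjoint_upper_lower hw hv).symm
  · obtain ⟨n, ⟨rfl, hr⟩ | ⟨rfl, hr⟩⟩ := (mem_lowerSeqs_iff v).1 hv <;>
      obtain ⟨m, ⟨rfl, hr'⟩ | ⟨rfl, hr'⟩⟩ := (mem_lowerSeqs_iff w).1 hw <;>
      simp only [Function.onFun, hr, hr'] <;>
      refine Disjoint.preimage _ (disjoint_band_of_ne fun h => ?_)
    · obtain rfl : n = m := by lia
      exact hne rfl
    · lia
    · lia
    · obtain rfl : n = m := by lia
      exact hne rfl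

lemma interior_preimage_swap_nonempty {s : Set (ℝ × ℝ)} (h : (interior s).Nonempty) :
    (interior (Prod.swap ⁻¹' s)).Nonempty := by
  obtain ⟨p, hp⟩ := h
  refine ⟨p.swap, interior_maximal (preimage_mono interior_subset)
    (isOpen_interior.preimage continuous_swap) ?_⟩
  simpa using hp

lemma interior_allowedRegion_seq31_nonempty (n : ℕ) :
    (interior (allowedRegion (seq31 (n + 1)))).Nonempty := by
  have hpi := Real.pi_pos
  have hopen : IsOpen {p : ℝ × ℝ | p ∈ massQuadrant ∧
      (2 * (n + 1 : ℕ) + 1) * midAngle p.1 p.2 p2 < Real.pi} :=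
    (continuousOn_const.mul (continuousOn_midAngle p2)).isOpen_inter_preimage
      isOpen_massQuadrant isOpen_Iio
  have hx : 0 < Real.pi / (2 * (n + 1 : ℕ) + 2) := by positivity
  have hx' : Real.pi / (2 * (n + 1 : ℕ) + 2) < Real.pi / 2 := by
    apply div_lt_div_of_pos_left hpi two_pos
    push_cast
    linarith [(n.cast_nonneg : (0 : ℝ) ≤ n)]
  -- Any ω₂ strictly below π/(2n+3) would serve; the isosceles triangle realises this one.
  set y := Real.pi / (2 * (n + 1 : ℕ) + 2) with hy
  obtain ⟨hQ, -, h2, -⟩ := midAngle_tan_div_tan (x := (Real.pi - y) / 2) (y := y)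
    (z := (Real.pi - y) / 2) (by linarith) (by linarith) hx hx' (by linarith) (by linarith)
    (by ring)
  refine ⟨_, mem_interior.2 ⟨_, ?_, hopen, ⟨hQ, ?_⟩⟩⟩
  · rintro p ⟨hp, hlt⟩
    exact ⟨hp, (captureAllowed_seq31_iff hp.1 hp.2 n).2 hlt.le⟩
  · rw [h2, hy, ← mul_div_assoc, div_lt_iff₀ (by positivity)]
    nlinarith

lemma captureAllowed_seq31_one {p : ℝ × ℝ} (hp : p ∈ massQuadrant) :
    CaptureAllowed p.1 p.2 [p3, p1] ↔ midAngle p.1 p.2 p2 ≤ Real.pi / 3 := by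
  have := captureAllowed_seq31_iff hp.1 hp.2 0
  rw [show seq31 (0 + 1) = [p3, p1] from rfl] at this
  rw [this]
  push_cast
  constructor <;> intro h <;> linarith

lemma disjoint_thomasForbidden_seq31 (n : ℕ) :
    Disjoint thomasForbidden (allowedRegion (seq31 (n + 1))) := by
  rw [Set.disjoint_left]
  rintro p ⟨hp, h, -⟩ ⟨-, h'⟩
  rw [captureAllowed_seq31_one hp] at h
  rw [captureAllowed_seq31_iff hp.1 hp.2] at h'
  have pos := midAngle_pos hp.1 hp.2 p2
  have : 0 ≤ n * midAngle p.1 p.2 p2 := by positivity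
  push_cast at h'
  linarith

/-- Outside of the region of (31), exactly one collision sequence leads to capture. -/
lemma existsUnique_captureAllowed {p : ℝ × ℝ} (hp : p ∈ massQuadrant)
    (h : Real.pi / 3 < midAngle p.1 p.2 p2) : ∃! w : List Particle, CaptureAllowed p.1 p.2 w := by
  have hmem : ∀ {w}, CaptureAllowed p.1 p.2 w → w = [p2] ∨ w ∈ upperSeqs ∪ lowerSeqs :=
    fun hw => hw.mem_seqs hp.1 hp.2 h
  have hsingle : CaptureAllowed p.1 p.2 [p2] ↔ p.1 = p.2 := by
    rw [captureAllowed_single_iff hp.1 hp.2]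
    constructor
    · intro he
      have t1 := tan_midAngle_one hp.1 hp.2
      rw [he, tan_midAngle_three hp.1 hp.2] at t1
      exact (mul_right_cancel₀ (tan_midAngle_pos hp.1 hp.2 p2).ne' t1).symm
    · intro he
      rw [he]; rfl
  have hside : ∀ w ∈ upperSeqs ∪ lowerSeqs, CaptureAllowed p.1 p.2 w → p.1 ≠ p.2 := by
    rintro w (hw | hw) hc he
    · have h1 : p ∈ ⋃ w ∈ upperSeqs, allowedRegion w := mem_biUnion hw ⟨hp, hc⟩
      rw [iUnion_upper] at h1
      exact h1.2.ne he
    · have h1 : p ∈ ⋃ w ∈ lowerSeqs, allowedRegion w := mem_biUnion hw ⟨hp, hc⟩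
      rw [iUnion_lower] at h1
      exact h1.2.ne' he
  have huniq : ∀ v ∈ upperSeqs ∪ lowerSeqs, CaptureAllowed p.1 p.2 v →
      ∃! w : List Particle, CaptureAllowed p.1 p.2 w := by
    intro v hv hcv
    refine ⟨v, hcv, fun w hcw => ?_⟩
    rcases hmem hcw with rfl | hw
    · exact absurd (hsingle.1 hcw) (hside v hv hcv)
    · by_contra hne
      exact Set.disjoint_left.1 (pairwiseDisjoint_allowedRegion hw hv hne) ⟨hp, hcw⟩ ⟨hp, hcv⟩
  rcases lt_trichotomy p.1 p.2 with hlt | heq | hgt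
  · have h1 : p ∈ ⋃ w ∈ upperSeqs, allowedRegion w := by
      rw [iUnion_upper]; exact ⟨hp.1, hlt⟩
    obtain ⟨v, hv, hpv⟩ := mem_iUnion₂.1 h1
    exact huniq v (Or.inl hv) hpv.2
  · refine ⟨[p2], hsingle.2 heq, fun w hw => ?_⟩
    rcases hmem hw with rfl | hw'
    · rfl
    · exact absurd heq (hside w hw' hw)
  · have h1 : p ∈ ⋃ w ∈ lowerSeqs, allowedRegion w := by
      rw [iUnion_lower]; exact ⟨hp.2, hgt⟩
    obtain ⟨v, hv, hpv⟩ := mem_iUnion₂.1 h1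
    exact huniq v (Or.inr hv) hpv.2

/-- On both curves ω₁ is an affine function of ω₃, with the value π/(2(2n+3)) at ω₃ = π/2. -/
lemma hasVerticalAsymptote_curves (n : ℕ) :
    HasVerticalAsymptote (marginCurve (2 * n + 2))
      (Real.tan (Real.pi / (2 * (2 * (n + 1 : ℕ) + 1))) ^ 2) ∧
    HasVerticalAsymptote (marginCurve (2 * n + 3))
      (Real.tan (Real.pi / (2 * (2 * (n + 1 : ℕ) + 1))) ^ 2) := by
  have hpi := Real.pi_pos
  have hn : (0 : ℝ) < 2 * n + 3 := by positivity
  have hval : Real.pi / (2 * (2 * (n + 1 : ℕ) + 1)) = Real.pi / 2 / (2 * n + 3) := by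
    push_cast; field_simp; ring
  have h0 : 0 ≤ Real.pi / 2 / (2 * n + 3) := by positivity
  have h1 : Real.pi / 2 / (2 * n + 3) < Real.pi / 2 :=
    div_lt_self (by positivity) (by linarith [(n.cast_nonneg : (0 : ℝ) ≤ n)])
  rw [hval]
  constructor
  · have e : Real.pi / (2 * n + 3) + -1 / (2 * n + 3) * (Real.pi / 2) =
        Real.pi / 2 / (2 * n + 3) := by field_simp; ring
    rw [← e] at h0 h1 ⊢
    refine hasVerticalAsymptote_marginCurve (by lia) (fun p hp => ?_) h0 h1
    have h2 := hp.2
    rw [show 2 * n + 2 = 2 * (n + 1) by ring, margin_even] at h2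
    have sum := midAngle_sum hp.1.1 hp.1.2
    push_cast at h2
    field_simp
    linarith
  · have e : 0 + 1 / (2 * n + 3) * (Real.pi / 2) = Real.pi / 2 / (2 * n + 3) := by
      field_simp; ring
    rw [← e] at h0 h1 ⊢
    refine hasVerticalAsymptote_marginCurve (by lia) (fun p hp => ?_) h0 h1
    have h2 := hp.2
    rw [show 2 * n + 3 = 2 * (n + 1) + 1 by ring, margin_odd] at h2
    push_cast at h2
    field_simp
    linarith

lemma tendsto_asymptotes :
    Tendsto (fun m : ℕ => Real.tan (Real.pi / (2 * (2 * m + 1))) ^ 2) atTop (𝓝 0) := by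
  have h : Tendsto (fun m : ℕ => Real.pi / (2 * (2 * (m : ℝ) + 1))) atTop (𝓝 0) := by
    refine Tendsto.const_div_atTop ?_ _
    refine Tendsto.const_mul_atTop two_pos (tendsto_atTop_add_const_right _ _ ?_)
    exact Tendsto.const_mul_atTop two_pos tendsto_natCast_atTop_atTop
  have h2 : Tendsto Real.tan (𝓝 0) (𝓝 (Real.tan 0)) :=
    (Real.continuousAt_tan.2 (by simp)).tendsto
  have := (h2.comp h).pow 2
  simpa using this

end Regions

end

theorem mainTheorem3 :
    -- each process occurs in a genuine region of the diagram
    (∀ n : ℕ, 1 ≤ n →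
      (interior (allowedRegion (seq32 n))).Nonempty ∧
      (interior (allowedRegion (seq232 n))).Nonempty ∧
      (interior (allowedRegion (seq21 n))).Nonempty ∧
      (interior (allowedRegion (seq212 n))).Nonempty ∧
      (interior (allowedRegion (seq31 n))).Nonempty) ∧
    -- the regions above the diagonal lie between consecutive curves
    (∀ n : ℕ, 1 ≤ n →
      allowedRegion (seq32 n) = between (oddCurve n) (evenCurve n) ∩ massQuadrant ∧
      allowedRegion (seq232 n) = between (evenCurve n) (oddCurve (n + 1)) ∩ massQuadrant) ∧
    -- they are contiguous: these curves are exactly their boundaries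
    (∀ n : ℕ, 1 ≤ n →
      frontier (allowedRegion (seq32 n)) ∩ massQuadrant = oddCurve n ∪ evenCurve n ∧
      frontier (allowedRegion (seq232 n)) ∩ massQuadrant = evenCurve n ∪ oddCurve (n + 1)) ∧
    -- asymptotes
    (∀ n : ℕ, 1 ≤ n →
      HasVerticalAsymptote (evenCurve n) (Real.tan (Real.pi / (2 * (2 * n + 1))) ^ 2) ∧
      HasVerticalAsymptote (oddCurve (n + 1)) (Real.tan (Real.pi / (2 * (2 * n + 1))) ^ 2)) ∧
    Tendsto (fun m : ℕ => Real.tan (Real.pi / (2 * (2 * m + 1))) ^ 2) atTop (𝓝 0) ∧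
    -- non-overlapping
    (upperSeqs ∪ lowerSeqs).PairwiseDisjoint allowedRegion ∧
    -- tiling of the two halves of the diagram
    (⋃ w ∈ upperSeqs, allowedRegion w) = {p : ℝ × ℝ | 0 < p.1 ∧ p.1 < p.2} ∧
    (⋃ w ∈ lowerSeqs, allowedRegion w) = {p : ℝ × ℝ | 0 < p.2 ∧ p.2 < p.1} ∧
    -- time-reversal symmetry
    (∀ n : ℕ, 1 ≤ n → ∀ a b : ℝ,
      ((b, a) ∈ allowedRegion (seq21 n) ↔ (a, b) ∈ allowedRegion (seq32 n)) ∧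
      ((b, a) ∈ allowedRegion (seq212 n) ↔ (a, b) ∈ allowedRegion (seq232 n))) ∧
    -- the forbidden region excludes processes of the fifth type
    (∀ n : ℕ, 1 ≤ n → Disjoint thomasForbidden (allowedRegion (seq31 n))) ∧
    -- a unique capture process, among all collision sequences, for every forbidden pair
    (∀ p ∈ thomasForbidden, ∃! w : List Particle, CaptureAllowed p.1 p.2 w) := by
  refine ⟨fun n hn => ?_, fun n hn => ?_, fun n hn => ?_, fun n hn => ?_, tendsto_asymptotes,
    pairwiseDisjoint_allowedRegion, iUnion_upper, iUnion_lower, fun n hn a b => ?_,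
    fun n hn => ?_, fun p hp => ?_⟩
  · obtain ⟨n, rfl⟩ := Nat.exists_eq_add_of_le' hn
    rw [allowedRegion_seq32, allowedRegion_seq232, allowedRegion_seq21, allowedRegion_seq212]
    exact ⟨interior_band_nonempty (by lia), interior_band_nonempty (by lia),
      interior_preimage_swap_nonempty (interior_band_nonempty (by lia)),
      interior_preimage_swap_nonempty (interior_band_nonempty (by lia)),
      interior_allowedRegion_seq31_nonempty n⟩
  · obtain ⟨n, rfl⟩ := Nat.exists_eq_add_of_le' hn
    rw [allowedRegion_seq32, allowedRegion_seq232, oddCurve_eq, evenCurve_eq, oddCurve_eq]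
    exact ⟨band_eq (by lia), band_eq (by lia)⟩
  · obtain ⟨n, rfl⟩ := Nat.exists_eq_add_of_le' hn
    rw [allowedRegion_seq32, allowedRegion_seq232, oddCurve_eq, evenCurve_eq, oddCurve_eq]
    exact ⟨frontier_band (by lia), frontier_band (by lia)⟩
  · obtain ⟨n, rfl⟩ := Nat.exists_eq_add_of_le' hn
    rw [evenCurve_eq, oddCurve_eq]
    exact hasVerticalAsymptote_curves n
  · obtain ⟨n, rfl⟩ := Nat.exists_eq_add_of_le' hn
    exact ⟨mem_allowedRegion_seq21 n a b, mem_allowedRegion_seq212 n a b⟩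
  · obtain ⟨n, rfl⟩ := Nat.exists_eq_add_of_le' hn
    exact disjoint_thomasForbidden_seq31 n
  -- Failure of (31) is the inequality ω₂ > π/3.
  · exact existsUnique_captureAllowed hp.1
      (not_le.1 fun h => hp.2.1 ((captureAllowed_seq31_one hp.1).2 h))
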